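/- All varieties are complex quasi-projective varieties. A triple $(Z,E,G)$ consists of a variety $Z$ with an action of a finite group $G$ by automorphisms and a $G$-equivariant algebraic vector bundle $E\to Z$ (its rank may vary). Two triples $(Z,E,G)$ and $(Z',E',G')$ are isomorphic if there are an isomorphism of groups $\varphi:G\to G'$ and an isomorphism of varieties with vector bundles $(Z,E)\to(Z',E')$ that is equivariant relative to $\varphi$. A variety with finite groups action and equivariant vector bundle is a finite disjoint union $(\mathcal X,E)=\bigsqcup_{i}(X_i,E_i,G_i)$ of triples; two of them are equivalent if they have partitions, into finitely many locally closed pieces of the components $X_i$ that are invariant under the corresponding groups $G_i$, with pairwise isomorphic pieces (considered as triples). For an embedding $G\subset H$ of finite groups let $\mathrm{ind}_G^H Z=(H\times Z)/\!\sim$, where $(h,x)\sim(hg^{-1},gx)$ for $g\in G$, and similarly for $E$. Let $K=K_0^{\rm fGr}(\mathrm{Vect}_{\mathbb C})$ be the abelian group generated by the classes $[(\mathcal X,E)]$ of varieties with finite groups actions and equivariant vector bundles, modulo the relations (1) $[(\mathcal X,E)]=[(\mathcal Y,E')]$ if $(\mathcal X,E)$ and $(\mathcal Y,E')$ are equivalent;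 (2) $[(\mathcal X,E)]=[(\mathcal Y,E|_{\mathcal Y})]+[(\mathcal X\setminus\mathcal Y,E|_{\mathcal X\setminus\mathcal Y})]$ if $\mathcal Y\subset\mathcal X$ is Zariski closed and invariant under the groups actions; (3) $[(\mathrm{ind}_G^H Z,\mathrm{ind}_G^H E,H)]=[(Z,E,G)]$ for finite groups $G\subset H$. There is exactly one structure of a commutative ring on $K$ with the given addition in which products are given by Cartesian products, so that $[(Z_1,E_1,G_1)]\cdot[(Z_2,E_2,G_2)]=[(Z_1\times Z_2,E_1\times E_2,G_1\times G_2)]$, and whose unit is the class of the point with the trivial group and the bundle of rank $0$. Consider $K$ with this ring structure. For a triple $(Z,E,G)$ and $n\ge1$ let $G_n=G^n\rtimes S_n$ be the wreath product, acting on $Z^n$ and on the bundle $E^n\to Z^n$ (with $G^n$ acting componentwise and $S_n$ permuting the factors), and let $\Delta_G\subset Z^n$ be the set of $n$-tuples of which at least two entries lie in the same $G$-orbit. Put $$\zeta_{(Z,E,G)}(t)=1+\sum_{n\ge1}[(Z^n,E^n,G_n)]\,t^n,\qquad \lambda_{(Z,E,G)}(t)=1+\sum_{n\ge1}[(Z^n\setminus\Delta_G,\,E^n|_{Z^n\setminus\Delta_G},\,G_n)]\,t^n\quad\text{in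 }1+tK[[t]].$$ Then: (a) $\zeta_{(Z,E,G)}(t)$ and $\lambda_{(Z,E,G)}(t)$ depend only on the class $[(Z,E,G)]\in K$. (b) For triples $(Z_1,E_1,G)$ and $(Z_2,E_2,G)$ with the same finite group $G$, $$\zeta_{(Z_1\sqcup Z_2,E_1\sqcup E_2,G)}(t)=\zeta_{(Z_1,E_1,G)}(t)\,\zeta_{(Z_2,E_2,G)}(t),\qquad \lambda_{(Z_1\sqcup Z_2,E_1\sqcup E_2,G)}(t)=\lambda_{(Z_1,E_1,G)}(t)\,\lambda_{(Z_2,E_2,G)}(t).$$ (c) Each of the two series defines a $\lambda$-structure on $K$: there is exactly one map $K\to 1+tK[[t]]$, $a\mapsto\zeta_a(t)$, with $\zeta_{a+b}(t)=\zeta_a(t)\zeta_b(t)$ and $\zeta_a(t)=1+at+\dots$ for all $a,b\in K$, that takes the value $\zeta_{(Z,E,G)}(t)$ at the class of every triple $(Z,E,G)$; and likewise for $\lambda$. -/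

import Mathlib

noncomputable section

namespace FGr

/-! Complex quasi-projective varieties, in the classical language. -/

/-- The projective space of lines in `ℂ^ι`. -/
def ProjSpace (ι : Type) : Type := Projectivization ℂ (ι → ℂ)

namespace ProjSpace

variable {ι κ : Type}

/-- The point with homogeneous coordinates `v`. -/
def of (v : ι → ℂ) (hv : v ≠ 0) : ProjSpace ι := Projectivization.mk ℂ v hv

/-- A choice of homogeneous coordinates of a point. -/
def vec (x : ProjSpace ι) : ι → ℂ := Projectivization.rep x

/-- The Zariski topology: its basic open sets are the non-vanishing loci of homogeneous
polynomials. -/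
instance zariski : TopologicalSpace (ProjSpace ι) :=
  TopologicalSpace.generateFrom
    {U | ∃ (d : ℕ) (p : MvPolynomial ι ℂ), p.IsHomogeneous d ∧
      U = {x | MvPolynomial.eval x.vec p ≠ 0}}

theorem vec_ne_zero (x : ProjSpace ι) : x.vec ≠ 0 := Projectivization.rep_nonzero x

theorem exists_vec_ne_zero (x : ProjSpace ι) : ∃ i, x.vec i ≠ 0 :=
  Function.ne_iff.mp x.vec_ne_zero

theorem of_vec (x : ProjSpace ι) : of x.vec x.vec_ne_zero = x := Projectivization.mk_rep x

theorem vec_of (v : ι → ℂ) (hv : v ≠ 0) : ∃ c : ℂ, c ≠ 0 ∧ (of v hv).vec = c • v := by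
  obtain ⟨a, ha⟩ := Projectivization.exists_smul_eq_mk_rep ℂ v hv
  exact ⟨a, a.ne_zero, ha.symm⟩

theorem ext_of_smul {x y : ProjSpace ι} {c : ℂ} (h : x.vec = c • y.vec) : x = y := by
  rw [← of_vec x, ← of_vec y]
  exact (Projectivization.mk_eq_mk_iff' ℂ _ _ _ _).mpr ⟨c, h.symm⟩

theorem eval_smul {d : ℕ} {p : MvPolynomial ι ℂ} (hp : p.IsHomogeneous d) (c : ℂ) (v : ι → ℂ) :
    MvPolynomial.eval (c • v) p = c ^ d * MvPolynomial.eval v p := by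
  rw [MvPolynomial.eval_eq, MvPolynomial.eval_eq, Finset.mul_sum]
  refine Finset.sum_congr rfl fun m hm => ?_
  have hd : ∑ i ∈ m.support, m i = d := by
    have := hp.degree_eq_sum_deg_support hm
    rw [this]
  simp only [Pi.smul_apply, smul_eq_mul, mul_pow, Finset.prod_mul_distrib]
  rw [Finset.prod_pow_eq_pow_sum, hd]
  ring

theorem isOpen_ne {d : ℕ} {p : MvPolynomial ι ℂ} (hp : p.IsHomogeneous d) :
    IsOpen {x : ProjSpace ι | MvPolynomial.eval x.vec p ≠ 0} :=
  TopologicalSpace.isOpen_generateFrom_of_mem ⟨d, p, hp, rfl⟩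

theorem isClosed_eq {d : ℕ} {p : MvPolynomial ι ℂ} (hp : p.IsHomogeneous d) :
    IsClosed {x : ProjSpace ι | MvPolynomial.eval x.vec p = 0} := by
  rw [← isOpen_compl_iff]
  exact isOpen_ne hp

theorem continuous_of_poly {U : Set (ProjSpace ι)} (g : U → ProjSpace κ)
    {d : ℕ} (F : κ → MvPolynomial ι ℂ) (hF : ∀ k, (F k).IsHomogeneous d)
    (h : ∀ x : U, ∃ c : ℂ, (g x).vec = c • fun k => MvPolynomial.eval x.1.vec (F k)) :
    Continuous g := by
  refine continuous_generateFrom_iff.mpr ?_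
  rintro _ ⟨e, p, hp, rfl⟩
  have hq : (MvPolynomial.bind₁ F p).IsHomogeneous (d * e) := hp.aeval F hF
  have : g ⁻¹' {x | MvPolynomial.eval x.vec p ≠ 0} =
      Subtype.val ⁻¹' {x : ProjSpace ι | MvPolynomial.eval x.vec (MvPolynomial.bind₁ F p) ≠ 0} := by
    ext x
    obtain ⟨c, hc⟩ := h x
    have hc0 : c ≠ 0 := by
      rintro rfl
      exact (g x).vec_ne_zero (by simpa using hc)
    have key : MvPolynomial.eval x.1.vec (MvPolynomial.bind₁ F p) =
        MvPolynomial.eval (fun k => MvPolynomial.eval x.1.vec (F k)) p := by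
      exact MvPolynomial.eval₂Hom_bind₁ (RingHom.id ℂ) x.1.vec F p
    simp only [Set.mem_preimage, Set.mem_ofPred_eq, hc, key, eval_smul hp]
    simp [hc0]
  rw [this]
  exact (isOpen_ne hq).preimage continuous_subtype_val

end ProjSpace

theorem isLocallyClosed_of_local {T : Type} [TopologicalSpace T] {S : Set T}
    (h : ∀ x ∈ S, ∃ U, IsOpen U ∧ x ∈ U ∧ IsLocallyClosed (U ∩ S)) : IsLocallyClosed S := by
  refine ((isLocallyClosed_tfae S).out 0 3).mpr fun x hx => ?_
  obtain ⟨U, hU, hxU, hUS⟩ := h x hx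
  have hloc : ∀ x ∈ U ∩ S, ∃ V, x ∈ V ∧ IsOpen V ∧ V ∩ closure (U ∩ S) ⊆ U ∩ S :=
    ((isLocallyClosed_tfae (U ∩ S)).out 0 3).mp hUS
  obtain ⟨V, hxV, hV, hVS⟩ := hloc x ⟨hxU, hx⟩
  refine ⟨V ∩ U, ⟨hxV, hxU⟩, hV.inter hU, fun y hy => ?_⟩
  exact (hVS ⟨hy.1.1, hU.inter_closure ⟨hy.1.2, hy.2⟩⟩).2

/-- A complex quasi-projective variety: its set of closed points, identified by `emb` with a Zariski
locally closed subset of a projective space. -/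
structure QPVariety : Type 1 where
  pts : Type
  idx : Type
  [finite_idx : Finite idx]
  emb : pts → ProjSpace idx
  emb_injective : Function.Injective emb
  isLocallyClosed_range : IsLocallyClosed (Set.range emb)

namespace QPVariety

attribute [instance] QPVariety.finite_idx

/-- The Zariski topology of a quasi-projective variety. -/
instance (X : QPVariety) : TopologicalSpace X.pts :=
  TopologicalSpace.induced X.emb inferInstance

/-- Homogeneous coordinates of a point of the variety. -/
def hcoord (X : QPVariety) (x : X.pts) : X.idx → ℂ := (X.emb x).vec

/-- The function `f` is regular at `x`: near `x` it is a quotient of homogeneous polynomials of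
the same degree, the denominator not vanishing at `x`. Only the germ of `f` at `x` matters. -/
def RegularAt (X : QPVariety) (f : X.pts → ℂ) (x : X.pts) : Prop :=
  ∃ (d : ℕ) (p q : MvPolynomial X.idx ℂ), p.IsHomogeneous d ∧ q.IsHomogeneous d ∧
    MvPolynomial.eval (X.hcoord x) q ≠ 0 ∧
    ∀ᶠ y in nhds x,
      f y = MvPolynomial.eval (X.hcoord y) p / MvPolynomial.eval (X.hcoord y) q

/-- Regular maps (morphisms of varieties): continuous maps that pull back regular functions to
regular functions. -/
def IsRegularMap (X Y : QPVariety) (φ : X.pts → Y.pts) : Prop :=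
  Continuous φ ∧ ∀ (x : X.pts) (f : Y.pts → ℂ), Y.RegularAt f (φ x) → X.RegularAt (f ∘ φ) x

variable {X Y W : QPVariety}

theorem continuous_emb (X : QPVariety) : Continuous X.emb := continuous_induced_dom

theorem isEmbedding_emb (X : QPVariety) : Topology.IsEmbedding X.emb :=
  ⟨⟨rfl⟩, X.emb_injective⟩

theorem exists_hcoord_ne_zero (x : X.pts) : ∃ i, X.hcoord x i ≠ 0 :=
  (X.emb x).exists_vec_ne_zero

theorem eventually_eval_ne {d : ℕ} {p : MvPolynomial X.idx ℂ} (hp : p.IsHomogeneous d)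
    {x : X.pts} (hx : MvPolynomial.eval (X.hcoord x) p ≠ 0) :
    ∀ᶠ y in nhds x, MvPolynomial.eval (X.hcoord y) p ≠ 0 :=
  ((ProjSpace.isOpen_ne hp).preimage X.continuous_emb).mem_nhds hx

theorem eventually_hcoord_ne {x : X.pts} {i : X.idx} (hx : X.hcoord x i ≠ 0) :
    ∀ᶠ y in nhds x, X.hcoord y i ≠ 0 := by
  simpa using eventually_eval_ne (MvPolynomial.isHomogeneous_X ℂ i) (x := x) (by simpa using hx)

namespace RegularAt

variable {f g : X.pts → ℂ} {x : X.pts}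

theorem congr (hf : X.RegularAt f x) (h : ∀ᶠ y in nhds x, g y = f y) : X.RegularAt g x := by
  obtain ⟨d, p, q, hp, hq, h0, he⟩ := hf
  exact ⟨d, p, q, hp, hq, h0, by filter_upwards [he, h] with y h1 h2 using h2.trans h1⟩

theorem const (c : ℂ) : X.RegularAt (fun _ => c) x :=
  ⟨0, MvPolynomial.C c, 1, MvPolynomial.isHomogeneous_C _ _, MvPolynomial.isHomogeneous_one _ _,
    by simp, by simp⟩

theorem add (hf : X.RegularAt f x) (hg : X.RegularAt g x) :
    X.RegularAt (fun y => f y + g y) x := by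
  obtain ⟨d, p, q, hp, hq, h0, he⟩ := hf
  obtain ⟨d', p', q', hp', hq', h0', he'⟩ := hg
  refine ⟨d + d', p * q' + q * p', q * q', (hp.mul hq').add (hq.mul hp'), hq.mul hq',
    by simpa using ⟨h0, h0'⟩, ?_⟩
  filter_upwards [he, he', eventually_eval_ne hq h0, eventually_eval_ne hq' h0'] with y h1 h2 h3 h4
  simp only [map_add, map_mul]
  rw [h1, h2, div_add_div _ _ h3 h4]

theorem mul (hf : X.RegularAt f x) (hg : X.RegularAt g x) :
    X.RegularAt (fun y => f y * g y) x := by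
  obtain ⟨d, p, q, hp, hq, h0, he⟩ := hf
  obtain ⟨d', p', q', hp', hq', h0', he'⟩ := hg
  refine ⟨d + d', p * p', q * q', hp.mul hp', hq.mul hq', by simpa using ⟨h0, h0'⟩, ?_⟩
  filter_upwards [he, he'] with y h1 h2
  simp only [map_mul]
  rw [h1, h2, div_mul_div_comm]

theorem eventually_ne (hf : X.RegularAt f x) (hx : f x ≠ 0) : ∀ᶠ y in nhds x, f y ≠ 0 := by
  obtain ⟨d, p, q, hp, hq, h0, he⟩ := hf
  have hpx : MvPolynomial.eval (X.hcoord x) p ≠ 0 := by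
    intro h
    exact hx (by rw [he.self_of_nhds, h, zero_div])
  filter_upwards [he, eventually_eval_ne hq h0, eventually_eval_ne hp hpx] with y h1 h2 h3
  rw [h1]
  exact div_ne_zero h3 h2

theorem inv (hf : X.RegularAt f x) (hx : f x ≠ 0) : X.RegularAt (fun y => (f y)⁻¹) x := by
  obtain ⟨d, p, q, hp, hq, h0, he⟩ := hf
  have hpx : MvPolynomial.eval (X.hcoord x) p ≠ 0 := by
    intro h
    exact hx (by rw [he.self_of_nhds, h, zero_div])
  refine ⟨d, q, p, hq, hp, hpx, ?_⟩
  filter_upwards [he] with y h1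
  rw [h1, inv_div]

theorem div (hf : X.RegularAt f x) (hg : X.RegularAt g x) (hx : g x ≠ 0) :
    X.RegularAt (fun y => f y / g y) x := by
  simpa only [div_eq_mul_inv] using hf.mul (hg.inv hx)

theorem prod {J : Type} (s : Finset J) {F : J → X.pts → ℂ}
    (h : ∀ j ∈ s, X.RegularAt (F j) x) : X.RegularAt (fun y => ∏ j ∈ s, F j y) x := by
  classical
  induction s using Finset.induction_on with
  | empty => simpa using const 1
  | insert a s ha ih =>
    simp only [Finset.prod_insert ha]
    exact (h a (by simp)).mul (ih fun j hj => h j (by simp [hj]))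

theorem sum {J : Type} (s : Finset J) {F : J → X.pts → ℂ}
    (h : ∀ j ∈ s, X.RegularAt (F j) x) : X.RegularAt (fun y => ∑ j ∈ s, F j y) x := by
  classical
  induction s using Finset.induction_on with
  | empty => simpa using const 0
  | insert a s ha ih =>
    simp only [Finset.sum_insert ha]
    exact (h a (by simp)).add (ih fun j hj => h j (by simp [hj]))

theorem mvEval {J : Type} {F : J → X.pts → ℂ} (h : ∀ j, X.RegularAt (F j) x)
    (p : MvPolynomial J ℂ) : X.RegularAt (fun y => MvPolynomial.eval (fun j => F j y) p) x := by
  induction p using MvPolynomial.induction_on with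
  | C a => simpa using const a
  | add p q hp hq => simpa using hp.add hq
  | mul_X p j hp => simpa using hp.mul (h j)

theorem hcoord_div {i j : X.idx} (h : X.hcoord x j ≠ 0) :
    X.RegularAt (fun y => X.hcoord y i / X.hcoord y j) x :=
  ⟨1, MvPolynomial.X i, MvPolynomial.X j, MvPolynomial.isHomogeneous_X _ _,
    MvPolynomial.isHomogeneous_X _ _, by simpa using h, by simp⟩

end RegularAt

theorem IsRegularMap.of_coords {φ : X.pts → Y.pts}
    (h : ∀ x, ∃ f : Y.idx → X.pts → ℂ, (∀ i, X.RegularAt (f i) x) ∧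
      ∀ᶠ y in nhds x, ∃ c : ℂ, Y.hcoord (φ y) = c • fun i => f i y) :
    IsRegularMap X Y φ := by
  have key : ∀ x, ∃ f : Y.idx → X.pts → ℂ, (∀ i, X.RegularAt (f i) x) ∧
      ∀ᶠ y in nhds x, ∃ c : ℂ, c ≠ 0 ∧ Y.hcoord (φ y) = c • fun i => f i y := by
    intro x
    obtain ⟨f, hf, hc⟩ := h x
    refine ⟨f, hf, hc.mono fun y => ?_⟩
    rintro ⟨c, hc⟩
    refine ⟨c, ?_, hc⟩
    rintro rfl
    exact (Y.emb (φ y)).vec_ne_zero (by rw [zero_smul] at hc; exact hc)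
  have hcont : Continuous φ := by
    refine continuous_induced_rng.mpr (continuous_generateFrom_iff.mpr ?_)
    rintro _ ⟨d, p, hp, rfl⟩
    refine isOpen_iff_mem_nhds.mpr fun x hx => ?_
    obtain ⟨f, hf, hc⟩ := key x
    have hx' : MvPolynomial.eval (fun i => f i x) p ≠ 0 := by
      obtain ⟨c, hc0, hcx⟩ := hc.self_of_nhds
      intro h0
      refine hx ?_
      change MvPolynomial.eval (Y.hcoord (φ x)) p = 0
      rw [hcx, ProjSpace.eval_smul hp, h0, mul_zero]
    filter_upwards [hc, (RegularAt.mvEval hf p).eventually_ne hx'] with y hy hy'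
    obtain ⟨c, hc0, hcy⟩ := hy
    change MvPolynomial.eval (Y.hcoord (φ y)) p ≠ 0
    rw [hcy, ProjSpace.eval_smul hp]
    exact mul_ne_zero (pow_ne_zero _ hc0) hy'
  refine ⟨hcont, fun x g hg => ?_⟩
  obtain ⟨d, p, q, hp, hq, h0, he⟩ := hg
  obtain ⟨f, hf, hc⟩ := key x
  have hqx : MvPolynomial.eval (fun i => f i x) q ≠ 0 := by
    obtain ⟨c, hc0, hcx⟩ := hc.self_of_nhds
    rw [hcx, ProjSpace.eval_smul hq] at h0
    exact right_ne_zero_of_mul h0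
  refine ((RegularAt.mvEval hf p).div (RegularAt.mvEval hf q) hqx).congr ?_
  filter_upwards [hc, hcont.continuousAt.eventually he] with y hy hy'
  obtain ⟨c, hc0, hcy⟩ := hy
  simp only [Function.comp_apply]
  rw [hy', hcy, ProjSpace.eval_smul hp, ProjSpace.eval_smul hq,
    mul_div_mul_left _ _ (pow_ne_zero _ hc0)]

theorem IsRegularMap.exists_coords {φ : X.pts → Y.pts} (h : IsRegularMap X Y φ) (x : X.pts) :
    ∃ f : Y.idx → X.pts → ℂ, (∀ i, X.RegularAt (f i) x) ∧ (∃ i, f i x ≠ 0) ∧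
      ∀ᶠ y in nhds x, ∃ c : ℂ, Y.hcoord (φ y) = c • fun i => f i y := by
  obtain ⟨j, hj⟩ := exists_hcoord_ne_zero (φ x)
  refine ⟨fun i y => Y.hcoord (φ y) i / Y.hcoord (φ y) j,
    fun i => h.2 x _ (RegularAt.hcoord_div hj), ⟨j, by simp [hj]⟩, ?_⟩
  filter_upwards [h.1.continuousAt.eventually (eventually_hcoord_ne hj)] with y hy
  refine ⟨Y.hcoord (φ y) j, ?_⟩
  ext i
  simp only [Pi.smul_apply, smul_eq_mul]
  field_simp

theorem IsRegularMap.comp {φ : X.pts → Y.pts} {ψ : Y.pts → W.pts} (hψ : IsRegularMap Y W ψ)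
    (hφ : IsRegularMap X Y φ) : IsRegularMap X W (ψ ∘ φ) :=
  ⟨hψ.1.comp hφ.1, fun x f hf => hφ.2 x _ (hψ.2 _ f hf)⟩

theorem IsRegularMap.id : IsRegularMap X X (fun x => x) := ⟨continuous_id, fun _ _ h => h⟩

/-! Subvarieties. -/

/-- A locally closed subset of a variety, as a variety. -/
def sub (X : QPVariety) (S : Set X.pts) (hS : IsLocallyClosed S) : QPVariety where
  pts := S
  idx := X.idx
  emb := fun x => X.emb x.1
  emb_injective := X.emb_injective.comp Subtype.val_injective
  isLocallyClosed_range := by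
    have : Set.range (fun x : S => X.emb x.1) = X.emb '' S := by
      rw [← Set.image_eq_range]
    rw [this]
    exact hS.image X.isEmbedding_emb.isInducing X.isLocallyClosed_range

theorem isRegularMap_val (S : Set X.pts) (hS : IsLocallyClosed S) :
    IsRegularMap (X.sub S hS) X Subtype.val := by
  refine IsRegularMap.of_coords fun x => ?_
  obtain ⟨j, hj⟩ := exists_hcoord_ne_zero (X := X.sub S hS) x
  refine ⟨fun i y => (X.sub S hS).hcoord y i / (X.sub S hS).hcoord y j,
    fun i => RegularAt.hcoord_div hj, ?_⟩
  filter_upwards [eventually_hcoord_ne hj] with y hy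
  refine ⟨(X.sub S hS).hcoord y j, ?_⟩
  ext i
  simp only [Pi.smul_apply, smul_eq_mul]
  rw [mul_div_cancel₀ _ hy]
  rfl

theorem isRegularMap_sub {S : Set Y.pts} {hS : IsLocallyClosed S} {φ : X.pts → (Y.sub S hS).pts}
    (h : IsRegularMap X Y (fun x => (φ x).1)) : IsRegularMap X (Y.sub S hS) φ := by
  refine IsRegularMap.of_coords fun x => ?_
  obtain ⟨f, hf, -, hc⟩ := h.exists_coords x
  exact ⟨f, hf, hc⟩

/-! Products. -/

/-- The product of the homogeneous coordinates, for the Segre embedding. -/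
def segre {J : Type} [Fintype J] {ι : J → Type} (v : ∀ j, ι j → ℂ) : (∀ j, ι j) → ℂ :=
  fun a => ∏ j, v j (a j)

theorem segre_ne_zero {J : Type} [Fintype J] {ι : J → Type} {v : ∀ j, ι j → ℂ}
    (hv : ∀ j, v j ≠ 0) : segre v ≠ 0 := by
  choose a ha using fun j => Function.ne_iff.mp (hv j)
  exact fun h => Finset.prod_ne_zero_iff.mpr (fun j _ => ha j) (congrFun h a)

theorem segre_update {J : Type} [Fintype J] [DecidableEq J] {ι : J → Type} (v : ∀ j, ι j → ℂ)
    (a : ∀ j, ι j) (k : J) (i : ι k) :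
    segre v (Function.update a k i) * v k (a k) = segre v a * v k i := by
  unfold segre
  rw [← Finset.mul_prod_erase _ _ (Finset.mem_univ k),
    ← Finset.mul_prod_erase Finset.univ (fun j => v j (a j)) (Finset.mem_univ k)]
  have : ∏ j ∈ Finset.univ.erase k, v j (Function.update a k i j) =
      ∏ j ∈ Finset.univ.erase k, v j (a j) :=
    Finset.prod_congr rfl fun j hj => by rw [Function.update_of_ne (Finset.ne_of_mem_erase hj)]
  rw [this, Function.update_self]
  ring

/-- Multi-arrays of rank one are recognised by the exchange relations. -/
theorem segre_of_exchange {J : Type} [Fintype J] [DecidableEq J] {ι : J → Type}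
    (M : (∀ j, ι j) → ℂ) (a b : ∀ j, ι j)
    (h : ∀ (b c : ∀ j, ι j) (k : J),
      M b * M c = M (Function.update b k (c k)) * M (Function.update c k (b k))) :
    M a * segre (fun j i => M (Function.update a j i)) b = M b * M a ^ Fintype.card J := by
  have key : ∀ s : Finset J, M b * M a ^ s.card =
      M (fun j => if j ∈ s then a j else b j) * ∏ j ∈ s, M (Function.update a j (b j)) := by
    intro s
    induction s using Finset.induction_on with
    | empty => simp
    | insert k s hk ih =>
      rw [Finset.card_insert_of_notMem hk, pow_succ, ← mul_assoc, ih, Finset.prod_insert hk]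
      have h1 := h (fun j => if j ∈ s then a j else b j) a k
      have h2 : Function.update (fun j => if j ∈ s then a j else b j) k (a k) =
          fun j => if j ∈ insert k s then a j else b j := by
        funext j
        by_cases hj : j = k
        · subst hj; simp
        · simp [Finset.mem_insert, hj]
      rw [h2] at h1
      simp only [hk, if_false] at h1
      linear_combination (∏ j ∈ s, M (Function.update a j (b j))) * h1
  have := key Finset.univ
  simp only [Finset.mem_univ, if_true, Finset.card_univ] at this
  exact this.symm

theorem isLocallyClosed_univ_pi {J : Type} [Finite J] {T : J → Type}
    [∀ j, TopologicalSpace (T j)] {S : ∀ j, Set (T j)} (h : ∀ j, IsLocallyClosed (S j)) :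
    IsLocallyClosed (Set.univ.pi S) := by
  choose O C hO hC hS using h
  refine ⟨Set.univ.pi O, Set.univ.pi C, isOpen_set_pi Set.finite_univ fun j _ => hO j,
    isClosed_set_pi fun j _ => hC j, ?_⟩
  rw [← Set.pi_inter_distrib]
  exact congrArg _ (funext hS)

/-- The Segre embedding of a finite product of varieties. -/
def segreEmb {J : Type} [Fintype J] (X : J → QPVariety) (x : ∀ j, (X j).pts) :
    ProjSpace (∀ j, (X j).idx) :=
  ProjSpace.of (segre fun j => (X j).hcoord (x j))
    (segre_ne_zero fun j => ((X j).emb (x j)).vec_ne_zero)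

theorem segreEmb_eq {J : Type} [Fintype J] (X : J → QPVariety) (x : ∀ j, (X j).pts)
    (m : ProjSpace (∀ j, (X j).idx)) {c : ℂ}
    (h : m.vec = c • segre fun j => (X j).hcoord (x j)) : segreEmb X x = m := by
  obtain ⟨c', hc', h'⟩ := ProjSpace.vec_of (segre fun j => (X j).hcoord (x j))
    (segre_ne_zero fun j => ((X j).emb (x j)).vec_ne_zero)
  symm
  refine ProjSpace.ext_of_smul (c := c * c'⁻¹) ?_
  unfold segreEmb
  rw [h', h, smul_smul, mul_assoc, inv_mul_cancel₀ hc', mul_one]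

theorem segreEmb_vec {J : Type} [Fintype J] (X : J → QPVariety) (x : ∀ j, (X j).pts) :
    ∃ c : ℂ, c ≠ 0 ∧ (segreEmb X x).vec = c • segre fun j => (X j).hcoord (x j) :=
  ProjSpace.vec_of _ _

theorem segreEmb_row {J : Type} [Fintype J] [DecidableEq J] (X : J → QPVariety)
    (x : ∀ j, (X j).pts) (a : ∀ j, (X j).idx) (ha : (segreEmb X x).vec a ≠ 0) (k : J) :
    ∃ c : ℂ, (X k).hcoord (x k) = c • fun i => (segreEmb X x).vec (Function.update a k i) := by
  obtain ⟨c, hc, h⟩ := segreEmb_vec X x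
  rw [h] at ha ⊢
  have hs : segre (fun j => (X j).hcoord (x j)) a ≠ 0 := right_ne_zero_of_mul ha
  refine ⟨(X k).hcoord (x k) (a k) * (c * segre (fun j => (X j).hcoord (x j)) a)⁻¹, ?_⟩
  ext i
  have := segre_update (fun j => (X j).hcoord (x j)) a k i
  simp only [Pi.smul_apply, smul_eq_mul]
  field_simp
  linear_combination -this

theorem segreEmb_injective {J : Type} [Fintype J] (X : J → QPVariety) :
    Function.Injective (segreEmb X) := by
  classical
  intro x y hxy
  funext k
  obtain ⟨a, ha⟩ := (segreEmb X x).exists_vec_ne_zero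
  obtain ⟨c, hc⟩ := segreEmb_row X x a ha k
  obtain ⟨d, hd⟩ := segreEmb_row X y a (hxy ▸ ha) k
  rw [← hxy] at hd
  have hd0 : d ≠ 0 := by
    rintro rfl
    exact ((X k).emb (y k)).vec_ne_zero (by rw [zero_smul] at hd; exact hd)
  refine (X k).emb_injective (ProjSpace.ext_of_smul (c := c * d⁻¹) ?_)
  change (X k).hcoord (x k) = _ • (X k).hcoord (y k)
  rw [hc, hd, smul_smul, mul_assoc, inv_mul_cancel₀ hd0, mul_one]

theorem isLocallyClosed_range_segreEmb {J : Type} [Fintype J] (X : J → QPVariety) :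
    IsLocallyClosed (Set.range (segreEmb X)) := by
  classical
  refine isLocallyClosed_of_local ?_
  rintro m hm
  obtain ⟨a, ha⟩ := m.exists_vec_ne_zero
  let U : Set (ProjSpace (∀ j, (X j).idx)) := {m | m.vec a ≠ 0}
  have hU : IsOpen U := by
    simpa using ProjSpace.isOpen_ne (MvPolynomial.isHomogeneous_X ℂ a)
  refine ⟨U, hU, ha, ?_⟩
  have hrow : ∀ (m : U) (k : J), (fun i => m.1.vec (Function.update a k i)) ≠ 0 := by
    intro m k h
    have := congrFun h (a k)
    rw [Function.update_eq_self] at this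
    exact m.2 this
  let g : U → ∀ k, ProjSpace (X k).idx := fun m k => ProjSpace.of _ (hrow m k)
  have hg : Continuous g := by
    refine continuous_pi fun k => ?_
    refine ProjSpace.continuous_of_poly _ (fun i => MvPolynomial.X (Function.update a k i))
      (fun i => MvPolynomial.isHomogeneous_X _ _) fun m => ?_
    obtain ⟨c, -, hc⟩ := ProjSpace.vec_of _ (hrow m k)
    exact ⟨c, by simpa using hc⟩
  let E : Set (ProjSpace (∀ j, (X j).idx)) :=
    ⋂ (b : ∀ j, (X j).idx) (c : ∀ j, (X j).idx) (k : J),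
      {m | MvPolynomial.eval m.vec (MvPolynomial.X b * MvPolynomial.X c -
        MvPolynomial.X (Function.update b k (c k)) *
          MvPolynomial.X (Function.update c k (b k))) = 0}
  have hE : IsClosed E := by
    refine isClosed_iInter fun b => isClosed_iInter fun c => isClosed_iInter fun k => ?_
    exact ProjSpace.isClosed_eq (d := 1 + 1)
      (((MvPolynomial.isHomogeneous_X _ _).mul (MvPolynomial.isHomogeneous_X _ _)).sub
        ((MvPolynomial.isHomogeneous_X _ _).mul (MvPolynomial.isHomogeneous_X _ _)))
  let R : Set (∀ k, ProjSpace (X k).idx) := Set.univ.pi fun k => Set.range (X k).emb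
  have hR : IsLocallyClosed R := isLocallyClosed_univ_pi fun k => (X k).isLocallyClosed_range
  have heq : U ∩ Set.range (segreEmb X) = E ∩ Subtype.val '' (g ⁻¹' R) := by
    ext m
    constructor
    · rintro ⟨hmU, x, rfl⟩
      refine ⟨?_, ⟨⟨_, hmU⟩, ?_, rfl⟩⟩
      · obtain ⟨c, -, hc⟩ := segreEmb_vec X x
        simp only [E, Set.mem_iInter, Set.mem_ofPred_eq, map_sub, map_mul, MvPolynomial.eval_X]
        intro b b' k
        rw [hc]
        simp only [Pi.smul_apply, smul_eq_mul, segre]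
        have h1 : ∀ b b' : ∀ j, (X j).idx,
            (∏ j, (X j).hcoord (x j) (Function.update b k (b' k) j)) =
              (X k).hcoord (x k) (b' k) * ∏ j ∈ Finset.univ.erase k, (X j).hcoord (x j) (b j) := by
          intro b b'
          rw [← Finset.mul_prod_erase _ _ (Finset.mem_univ k), Function.update_self]
          congr 1
          exact Finset.prod_congr rfl fun j hj => by
            rw [Function.update_of_ne (Finset.ne_of_mem_erase hj)]
        rw [h1, h1, ← Finset.mul_prod_erase _ (fun j => (X j).hcoord (x j) (b j))
          (Finset.mem_univ k), ← Finset.mul_prod_erase _ (fun j => (X j).hcoord (x j) (b' j))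
          (Finset.mem_univ k)]
        ring
      · intro k _
        refine ⟨x k, ?_⟩
        obtain ⟨c, hc⟩ := segreEmb_row X x a hmU k
        obtain ⟨d, hd0, hd⟩ := ProjSpace.vec_of _ (hrow ⟨_, hmU⟩ k)
        refine ProjSpace.ext_of_smul (c := c * d⁻¹) ?_
        change (X k).hcoord (x k) = _
        simp only [g]
        rw [hd, hc, smul_smul, mul_assoc, inv_mul_cancel₀ hd0, mul_one]
    · rintro ⟨hmE, ⟨m, hmU⟩, hmR, rfl⟩
      refine ⟨hmU, ?_⟩
      choose x hx using fun k => hmR k (Set.mem_univ k)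
      simp only [E, Set.mem_iInter, Set.mem_ofPred_eq, map_sub, map_mul, MvPolynomial.eval_X,
        sub_eq_zero] at hmE
      have hrowx : ∀ k, ∃ c : ℂ, c ≠ 0 ∧
          (X k).hcoord (x k) = c • fun i => m.vec (Function.update a k i) := by
        intro k
        obtain ⟨d, hd0, hd⟩ := ProjSpace.vec_of _ (hrow ⟨m, hmU⟩ k)
        refine ⟨d, hd0, ?_⟩
        change ((X k).emb (x k)).vec = _
        rw [hx k]
        exact hd
      choose c hc0 hc using hrowx
      have hm0 : m.vec a ≠ 0 := hmU
      refine ⟨x, segreEmb_eq X x m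
        (c := m.vec a * (∏ k, c k)⁻¹ * (m.vec a ^ Fintype.card J)⁻¹) ?_⟩
      ext b
      have h1 := segre_of_exchange m.vec a b hmE
      have h2 : segre (fun j => (X j).hcoord (x j)) b =
          (∏ k, c k) * segre (fun j i => m.vec (Function.update a j i)) b := by
        simp only [segre, ← Finset.prod_mul_distrib]
        refine Finset.prod_congr rfl fun j _ => ?_
        rw [hc j]
        simp
      have h3 : (∏ k, c k) ≠ 0 := Finset.prod_ne_zero_iff.mpr fun k _ => hc0 k
      simp only [Pi.smul_apply, smul_eq_mul]
      rw [h2]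
      field_simp
      linear_combination -h1
  rw [heq]
  refine hE.isLocallyClosed.inter ?_
  refine (hR.preimage hg).image Topology.IsInducing.subtypeVal ?_
  rw [Subtype.range_coe]
  exact hU.isLocallyClosed

/-- The product of a finite family of varieties, through the Segre embedding. -/
def pi {J : Type} [Fintype J] (X : J → QPVariety) : QPVariety where
  pts := ∀ j, (X j).pts
  idx := ∀ j, (X j).idx
  emb := segreEmb X
  emb_injective := segreEmb_injective X
  isLocallyClosed_range := isLocallyClosed_range_segreEmb X

theorem isRegularMap_proj {J : Type} [Fintype J] (X : J → QPVariety) (k : J) :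
    IsRegularMap (pi X) (X k) (fun x => x k) := by
  classical
  refine IsRegularMap.of_coords fun x => ?_
  obtain ⟨a, ha⟩ := exists_hcoord_ne_zero (X := pi X) x
  refine ⟨fun i y => (pi X).hcoord y (Function.update a k i) / (pi X).hcoord y a,
    fun i => RegularAt.hcoord_div ha, ?_⟩
  filter_upwards [eventually_hcoord_ne ha] with y hy
  obtain ⟨c, hc⟩ := segreEmb_row X y a hy k
  refine ⟨c * (pi X).hcoord y a, ?_⟩
  rw [hc]
  ext i
  simp only [Pi.smul_apply, smul_eq_mul]
  rw [mul_assoc, mul_div_cancel₀ _ hy]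
  rfl

theorem isRegularMap_pi {J : Type} [Fintype J] {X : J → QPVariety} {φ : Y.pts → (pi X).pts}
    (h : ∀ j, IsRegularMap Y (X j) (fun y => φ y j)) : IsRegularMap Y (pi X) φ := by
  refine IsRegularMap.of_coords fun y => ?_
  choose f hf _ hc using fun j => (h j).exists_coords y
  refine ⟨fun a z => ∏ j, f j (a j) z, fun a => RegularAt.prod _ fun j _ => hf j (a j), ?_⟩
  filter_upwards [Filter.eventually_all.mpr hc] with z hz
  choose c hc using hz
  obtain ⟨d, -, hd⟩ := segreEmb_vec X (φ z)
  refine ⟨d * ∏ j, c j, ?_⟩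
  change (segreEmb X (φ z)).vec = _
  rw [hd]
  ext a
  have h1 : segre (fun j => (X j).hcoord (φ z j)) a = (∏ j, c j) * ∏ j, f j (a j) z := by
    unfold segre
    rw [← Finset.prod_mul_distrib]
    exact Finset.prod_congr rfl fun j _ => congrFun (hc j) (a j)
  change d * segre (fun j => (X j).hcoord (φ z j)) a = d * (∏ j, c j) * ∏ j, f j (a j) z
  rw [h1, mul_assoc]

/-! Disjoint unions. -/

/-- The inclusion of a block of coordinates. -/
def block {J : Type} [DecidableEq J] {ι : J → Type} (k : J) (v : ι k → ℂ) : (Σ j, ι j) → ℂ :=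
  fun a => (Pi.single k v : ∀ j, ι j → ℂ) a.1 a.2

theorem block_same {J : Type} [DecidableEq J] {ι : J → Type} (k : J) (v : ι k → ℂ) (i : ι k) :
    block k v ⟨k, i⟩ = v i := by
  simp [block]

theorem block_ne {J : Type} [DecidableEq J] {ι : J → Type} {k : J} (v : ι k → ℂ) {j : J}
    (h : j ≠ k) (i : ι j) : block k v ⟨j, i⟩ = 0 := by
  simp [block, Pi.single_eq_of_ne h]

theorem block_ne_zero {J : Type} [DecidableEq J] {ι : J → Type} {k : J} {v : ι k → ℂ}
    (hv : v ≠ 0) : block k v ≠ 0 := by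
  obtain ⟨i, hi⟩ := Function.ne_iff.mp hv
  intro h
  exact hi (by rw [← block_same k v i, h]; rfl)

open Classical in
/-- The embedding of a disjoint union: the pieces are put into complementary coordinate subspaces
of one projective space. -/
def sigmaEmb {J : Type} (X : J → QPVariety) (x : Σ j, (X j).pts) : ProjSpace (Σ j, (X j).idx) :=
  ProjSpace.of (block x.1 ((X x.1).hcoord x.2)) (block_ne_zero ((X x.1).emb x.2).vec_ne_zero)

theorem sigmaEmb_vec {J : Type} (X : J → QPVariety) (x : Σ j, (X j).pts) :
    ∃ c : ℂ, c ≠ 0 ∧ (∀ i, (sigmaEmb X x).vec ⟨x.1, i⟩ = c * (X x.1).hcoord x.2 i) ∧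
      ∀ a : Σ j, (X j).idx, a.1 ≠ x.1 → (sigmaEmb X x).vec a = 0 := by
  classical
  obtain ⟨c, hc, h⟩ := ProjSpace.vec_of
    (block (ι := fun j => (X j).idx) x.1 ((X x.1).hcoord x.2))
    (block_ne_zero (ι := fun j => (X j).idx) (v := (X x.1).hcoord x.2) ((X x.1).emb x.2).vec_ne_zero)
  refine ⟨c, hc, fun i => ?_, ?_⟩
  · refine (congrFun h _).trans ?_
    simp only [Pi.smul_apply, smul_eq_mul]
    congr 1
    exact block_same _ _ _
  · rintro ⟨j, i⟩ hj
    refine (congrFun h _).trans ?_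
    simp only [Pi.smul_apply, smul_eq_mul]
    rw [block_ne _ hj, mul_zero]

theorem sigmaEmb_fst {J : Type} {X : J → QPVariety} {x : Σ j, (X j).pts} {a : Σ j, (X j).idx}
    (h : (sigmaEmb X x).vec a ≠ 0) : a.1 = x.1 := by
  obtain ⟨c, -, -, h0⟩ := sigmaEmb_vec X x
  by_contra hne
  exact h (h0 a hne)

theorem sigmaEmb_injective {J : Type} (X : J → QPVariety) : Function.Injective (sigmaEmb X) := by
  rintro ⟨j, x⟩ ⟨k, y⟩ h
  obtain ⟨a, ha⟩ := (sigmaEmb X ⟨j, x⟩).exists_vec_ne_zero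
  have hj : a.1 = j := sigmaEmb_fst ha
  have hk : a.1 = k := sigmaEmb_fst (h ▸ ha)
  obtain rfl : j = k := hj.symm.trans hk
  obtain ⟨c, hc, h1, -⟩ := sigmaEmb_vec X ⟨j, x⟩
  obtain ⟨d, hd, h2, -⟩ := sigmaEmb_vec X ⟨j, y⟩
  have : x = y := by
    refine (X j).emb_injective (ProjSpace.ext_of_smul (c := c⁻¹ * d) ?_)
    ext i
    have h3 := h1 i
    have h4 := h2 i
    rw [h, h4] at h3
    change (X j).hcoord x i = (c⁻¹ * d) * (X j).hcoord y i
    simp only at h3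
    rw [mul_assoc, h3, inv_mul_cancel_left₀ hc]
  rw [this]

theorem isLocallyClosed_range_sigmaEmb {J : Type} (X : J → QPVariety) :
    IsLocallyClosed (Set.range (sigmaEmb X)) := by
  refine isLocallyClosed_of_local fun m _ => ?_
  obtain ⟨⟨k, l⟩, ha⟩ := m.exists_vec_ne_zero
  let U : Set (ProjSpace (Σ j, (X j).idx)) := {m | m.vec ⟨k, l⟩ ≠ 0}
  have hU : IsOpen U := by
    simpa using ProjSpace.isOpen_ne (MvPolynomial.isHomogeneous_X ℂ (⟨k, l⟩ : Σ j, (X j).idx))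
  refine ⟨U, hU, ha, ?_⟩
  have hrow : ∀ m : U, (fun i => m.1.vec ⟨k, i⟩) ≠ 0 := fun m h => m.2 (congrFun h l)
  let g : U → ProjSpace (X k).idx := fun m => ProjSpace.of _ (hrow m)
  have hg : Continuous g := by
    refine ProjSpace.continuous_of_poly _ (fun i => MvPolynomial.X ⟨k, i⟩)
      (fun i => MvPolynomial.isHomogeneous_X _ _) fun m => ?_
    obtain ⟨c, -, hc⟩ := ProjSpace.vec_of _ (hrow m)
    exact ⟨c, by simpa using hc⟩
  let E : Set (ProjSpace (Σ j, (X j).idx)) :=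
    ⋂ (a : Σ j, (X j).idx) (_ : a.1 ≠ k), {m | MvPolynomial.eval m.vec (MvPolynomial.X a) = 0}
  have hE : IsClosed E := isClosed_iInter fun a => isClosed_iInter fun _ =>
    ProjSpace.isClosed_eq (MvPolynomial.isHomogeneous_X _ _)
  have heq : U ∩ Set.range (sigmaEmb X) =
      E ∩ Subtype.val '' (g ⁻¹' Set.range (X k).emb) := by
    ext m
    constructor
    · rintro ⟨hmU, ⟨j, x⟩, rfl⟩
      obtain rfl : k = j := sigmaEmb_fst hmU
      obtain ⟨c, hc, h1, h0⟩ := sigmaEmb_vec X ⟨k, x⟩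
      refine ⟨?_, ⟨⟨_, hmU⟩, ⟨x, ?_⟩, rfl⟩⟩
      · simpa [E] using fun (a : Σ j, (X j).idx) (ha : a.1 ≠ k) => h0 a ha
      · obtain ⟨d, hd0, hd⟩ := ProjSpace.vec_of _ (hrow ⟨_, hmU⟩)
        refine ProjSpace.ext_of_smul (c := c⁻¹ * d⁻¹) ?_
        simp only [g]
        rw [hd, smul_smul, mul_assoc, inv_mul_cancel₀ hd0, mul_one]
        ext i
        simp only [Pi.smul_apply, smul_eq_mul]
        rw [h1 i, inv_mul_cancel_left₀ hc]
        rfl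
    · rintro ⟨hmE, ⟨m, hmU⟩, ⟨x, hx⟩, rfl⟩
      refine ⟨hmU, ⟨k, x⟩, ?_⟩
      obtain ⟨c, hc, h1, h0⟩ := sigmaEmb_vec X ⟨k, x⟩
      obtain ⟨d, hd0, hd⟩ := ProjSpace.vec_of _ (hrow ⟨_, hmU⟩)
      have hx' : ((X k).emb x).vec = d • fun i => m.vec ⟨k, i⟩ := by rw [hx]; exact hd
      simp only [E, Set.mem_iInter, Set.mem_ofPred_eq, MvPolynomial.eval_X] at hmE
      refine ProjSpace.ext_of_smul (c := c * d) ?_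
      ext ⟨j, i⟩
      by_cases hj : j = k
      · subst hj
        rw [h1 i]
        change c * ((X j).emb x).vec i = _
        rw [hx']
        simp [mul_assoc]
      · rw [h0 ⟨j, i⟩ hj]
        simp only [Pi.smul_apply, smul_eq_mul]
        rw [hmE ⟨j, i⟩ hj, mul_zero]
  rw [heq]
  refine hE.isLocallyClosed.inter ?_
  refine ((X k).isLocallyClosed_range.preimage hg).image Topology.IsInducing.subtypeVal ?_
  rw [Subtype.range_coe]
  exact hU.isLocallyClosed

/-- The disjoint union of a finite family of varieties. -/
def sigma {J : Type} [Finite J] (X : J → QPVariety) : QPVariety where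
  pts := Σ j, (X j).pts
  idx := Σ j, (X j).idx
  emb := sigmaEmb X
  emb_injective := sigmaEmb_injective X
  isLocallyClosed_range := isLocallyClosed_range_sigmaEmb X

section sigma

variable {J : Type} [Finite J] {X : J → QPVariety}

/-- The inclusion of a piece of a disjoint union. -/
def inc (k : J) (x : (X k).pts) : (sigma X).pts := ⟨k, x⟩

theorem eventually_fst (x : (sigma X).pts) : ∀ᶠ y in nhds x, y.1 = x.1 := by
  obtain ⟨a, ha⟩ := exists_hcoord_ne_zero x
  filter_upwards [eventually_hcoord_ne ha] with y hy
  exact (sigmaEmb_fst hy).symm.trans (sigmaEmb_fst ha)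

theorem isRegularMap_mk (k : J) : IsRegularMap (X k) (sigma X) (inc k) := by
  classical
  refine IsRegularMap.of_coords fun x => ?_
  obtain ⟨i₀, hi⟩ := exists_hcoord_ne_zero x
  refine ⟨fun a y => block (ι := fun j => (X j).idx) k (fun i => (X k).hcoord y i / (X k).hcoord y i₀) a, ?_, ?_⟩
  · rintro ⟨j, i⟩
    by_cases hj : j = k
    · subst hj
      simp only [block_same]
      exact RegularAt.hcoord_div hi
    · simp only [block_ne _ hj]
      exact RegularAt.const 0
  · filter_upwards [eventually_hcoord_ne hi] with y hy
    obtain ⟨c, hc, h1, h0⟩ := sigmaEmb_vec X ⟨k, y⟩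
    refine ⟨c * (X k).hcoord y i₀, funext ?_⟩
    rintro ⟨j, i⟩
    change (sigmaEmb X ⟨k, y⟩).vec ⟨j, i⟩ = c * (X k).hcoord y i₀ *
      block (ι := fun j => (X j).idx) k (fun i => (X k).hcoord y i / (X k).hcoord y i₀) ⟨j, i⟩
    by_cases hj : j = k
    · subst hj
      rw [block_same, mul_assoc, mul_div_cancel₀ _ hy]
      exact h1 i
    · rw [block_ne _ hj, mul_zero]
      exact h0 ⟨j, i⟩ hj

theorem IsRegularMap.of_local {Y Z : QPVariety} {φ : Y.pts → Z.pts}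
    (h : ∀ x, ∃ ψ, IsRegularMap Y Z ψ ∧ ∀ᶠ y in nhds x, φ y = ψ y) : IsRegularMap Y Z φ := by
  constructor
  · refine continuous_iff_continuousAt.mpr fun x => ?_
    obtain ⟨ψ, hψ, he⟩ := h x
    exact hψ.1.continuousAt.congr (he.mono fun _ h => h.symm)
  · intro x f hf
    obtain ⟨ψ, hψ, he⟩ := h x
    rw [he.self_of_nhds] at hf
    exact (hψ.2 x f hf).congr (he.mono fun y hy => congrArg f hy)

theorem IsRegularMap.const {Y Z : QPVariety} (z : Z.pts) : IsRegularMap Y Z (fun _ => z) :=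
  IsRegularMap.of_coords fun _ => ⟨fun i _ => Z.hcoord z i, fun _ => RegularAt.const _,
    Filter.Eventually.of_forall fun _ => ⟨1, (one_smul _ _).symm⟩⟩

open Classical in
/-- The map from a disjoint union to one of its pieces that is the identity on that piece and
constant on the other ones. -/
def retract (X : J → QPVariety) (k : J) (x₀ : (X k).pts) (y : (sigma X).pts) : (X k).pts :=
  if h : y.1 = k then h ▸ y.2 else x₀

theorem retract_mk (k : J) (x₀ x : (X k).pts) : retract X k x₀ (inc k x) = x := by
  simp [retract, inc]

theorem retract_of_ne {k : J} (x₀ : (X k).pts) {y : (sigma X).pts} (h : y.1 ≠ k) :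
    retract X k x₀ y = x₀ := by
  simp [retract, h]

theorem isRegularMap_retract (k : J) (x₀ : (X k).pts) :
    IsRegularMap (sigma X) (X k) (retract X k x₀) := by
  refine IsRegularMap.of_coords fun x => ?_
  by_cases hx : x.1 = k
  · obtain ⟨⟨j, i₀⟩, hi⟩ := exists_hcoord_ne_zero x
    obtain rfl : j = k := (sigmaEmb_fst hi).trans hx
    refine ⟨fun i y => (sigma X).hcoord y ⟨j, i⟩ / (sigma X).hcoord y ⟨j, i₀⟩,
      fun i => RegularAt.hcoord_div hi, ?_⟩
    filter_upwards [eventually_hcoord_ne hi] with y hy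
    obtain ⟨k, y⟩ := y
    obtain rfl : j = k := sigmaEmb_fst hy
    change (sigma X).hcoord (inc j y) ⟨j, i₀⟩ ≠ 0 at hy
    change ∃ c, (X j).hcoord (retract X j x₀ (inc j y)) = _
    obtain ⟨c, hc, h1, -⟩ := sigmaEmb_vec X ⟨j, y⟩
    refine ⟨c⁻¹ * (sigma X).hcoord (inc j y) ⟨j, i₀⟩, funext fun i => ?_⟩
    have h2 : (sigma X).hcoord (inc j y) ⟨j, i⟩ = c * (X j).hcoord y i := h1 i
    change _ = c⁻¹ * (sigma X).hcoord (inc j y) ⟨j, i₀⟩ *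
      ((sigma X).hcoord (inc j y) ⟨j, i⟩ / (sigma X).hcoord (inc j y) ⟨j, i₀⟩)
    rw [retract_mk, mul_assoc, mul_div_cancel₀ _ hy, h2, inv_mul_cancel_left₀ hc]
  · refine ⟨fun i _ => (X k).hcoord x₀ i, fun _ => RegularAt.const _, ?_⟩
    filter_upwards [eventually_fst x] with y hy
    rw [retract_of_ne x₀ (fun h => hx (hy.symm.trans h))]
    exact ⟨1, (one_smul _ _).symm⟩

theorem eventually_retract (k : J) (x₀ x : (X k).pts) :
    ∀ᶠ y in nhds (inc k x : (sigma X).pts), y = inc k (retract X k x₀ y) := by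
  filter_upwards [eventually_fst (inc k x : (sigma X).pts)] with y hy
  obtain ⟨j, y⟩ := y
  obtain rfl : j = k := hy
  exact congrArg (inc j) (retract_mk j x₀ y).symm

theorem eventually_sigma {k : J} {x : (X k).pts} {P : (sigma X).pts → Prop}
    (h : ∀ᶠ y in nhds x, P (inc k y)) : ∀ᶠ y in nhds (inc k x : (sigma X).pts), P y := by
  have h1 : ∀ᶠ y in nhds (retract X k x (inc k x)), P (inc k y) := by rwa [retract_mk]
  filter_upwards [eventually_retract k x x,
    (isRegularMap_retract k x).1.continuousAt.eventually h1] with y hy hy'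
  rw [hy]
  exact hy'

theorem regularAt_sigma {k : J} {x : (X k).pts} {f : (sigma X).pts → ℂ}
    (h : (X k).RegularAt (fun y => f (inc k y)) x) : (sigma X).RegularAt f (inc k x) := by
  have h1 : (X k).RegularAt (fun y => f (inc k y)) (retract X k x (inc k x)) := by rwa [retract_mk]
  refine ((isRegularMap_retract k x).2 _ _ h1).congr ?_
  filter_upwards [eventually_retract k x x] with y hy
  exact congrArg f hy

theorem isRegularMap_sigma {Y : QPVariety} {φ : (sigma X).pts → Y.pts}
    (h : ∀ j, IsRegularMap (X j) Y (fun x => φ (inc j x))) : IsRegularMap (sigma X) Y φ := by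
  refine IsRegularMap.of_local ?_
  rintro ⟨k, x⟩
  refine ⟨_, (h k).comp (isRegularMap_retract k x), ?_⟩
  filter_upwards [eventually_retract k x x] with y hy
  exact congrArg φ hy

theorem isOpen_sigma {S : Set (sigma X).pts} (h : ∀ j, IsOpen {x : (X j).pts | inc j x ∈ S}) :
    IsOpen S := by
  refine isOpen_iff_mem_nhds.mpr ?_
  rintro ⟨k, x⟩ hx
  exact eventually_sigma ((h k).mem_nhds hx)

end sigma

/-- The structure of a variety carried along a bijection. -/
def transport (X : QPVariety) {T : Type} (e : T ≃ X.pts) : QPVariety where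
  pts := T
  idx := X.idx
  emb := X.emb ∘ e
  emb_injective := X.emb_injective.comp e.injective
  isLocallyClosed_range := by
    rw [e.surjective.range_comp]
    exact X.isLocallyClosed_range

theorem isRegularMap_transport {T : Type} (e : T ≃ X.pts) :
    IsRegularMap (X.transport e) X e := by
  refine IsRegularMap.of_coords fun x => ?_
  obtain ⟨f, hf, -, hc⟩ := IsRegularMap.exists_coords (IsRegularMap.id (X := X.transport e)) x
  exact ⟨f, hf, hc⟩

theorem isRegularMap_transport_symm {T : Type} (e : T ≃ X.pts) :
    IsRegularMap X (X.transport e) e.symm := by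
  refine IsRegularMap.of_coords fun x => ?_
  obtain ⟨f, hf, -, hc⟩ := IsRegularMap.exists_coords (IsRegularMap.id (X := X)) x
  refine ⟨f, hf, hc.mono ?_⟩
  rintro y ⟨c, hc⟩
  refine ⟨c, ?_⟩
  refine Eq.trans ?_ hc
  exact congrArg X.hcoord (e.apply_symm_apply y)

end QPVariety

/-! Algebraic vector bundles. -/

/-- A local trivialization of `p : T → X`: fibrewise bijective coordinates over an open set. -/
structure Chart (X : QPVariety) {T : Type} (p : T → X.pts) : Type 1 where
  dom : Set X.pts
  isOpen_dom : IsOpen dom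
  rank : Type
  [finite_rank : Finite rank]
  coord : T → rank → ℂ
  bijective : ∀ x ∈ dom, Function.Bijective (fun e : {e : T // p e = x} => coord e.1)

attribute [instance] Chart.finite_rank

/-- In the charts `τ` and `τ'`, near the point `x`, the map `Ψ` is linear on the fibres, with
matrix entries that are regular functions of the base point. -/
def Chart.LinearAt {X Y : QPVariety} {T T' : Type} {p : T → X.pts} {p' : T' → Y.pts}
    (Ψ : T → T') (τ : Chart X p) (τ' : Chart Y p') (x : X.pts) : Prop :=
  ∃ L : X.pts → ((τ.rank → ℂ) →ₗ[ℂ] (τ'.rank → ℂ)),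
    (∀ v i, X.RegularAt (fun y => L y v i) x) ∧
    ∀ᶠ y in nhds x, ∀ e, p e = y → τ'.coord (Ψ e) = L y (τ.coord e)

/-- An algebraic vector bundle over `X` (the rank may vary): a map to `X` with a set of local
trivializations that cover `X` and whose transition functions are linear and regular. The fibres
get their vector space structure from the trivializations. -/
structure VBundle (X : QPVariety) : Type 1 where
  tot : Type
  proj : tot → X.pts
  charts : Set (Chart X proj)
  cover : ∀ x, ∃ τ ∈ charts, x ∈ τ.dom
  compat : ∀ τ ∈ charts, ∀ τ' ∈ charts, ∀ x ∈ τ.dom, x ∈ τ'.dom → Chart.LinearAt id τ τ' x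

/-- The pair `(ψ, Ψ)` is a morphism of vector bundles. -/
def IsBundleMap {X Y : QPVariety} (E : VBundle X) (F : VBundle Y) (ψ : X.pts → Y.pts)
    (Ψ : E.tot → F.tot) : Prop :=
  X.IsRegularMap Y ψ ∧ (∀ e, F.proj (Ψ e) = ψ (E.proj e)) ∧
    ∀ τ ∈ E.charts, ∀ τ' ∈ F.charts, ∀ x ∈ τ.dom, ψ x ∈ τ'.dom → Chart.LinearAt Ψ τ τ' x

theorem IsBundleMap.congr {X Y : QPVariety} {E : VBundle X} {F : VBundle Y}
    {ψ ψ' : X.pts → Y.pts} {Ψ Ψ' : E.tot → F.tot} (h : IsBundleMap E F ψ Ψ)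
    (h1 : ∀ x, ψ' x = ψ x) (h2 : ∀ e, Ψ' e = Ψ e) : IsBundleMap E F ψ' Ψ' := by
  rw [funext h1, funext h2]
  exact h

namespace VBundle

variable {X Y W : QPVariety} {E : VBundle X} {F : VBundle Y} {K : VBundle W}

theorem linearAt_comp {T T' T'' : Type} {p : T → X.pts} {p' : T' → Y.pts} {p'' : T'' → W.pts}
    {τ : Chart X p} {τ' : Chart Y p'} {τ'' : Chart W p''} {ψ : X.pts → Y.pts} {Ψ : T → T'}
    {Φ : T' → T''} {x : X.pts} (hψ : X.IsRegularMap Y ψ) (hp : ∀ e, p' (Ψ e) = ψ (p e))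
    (h : Chart.LinearAt Ψ τ τ' x) (h' : Chart.LinearAt Φ τ' τ'' (ψ x)) :
    Chart.LinearAt (Φ ∘ Ψ) τ τ'' x := by
  classical
  obtain ⟨L, hL, he⟩ := h
  obtain ⟨L', hL', he'⟩ := h'
  have := Fintype.ofFinite τ'.rank
  refine ⟨fun y => (L' (ψ y)).comp (L y), fun v i => ?_, ?_⟩
  · have : ∀ y, L' (ψ y) (L y v) i =
        ∑ k, L y v k * L' (ψ y) (fun j => if k = j then 1 else 0) i := by
      intro y
      rw [LinearMap.pi_apply_eq_sum_univ (L' (ψ y)) (L y v)]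
      simp
    simp only [LinearMap.comp_apply, this]
    exact QPVariety.RegularAt.sum _ fun k _ => (hL v k).mul (hψ.2 x _ (hL' _ i))
  · filter_upwards [he, hψ.1.continuousAt.eventually he'] with y h1 h2 e hy
    simp only [Function.comp_apply, LinearMap.comp_apply]
    rw [h2 (Ψ e) (by rw [hp, hy]), h1 e hy]

theorem isBundleMap_comp {ψ : X.pts → Y.pts} {Ψ : E.tot → F.tot} {ψ' : Y.pts → W.pts}
    {Ψ' : F.tot → K.tot} (h' : IsBundleMap F K ψ' Ψ') (h : IsBundleMap E F ψ Ψ) :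
    IsBundleMap E K (ψ' ∘ ψ) (Ψ' ∘ Ψ) := by
  refine ⟨h'.1.comp h.1, fun e => by simp [h'.2.1, h.2.1], fun τ hτ τ'' hτ'' x hx hx'' => ?_⟩
  obtain ⟨τ', hτ', hx'⟩ := F.cover (ψ x)
  exact linearAt_comp h.1 h.2.1 (h.2.2 τ hτ τ' hτ' x hx hx') (h'.2.2 τ' hτ' τ'' hτ'' _ hx' hx'')

theorem isBundleMap_id : IsBundleMap E E (fun x => x) (fun e => e) :=
  ⟨QPVariety.IsRegularMap.id, fun _ => rfl, E.compat⟩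

theorem isBundleMap_of_local {ψ : X.pts → Y.pts} {Ψ : E.tot → F.tot} (hψ : X.IsRegularMap Y ψ)
    (hp : ∀ e, F.proj (Ψ e) = ψ (E.proj e))
    (h : ∀ x, ∃ τ ∈ E.charts, ∃ τ' ∈ F.charts, x ∈ τ.dom ∧ ψ x ∈ τ'.dom ∧
      Chart.LinearAt Ψ τ τ' x) : IsBundleMap E F ψ Ψ := by
  refine ⟨hψ, hp, fun σ hσ σ' hσ' x hx hx' => ?_⟩
  obtain ⟨τ, hτ, τ', hτ', h1, h2, hL⟩ := h x
  exact linearAt_comp (Ψ := Ψ) (Φ := id) hψ hp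
    (linearAt_comp (ψ := fun x => x) (Ψ := id) (Φ := Ψ) QPVariety.IsRegularMap.id (fun _ => rfl)
      (E.compat σ hσ τ hτ x hx h1) hL) (F.compat τ' hτ' σ' hσ' _ h2 hx')

/-! Restriction to a subvariety. -/

/-- The restriction of a chart to a subvariety. -/
def chartRestrict (S : Set X.pts) (hS : IsLocallyClosed S) (τ : Chart X E.proj) :
    Chart (X.sub S hS) (T := {e : E.tot // E.proj e ∈ S}) (fun e => ⟨E.proj e.1, e.2⟩) where
  dom := {x | x.1 ∈ τ.dom}
  isOpen_dom := τ.isOpen_dom.preimage (QPVariety.isRegularMap_val S hS).1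
  rank := τ.rank
  coord := fun e => τ.coord e.1
  bijective := by
    rintro ⟨x, hx⟩ hxd
    obtain ⟨h1, h2⟩ := τ.bijective x hxd
    constructor
    · rintro ⟨⟨e, he⟩, hex⟩ ⟨⟨e', he'⟩, hex'⟩ h
      have := @h1 ⟨e, congrArg Subtype.val hex⟩ ⟨e', congrArg Subtype.val hex'⟩ h
      simpa using this
    · intro v
      obtain ⟨⟨e, he⟩, hv⟩ := h2 v
      exact ⟨⟨⟨e, he ▸ hx⟩, Subtype.ext he⟩, hv⟩

theorem linearAt_restrict {S : Set X.pts} {hS : IsLocallyClosed S} {S' : Set Y.pts}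
    {hS' : IsLocallyClosed S'} {τ : Chart X E.proj} {τ' : Chart Y F.proj} {Ψ : E.tot → F.tot}
    {x : (X.sub S hS).pts} (Φ : {e : E.tot // E.proj e ∈ S} → {e : F.tot // F.proj e ∈ S'})
    (hΦ : ∀ e, (Φ e).1 = Ψ e.1) (h : Chart.LinearAt Ψ τ τ' x.1) :
    Chart.LinearAt Φ (chartRestrict S hS τ) (chartRestrict S' hS' τ') x := by
  obtain ⟨L, hL, he⟩ := h
  refine ⟨fun y => L y.1, fun v i => (QPVariety.isRegularMap_val S hS).2 x _ (hL v i), ?_⟩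
  filter_upwards [(QPVariety.isRegularMap_val S hS).1.continuousAt.eventually he] with y hy e hey
  change τ'.coord (Φ e).1 = L y.1 (τ.coord e.1)
  rw [hΦ]
  exact hy e.1 (congrArg Subtype.val hey)

/-- The restriction of a vector bundle to a subvariety. -/
def restrict (E : VBundle X) (S : Set X.pts) (hS : IsLocallyClosed S) :
    VBundle (X.sub S hS) where
  tot := {e : E.tot // E.proj e ∈ S}
  proj := fun e => ⟨E.proj e.1, e.2⟩
  charts := {σ | ∃ τ ∈ E.charts, σ = chartRestrict S hS τ}
  cover := fun x => by
    obtain ⟨τ, hτ, hx⟩ := E.cover x.1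
    exact ⟨_, ⟨τ, hτ, rfl⟩, hx⟩
  compat := by
    rintro _ ⟨τ, hτ, rfl⟩ _ ⟨τ', hτ', rfl⟩ x hx hx'
    exact linearAt_restrict id (fun _ => rfl) (E.compat τ hτ τ' hτ' x.1 hx hx')

theorem isBundleMap_restrict {S : Set X.pts} {hS : IsLocallyClosed S} {S' : Set Y.pts}
    {hS' : IsLocallyClosed S'} {ψ : X.pts → Y.pts} {Ψ : E.tot → F.tot}
    (h : IsBundleMap E F ψ Ψ) (φ : (X.sub S hS).pts → (Y.sub S' hS').pts)
    (Φ : (E.restrict S hS).tot → (F.restrict S' hS').tot) (hφ : ∀ x, (φ x).1 = ψ x.1)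
    (hΦ : ∀ e, (Φ e).1 = Ψ e.1) : IsBundleMap (E.restrict S hS) (F.restrict S' hS') φ Φ := by
  have hreg : (X.sub S hS).IsRegularMap (Y.sub S' hS') φ := by
    refine QPVariety.isRegularMap_sub ?_
    rw [funext hφ]
    exact h.1.comp (QPVariety.isRegularMap_val S hS)
  refine ⟨hreg, fun e => Subtype.ext ?_, ?_⟩
  · rw [hφ]
    exact (congrArg F.proj (hΦ e)).trans (h.2.1 e.1)
  · rintro _ ⟨τ, hτ, rfl⟩ _ ⟨τ', hτ', rfl⟩ x hx hx'
    have hx'' : ψ x.1 ∈ τ'.dom := by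
      rw [← hφ]
      exact hx'
    exact linearAt_restrict Φ hΦ (h.2.2 τ hτ τ' hτ' x.1 hx hx'')

/-! Products. -/

section pi

variable {J : Type} [Fintype J] {X : J → QPVariety} {E : ∀ j, VBundle (X j)}

/-- The product of charts; the coordinates are put side by side. -/
def chartPi (τ : ∀ j, Chart (X j) (E j).proj) :
    Chart (QPVariety.pi X) (T := ∀ j, (E j).tot) (fun e j => (E j).proj (e j)) where
  dom := {x | ∀ j, x j ∈ (τ j).dom}
  isOpen_dom := by
    have : {x : (QPVariety.pi X).pts | ∀ j, x j ∈ (τ j).dom} =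
        ⋂ j, {x : (QPVariety.pi X).pts | x j ∈ (τ j).dom} := by
      ext x
      simp
    rw [this]
    exact isOpen_iInter_of_finite fun j =>
      (τ j).isOpen_dom.preimage (QPVariety.isRegularMap_proj X j).1
  rank := Σ j, (τ j).rank
  coord := fun e a => (τ a.1).coord (e a.1) a.2
  bijective := by
    intro x hx
    constructor
    · rintro ⟨e, he⟩ ⟨e', he'⟩ h
      refine Subtype.ext (funext fun j => ?_)
      have := @((τ j).bijective (x j) (hx j)).1 ⟨e j, congrFun he j⟩ ⟨e' j, congrFun he' j⟩
        (funext fun i => congrFun h ⟨j, i⟩)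
      simpa using this
    · intro v
      choose e he using fun j => ((τ j).bijective (x j) (hx j)).2 (fun i => v ⟨j, i⟩)
      exact ⟨⟨fun j => (e j).1, funext fun j => (e j).2⟩,
        funext fun a => congrFun (he a.1) a.2⟩

theorem linearAt_pi {T : Type} {p : T → Y.pts} {τ : Chart Y p}
    {σ : ∀ j, Chart (X j) (E j).proj} {Ψ : T → ∀ j, (E j).tot} {y : Y.pts}
    (h : ∀ j, Chart.LinearAt (fun e => Ψ e j) τ (σ j) y) :
    Chart.LinearAt Ψ τ (chartPi σ) y := by
  choose L hL he using h
  refine ⟨fun y => LinearMap.pi fun a => (LinearMap.proj a.2).comp (L a.1 y),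
    fun v a => hL a.1 v a.2, ?_⟩
  filter_upwards [Filter.eventually_all.mpr he] with z hz e hez
  funext a
  exact congrFun (hz a.1 e hez) a.2

theorem linearAt_proj (τ : ∀ j, Chart (X j) (E j).proj) (k : J) (x : (QPVariety.pi X).pts) :
    Chart.LinearAt (fun e : ∀ j, (E j).tot => e k) (chartPi τ) (τ k) x := by
  refine ⟨fun _ => LinearMap.pi fun i => LinearMap.proj ⟨k, i⟩,
    fun v i => QPVariety.RegularAt.const _, ?_⟩
  exact Filter.Eventually.of_forall fun _ _ _ => rfl

/-- The product of a finite family of vector bundles, over the product of their bases. The fibre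
at a point is the direct sum of the fibres. -/
def pi (E : ∀ j, VBundle (X j)) : VBundle (QPVariety.pi X) where
  tot := ∀ j, (E j).tot
  proj := fun e j => (E j).proj (e j)
  charts := {σ | ∃ τ : ∀ j, Chart (X j) (E j).proj, (∀ j, τ j ∈ (E j).charts) ∧ σ = chartPi τ}
  cover := fun x => by
    choose τ hτ hx using fun j => (E j).cover (x j)
    exact ⟨_, ⟨τ, hτ, rfl⟩, hx⟩
  compat := by
    rintro _ ⟨τ, hτ, rfl⟩ _ ⟨τ', hτ', rfl⟩ x hx hx'
    exact linearAt_pi fun j => linearAt_comp (Φ := id) (QPVariety.isRegularMap_proj X j)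
      (fun _ => rfl) (linearAt_proj τ j x)
      ((E j).compat (τ j) (hτ j) (τ' j) (hτ' j) (x j) (hx j) (hx' j))

theorem isBundleMap_proj (E : ∀ j, VBundle (X j)) (k : J) :
    IsBundleMap (pi E) (E k) (fun x => x k) (fun e => e k) := by
  refine isBundleMap_of_local (QPVariety.isRegularMap_proj X k) (fun _ => rfl) fun x => ?_
  choose τ hτ hx using fun j => (E j).cover (x j)
  exact ⟨_, ⟨τ, hτ, rfl⟩, τ k, hτ k, hx, hx k, linearAt_proj τ k x⟩

theorem isBundleMap_pi {ψ : Y.pts → (QPVariety.pi X).pts} {Ψ : F.tot → (pi E).tot}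
    (h : ∀ j, IsBundleMap F (E j) (fun y => ψ y j) (fun e => Ψ e j)) :
    IsBundleMap F (pi E) ψ Ψ := by
  refine ⟨QPVariety.isRegularMap_pi fun j => (h j).1,
    fun e => funext fun j => (h j).2.1 e, ?_⟩
  rintro τ hτ _ ⟨σ, hσ, rfl⟩ y hy hy'
  exact linearAt_pi fun j => (h j).2.2 τ hτ (σ j) (hσ j) y hy (hy' j)

end pi

/-! Disjoint unions. -/

section sigma

variable {J : Type} [Finite J] {X : J → QPVariety} {E : ∀ j, VBundle (X j)}

open Classical in
/-- A chart over one piece of a disjoint union. -/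
def chartSigma (k : J) (τ : Chart (X k) (E k).proj) :
    Chart (QPVariety.sigma X) (T := Σ j, (E j).tot)
      (fun e => QPVariety.inc e.1 ((E e.1).proj e.2)) where
  dom := QPVariety.inc k '' τ.dom
  isOpen_dom := by
    refine QPVariety.isOpen_sigma fun j => ?_
    by_cases h : j = k
    · subst h
      have : {x : (X j).pts | QPVariety.inc j x ∈ QPVariety.inc (X := X) j '' τ.dom} = τ.dom := by
        ext x
        constructor
        · rintro ⟨y, hy, h⟩
          obtain rfl : y = x := eq_of_heq (Sigma.mk.inj h).2
          exact hy
        · exact fun hx => ⟨x, hx, rfl⟩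
      rw [this]
      exact τ.isOpen_dom
    · have : {x : (X j).pts | QPVariety.inc j x ∈ QPVariety.inc (X := X) k '' τ.dom} = ∅ := by
        ext x
        simp only [Set.mem_ofPred_eq, Set.mem_image, Set.mem_empty_iff_false, iff_false]
        rintro ⟨y, -, hy⟩
        exact h (congrArg Sigma.fst hy).symm
      rw [this]
      exact isOpen_empty
  rank := τ.rank
  coord := fun e => if h : e.1 = k then τ.coord (h ▸ e.2) else 0
  bijective := by
    rintro _ ⟨x, hx, rfl⟩
    obtain ⟨h1, h2⟩ := τ.bijective x hx
    constructor
    · rintro ⟨⟨j, e⟩, he⟩ ⟨⟨j', e'⟩, he'⟩ h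
      obtain rfl : j = k := congrArg Sigma.fst he
      obtain rfl : j' = j := congrArg Sigma.fst he'
      have hx1 : (E j').proj e = x := eq_of_heq (Sigma.mk.inj he).2
      have hx2 : (E j').proj e' = x := eq_of_heq (Sigma.mk.inj he').2
      have := @h1 ⟨e, hx1⟩ ⟨e', hx2⟩ (by simpa using h)
      simpa using this
    · intro v
      obtain ⟨⟨e, rfl⟩, hv⟩ := h2 v
      exact ⟨⟨⟨k, e⟩, rfl⟩, by simpa using hv⟩

theorem chartSigma_coord (k : J) (τ : Chart (X k) (E k).proj) (e : (E k).tot) :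
    (chartSigma k τ).coord ⟨k, e⟩ = τ.coord e := by
  simp [chartSigma]

theorem linearAt_inc (k : J) (τ : Chart (X k) (E k).proj) (x : (X k).pts) :
    Chart.LinearAt (fun e => (⟨k, e⟩ : Σ j, (E j).tot)) τ (chartSigma k τ) x :=
  ⟨fun _ => LinearMap.id, fun _ _ => QPVariety.RegularAt.const _,
    Filter.Eventually.of_forall fun _ e _ => chartSigma_coord k τ e⟩

theorem linearAt_sigma {T : Type} {p : T → Y.pts} {σ : Chart Y p} {k : J}
    {τ : Chart (X k) (E k).proj} {Ψ : (Σ j, (E j).tot) → T} {x : (X k).pts}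
    (h : Chart.LinearAt (fun e => Ψ ⟨k, e⟩) τ σ x) :
    Chart.LinearAt Ψ (chartSigma k τ) σ (QPVariety.inc k x) := by
  obtain ⟨L, hL, he⟩ := h
  refine ⟨fun y => L (QPVariety.retract X k x y), fun v i => QPVariety.regularAt_sigma ?_,
    QPVariety.eventually_sigma ?_⟩
  · refine (hL v i).congr (Filter.Eventually.of_forall fun y => ?_)
    exact congrArg (fun z => L z v i) (QPVariety.retract_mk k x y)
  · filter_upwards [he] with y hy
    rintro ⟨j, e⟩ hj
    obtain rfl : j = k := congrArg Sigma.fst hj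
    rw [QPVariety.retract_mk]
    refine (hy e (eq_of_heq (Sigma.mk.inj hj).2)).trans (congrArg (L y) ?_)
    exact (chartSigma_coord j τ e).symm

/-- The disjoint union of a finite family of vector bundles. -/
def sigma (E : ∀ j, VBundle (X j)) : VBundle (QPVariety.sigma X) where
  tot := Σ j, (E j).tot
  proj := fun e => QPVariety.inc e.1 ((E e.1).proj e.2)
  charts := {σ | ∃ k, ∃ τ ∈ (E k).charts, σ = chartSigma k τ}
  cover := fun x => by
    obtain ⟨τ, hτ, hx⟩ := (E x.1).cover x.2
    exact ⟨_, ⟨x.1, τ, hτ, rfl⟩, x.2, hx, rfl⟩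
  compat := by
    rintro _ ⟨k, τ, hτ, rfl⟩ _ ⟨k', τ', hτ', rfl⟩ _ ⟨x, hx, rfl⟩ ⟨x', hx', h⟩
    obtain rfl : k' = k := congrArg Sigma.fst h
    obtain rfl : x' = x := eq_of_heq (Sigma.mk.inj h).2
    exact linearAt_sigma (linearAt_comp (ψ := fun x => x) (Ψ := id) QPVariety.IsRegularMap.id
      (fun _ => rfl) ((E k').compat τ hτ τ' hτ' x' hx hx') (linearAt_inc k' τ' x'))

theorem isBundleMap_inc (k : J) :
    IsBundleMap (E k) (sigma E) (QPVariety.inc k) (fun e => ⟨k, e⟩) := by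
  refine isBundleMap_of_local (QPVariety.isRegularMap_mk k) (fun _ => rfl) fun x => ?_
  obtain ⟨τ, hτ, hx⟩ := (E k).cover x
  exact ⟨τ, hτ, _, ⟨k, τ, hτ, rfl⟩, hx, ⟨x, hx, rfl⟩, linearAt_inc k τ x⟩

theorem isBundleMap_sigma {ψ : (QPVariety.sigma X).pts → Y.pts} {Ψ : (sigma E).tot → F.tot}
    (h : ∀ j, IsBundleMap (E j) F (fun x => ψ (QPVariety.inc j x)) (fun e => Ψ ⟨j, e⟩)) :
    IsBundleMap (sigma E) F ψ Ψ := by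
  refine ⟨QPVariety.isRegularMap_sigma fun j => (h j).1, fun e => (h e.1).2.1 e.2, ?_⟩
  rintro _ ⟨k, τ, hτ, rfl⟩ σ hσ _ ⟨x, hx, rfl⟩ hx'
  exact linearAt_sigma ((h k).2.2 τ hτ σ hσ x hx hx')

end sigma

/-! Transport along bijections. -/

section transport

variable {S T : Type}

/-- A chart carried along bijections of the base and of the total space. -/
def chartTransport (a : S ≃ X.pts) (b : T ≃ E.tot) (τ : Chart X E.proj) :
    Chart (X.transport a) (fun e : T => a.symm (E.proj (b e))) where
  dom := a ⁻¹' τ.dom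
  isOpen_dom := τ.isOpen_dom.preimage (QPVariety.isRegularMap_transport a).1
  rank := τ.rank
  coord := fun e => τ.coord (b e)
  bijective := by
    intro x hx
    obtain ⟨h1, h2⟩ := τ.bijective (a x) hx
    constructor
    · rintro ⟨e, he⟩ ⟨e', he'⟩ h
      have := @h1 ⟨b e, by rw [← he]; exact (a.apply_symm_apply _).symm⟩
        ⟨b e', by rw [← he']; exact (a.apply_symm_apply _).symm⟩ h
      simpa using this
    · intro v
      obtain ⟨⟨e, he⟩, hv⟩ := h2 v
      refine ⟨⟨b.symm e, ?_⟩, ?_⟩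
      · rw [b.apply_symm_apply, he]
        exact a.symm_apply_apply x
      · simpa using hv

/-- A vector bundle carried along bijections of the base and of the total space. -/
def transport (E : VBundle X) (a : S ≃ X.pts) (b : T ≃ E.tot) : VBundle (X.transport a) where
  tot := T
  proj := fun e => a.symm (E.proj (b e))
  charts := {σ | ∃ τ ∈ E.charts, σ = chartTransport a b τ}
  cover := fun x => by
    obtain ⟨τ, hτ, hx⟩ := E.cover (a x)
    exact ⟨_, ⟨τ, hτ, rfl⟩, hx⟩
  compat := by
    rintro _ ⟨τ, hτ, rfl⟩ _ ⟨τ', hτ', rfl⟩ x hx hx'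
    obtain ⟨L, hL, he⟩ := E.compat τ hτ τ' hτ' (a x) hx hx'
    refine ⟨fun y => L (a y), fun v i => (QPVariety.isRegularMap_transport a).2 x _ (hL v i), ?_⟩
    filter_upwards [(QPVariety.isRegularMap_transport a).1.continuousAt.eventually he]
      with y hy e hey
    refine hy (b e) ?_
    rw [← hey]
    exact (a.apply_symm_apply _).symm

theorem isBundleMap_transport (a : S ≃ X.pts) (b : T ≃ E.tot) :
    IsBundleMap (E.transport a b) E a b := by
  refine isBundleMap_of_local (QPVariety.isRegularMap_transport a)
    (fun e => (a.apply_symm_apply _).symm) fun x => ?_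
  obtain ⟨τ, hτ, hx⟩ := E.cover (a x)
  exact ⟨_, ⟨τ, hτ, rfl⟩, τ, hτ, hx, hx, fun _ => LinearMap.id,
    fun _ _ => QPVariety.RegularAt.const _, Filter.Eventually.of_forall fun _ _ _ => rfl⟩

theorem isBundleMap_transport_symm (a : S ≃ X.pts) (b : T ≃ E.tot) :
    IsBundleMap E (E.transport a b) a.symm b.symm := by
  refine isBundleMap_of_local (QPVariety.isRegularMap_transport_symm a) (fun e => ?_) fun x => ?_
  · exact congrArg (fun e => a.symm (E.proj e)) (b.apply_symm_apply e)
  · obtain ⟨τ, hτ, hx⟩ := E.cover x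
    refine ⟨τ, hτ, _, ⟨τ, hτ, rfl⟩, hx, ?_, fun _ => LinearMap.id,
      fun _ _ => QPVariety.RegularAt.const _, Filter.Eventually.of_forall fun _ e _ => ?_⟩
    · change a (a.symm x) ∈ τ.dom
      rwa [a.apply_symm_apply]
    · exact congrArg τ.coord (b.apply_symm_apply e)

end transport

end VBundle

/-! Varieties with finite group actions and equivariant vector bundles. -/

/-- A variety with an action of `G` and a `G`-equivariant vector bundle over it: `G` acts on the
total space by automorphisms of the bundle over the action on the base. -/
structure GBundle (G : Type) [Group G] : Type 1 where
  base : QPVariety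
  bundle : VBundle base
  [actBase : MulAction G base.pts]
  [actTot : MulAction G bundle.tot]
  isBundleMap_smul : ∀ g : G, IsBundleMap bundle bundle (fun x => g • x) (fun e => g • e)

namespace GBundle

attribute [instance] GBundle.actBase GBundle.actTot

variable {G K H : Type} [Group G] [Group K] [Group H]

theorem proj_smul (X : GBundle G) (g : G) (e : X.bundle.tot) :
    X.bundle.proj (g • e) = g • X.bundle.proj e := (X.isBundleMap_smul g).2.1 e

/-- The restriction to an invariant locally closed subvariety. -/
def restrict (X : GBundle G) (S : Set X.base.pts) (hS : IsLocallyClosed S)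
    (hG : ∀ (g : G), ∀ x ∈ S, g • x ∈ S) : GBundle G where
  base := X.base.sub S hS
  bundle := X.bundle.restrict S hS
  actBase :=
    { smul := fun g x => ⟨g • x.1, hG g x.1 x.2⟩
      one_smul := fun x => Subtype.ext (one_smul G x.1)
      mul_smul := fun g h x => Subtype.ext (mul_smul g h x.1) }
  actTot :=
    { smul := fun g e => ⟨g • e.1, by rw [proj_smul]; exact hG g _ e.2⟩
      one_smul := fun e => Subtype.ext (one_smul G e.1)
      mul_smul := fun g h e => Subtype.ext (mul_smul g h e.1) }
  isBundleMap_smul := fun g =>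
    VBundle.isBundleMap_restrict (X.isBundleMap_smul g) _ _ (fun _ => rfl) (fun _ => rfl)

/-- The disjoint union of a finite family. -/
def sigma {J : Type} [Finite J] (X : J → GBundle G) : GBundle G where
  base := QPVariety.sigma fun j => (X j).base
  bundle := VBundle.sigma fun j => (X j).bundle
  actBase :=
    { smul := fun g x => ⟨x.1, g • x.2⟩
      one_smul := fun x => Sigma.ext rfl (heq_of_eq (one_smul G x.2))
      mul_smul := fun g h x => Sigma.ext rfl (heq_of_eq (mul_smul g h x.2)) }
  actTot :=
    { smul := fun g x => ⟨x.1, g • x.2⟩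
      one_smul := fun x => Sigma.ext rfl (heq_of_eq (one_smul G x.2))
      mul_smul := fun g h x => Sigma.ext rfl (heq_of_eq (mul_smul g h x.2)) }
  isBundleMap_smul := fun g => VBundle.isBundleMap_sigma fun j =>
    VBundle.isBundleMap_comp (VBundle.isBundleMap_inc j) ((X j).isBundleMap_smul g)

/-- The disjoint union of two varieties with equivariant bundles for the same group. -/
def disjUnion (X Y : GBundle G) : GBundle G := sigma fun b : Bool => if b then X else Y

/-! The Cartesian product. -/

/-- A pair of varieties, as a family. -/
def pairVar (X Y : QPVariety) : Bool → QPVariety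
  | true => X
  | false => Y

/-- A pair of bundles, as a family. -/
def pairBundle {X Y : QPVariety} (E : VBundle X) (F : VBundle Y) :
    ∀ b, VBundle (pairVar X Y b)
  | true => E
  | false => F

/-- Pairs of points are points of the product. -/
def pairVarEquiv (X Y : QPVariety) : X.pts × Y.pts ≃ (QPVariety.pi (pairVar X Y)).pts where
  toFun := fun x b => match b with
    | true => x.1
    | false => x.2
  invFun := fun x => (x true, x false)
  left_inv := fun _ => rfl
  right_inv := fun x => by
    funext b
    cases b <;> rfl

/-- Pairs of vectors are vectors of the product. -/
def pairBundleEquiv {X Y : QPVariety} (E : VBundle X) (F : VBundle Y) :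
    E.tot × F.tot ≃ (VBundle.pi (pairBundle E F)).tot where
  toFun := fun x b => match b with
    | true => x.1
    | false => x.2
  invFun := fun x => (x true, x false)
  left_inv := fun _ => rfl
  right_inv := fun x => by
    funext b
    cases b <;> rfl

theorem isBundleMap_pair {X X' Y Y' : QPVariety} {E : VBundle X} {E' : VBundle X'} {F : VBundle Y}
    {F' : VBundle Y'} {ψ : X.pts → X'.pts} {Ψ : E.tot → E'.tot} {φ : Y.pts → Y'.pts}
    {Φ : F.tot → F'.tot} (h : IsBundleMap E E' ψ Ψ) (h' : IsBundleMap F F' φ Φ) :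
    IsBundleMap ((VBundle.pi (pairBundle E F)).transport (pairVarEquiv X Y) (pairBundleEquiv E F))
      ((VBundle.pi (pairBundle E' F')).transport (pairVarEquiv X' Y') (pairBundleEquiv E' F'))
      (Prod.map ψ φ) (Prod.map Ψ Φ) := by
  have h1 : IsBundleMap
      ((VBundle.pi (pairBundle E F)).transport (pairVarEquiv X Y) (pairBundleEquiv E F))
      (VBundle.pi (pairBundle E' F')) (fun x => pairVarEquiv X' Y' (Prod.map ψ φ x))
      (fun e => pairBundleEquiv E' F' (Prod.map Ψ Φ e)) := by
    refine VBundle.isBundleMap_pi fun b => ?_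
    have h2 := VBundle.isBundleMap_comp (VBundle.isBundleMap_proj (pairBundle E F) b)
      (VBundle.isBundleMap_transport (pairVarEquiv X Y) (pairBundleEquiv E F))
    cases b with
    | true => exact VBundle.isBundleMap_comp h h2
    | false => exact VBundle.isBundleMap_comp h' h2
  exact VBundle.isBundleMap_comp
    (VBundle.isBundleMap_transport_symm (pairVarEquiv X' Y') (pairBundleEquiv E' F')) h1

/-- The Cartesian product `(Z₁ × Z₂, E₁ × E₂, G × K)`. -/
def prod (X : GBundle G) (Y : GBundle K) : GBundle (G × K) where
  base := (QPVariety.pi (pairVar X.base Y.base)).transport (pairVarEquiv X.base Y.base)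
  bundle := (VBundle.pi (pairBundle X.bundle Y.bundle)).transport
    (pairVarEquiv X.base Y.base) (pairBundleEquiv X.bundle Y.bundle)
  actBase :=
    { smul := fun g x => (g.1 • x.1, g.2 • x.2)
      one_smul := fun x => Prod.ext (one_smul G x.1) (one_smul K x.2)
      mul_smul := fun g h x => Prod.ext (mul_smul g.1 h.1 x.1) (mul_smul g.2 h.2 x.2) }
  actTot :=
    { smul := fun g x => (g.1 • x.1, g.2 • x.2)
      one_smul := fun x => Prod.ext (one_smul G x.1) (one_smul K x.2)
      mul_smul := fun g h x => Prod.ext (mul_smul g.1 h.1 x.1) (mul_smul g.2 h.2 x.2) }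
  isBundleMap_smul := fun g =>
    isBundleMap_pair (X.isBundleMap_smul g.1) (Y.isBundleMap_smul g.2)

/-! Cartesian powers and wreath products. -/

/-- The wreath product `Gⁿ ⋊ Sₙ`; a permutation `σ` acts on `Gⁿ` by
`(σ a) i = a (σ⁻¹ i)`. -/
abbrev Wreath (G : Type) [Group G] (n : ℕ) : Type :=
  (Fin n → G) ⋊[mulAutArrow] Equiv.Perm (Fin n)

instance (n : ℕ) [Finite G] : Finite (Wreath G n) :=
  Finite.of_equiv _ SemidirectProduct.equivProd.symm

/-- The action of the wreath product on the `n`-th power of a set with an action of `G`. -/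
@[reducible]
def wreathAction (n : ℕ) (T : Type) [MulAction G T] : MulAction (Wreath G n) (Fin n → T) where
  smul := fun w x i => w.left i • x (w.right⁻¹ i)
  one_smul := fun x => by
    funext i
    change (1 : G) • x ((1 : Equiv.Perm (Fin n))⁻¹ i) = x i
    simp
  mul_smul := fun v w x => by
    funext i
    change (v * w).left i • x ((v * w).right⁻¹ i) =
      v.left i • w.left (v.right⁻¹ i) • x (w.right⁻¹ (v.right⁻¹ i))
    rw [smul_smul]
    simp only [SemidirectProduct.mul_left, SemidirectProduct.mul_right, mul_inv_rev]
    rfl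

/-- The Cartesian power `(Zⁿ, Eⁿ, Gₙ)`. -/
def power (X : GBundle G) (n : ℕ) : GBundle (Wreath G n) where
  base := QPVariety.pi fun _ : Fin n => X.base
  bundle := VBundle.pi fun _ : Fin n => X.bundle
  actBase := wreathAction n X.base.pts
  actTot := wreathAction n X.bundle.tot
  isBundleMap_smul := fun w => VBundle.isBundleMap_pi fun i =>
    VBundle.isBundleMap_comp (X.isBundleMap_smul (w.left i))
      (VBundle.isBundleMap_proj (fun _ : Fin n => X.bundle) (w.right⁻¹ i))

/-- The complement in `Zⁿ` of the big `G`-diagonal: the tuples of points with pairwise different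
`G`-orbits. -/
def offDiag (X : GBundle G) (n : ℕ) : Set (X.power n).base.pts :=
  {x | ∀ i j : Fin n, i ≠ j → ∀ g : G, g • (x : Fin n → X.base.pts) i ≠ (x : Fin n → X.base.pts) j}

theorem isOpen_ne_of_isRegularMap {X Y : QPVariety} {φ ψ : X.pts → Y.pts}
    (hφ : X.IsRegularMap Y φ) (hψ : X.IsRegularMap Y ψ) : IsOpen {x | φ x ≠ ψ x} := by
  refine isOpen_iff_mem_nhds.mpr fun x hx => ?_
  obtain ⟨f, hf, ⟨i, hi⟩, hfe⟩ := hφ.exists_coords x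
  obtain ⟨f', hf', ⟨i', hi'⟩, hfe'⟩ := hψ.exists_coords x
  obtain ⟨k, l, hkl⟩ : ∃ k l, f k x * f' l x - f l x * f' k x ≠ 0 := by
    by_contra hcon
    push Not at hcon
    refine hx (Y.emb_injective ?_)
    obtain ⟨c, hc⟩ := hfe.self_of_nhds
    obtain ⟨c', hc'⟩ := hfe'.self_of_nhds
    have hc0 : c' ≠ 0 := by
      rintro rfl
      exact (Y.emb (ψ x)).vec_ne_zero (by rw [zero_smul] at hc'; exact hc')
    refine ProjSpace.ext_of_smul (c := c * f i' x * (c' * f' i' x)⁻¹) ?_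
    change Y.hcoord (φ x) = _ • Y.hcoord (ψ x)
    rw [hc, hc']
    ext k
    simp only [Pi.smul_apply, smul_eq_mul]
    have := hcon k i'
    field_simp
    linear_combination c * this
  have hreg : X.RegularAt (fun y => f k y * f' l y + (-1) * (f l y * f' k y)) x :=
    ((hf k).mul (hf' l)).add ((QPVariety.RegularAt.const (-1)).mul ((hf l).mul (hf' k)))
  filter_upwards [hreg.eventually_ne (by simpa [sub_eq_add_neg] using hkl), hfe, hfe']
    with y hy h1 h2 heq
  obtain ⟨c, hc⟩ := h1
  obtain ⟨c', hc'⟩ := h2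
  have hcc : (c • fun i => f i y) = c' • fun i => f' i y := by rw [← hc, ← hc', heq]
  have hc0 : c ≠ 0 := by
    rintro rfl
    exact (Y.emb (φ y)).vec_ne_zero (by rw [zero_smul] at hc; exact hc)
  have hk : c * f k y = c' * f' k y := congrFun hcc k
  have hl : c * f l y = c' * f' l y := congrFun hcc l
  refine hy (mul_left_cancel₀ hc0 ?_)
  linear_combination f' l y * hk - f' k y * hl

theorem isOpen_offDiag [Finite G] (X : GBundle G) (n : ℕ) : IsOpen (X.offDiag n) := by
  have : X.offDiag n = ⋂ (i : Fin n) (j : Fin n) (_ : i ≠ j) (g : G),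
      {x : (QPVariety.pi fun _ : Fin n => X.base).pts | g • x i ≠ x j} := by
    refine Set.ext fun x => Iff.trans ?_ (Set.mem_iInter₂.trans (forall₂_congr fun i j =>
      Set.mem_iInter₂)).symm
    rfl
  rw [this]
  refine isOpen_iInter_of_finite fun i => isOpen_iInter_of_finite fun j =>
    isOpen_iInter_of_finite fun _ => isOpen_iInter_of_finite fun g => ?_
  exact isOpen_ne_of_isRegularMap
    ((X.isBundleMap_smul g).1.comp (QPVariety.isRegularMap_proj _ i))
    (QPVariety.isRegularMap_proj _ j)

theorem smul_mem_offDiag (X : GBundle G) (n : ℕ) (w : Wreath G n) (x : (X.power n).base.pts)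
    (hx : x ∈ X.offDiag n) : w • x ∈ X.offDiag n := by
  intro i j hij g h
  refine hx (w.right⁻¹ i) (w.right⁻¹ j) (fun h => hij (w.right⁻¹.injective h))
    ((w.left j)⁻¹ * g * w.left i) ?_
  have h' : g • w.left i • (x : Fin n → X.base.pts) (w.right⁻¹ i) =
    w.left j • (x : Fin n → X.base.pts) (w.right⁻¹ j) := h
  rw [mul_smul, mul_smul, h', inv_smul_smul]

/-- The configuration space `(Zⁿ ∖ Δ_G, Eⁿ restricted to it, Gₙ)`. -/
def config [Finite G] (X : GBundle G) (n : ℕ) : GBundle (Wreath G n) :=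
  (X.power n).restrict (X.offDiag n) (X.isOpen_offDiag n).isLocallyClosed (X.smul_mem_offDiag n)

/-! Induction. -/

/-- The equivalence relation on `H × T` with quotient `ind_G^H T`, for `φ : G → H`. -/
def indSetoid (φ : G →* H) (T : Type) [MulAction G T] : Setoid (H × T) where
  r := fun a b => ∃ g : G, b.1 = a.1 * (φ g)⁻¹ ∧ b.2 = g • a.2
  iseqv :=
    { refl := fun a => ⟨1, by simp, by simp⟩
      symm := by
        rintro a b ⟨g, h1, h2⟩
        exact ⟨g⁻¹, by rw [h1]; simp, by rw [h2]; simp⟩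
      trans := by
        rintro a b c ⟨g, h1, h2⟩ ⟨g', h3, h4⟩
        exact ⟨g' * g, by rw [h3, h1]; simp [mul_assoc], by rw [h4, h2, mul_smul]⟩ }

/-- The induced `H`-set `ind_G^H T = (H × T)/∼`. -/
def Ind (φ : G →* H) (T : Type) [MulAction G T] : Type := Quotient (indSetoid φ T)

/-- The class of `(h, x)`. -/
def Ind.mk (φ : G →* H) {T : Type} [MulAction G T] (h : H) (x : T) : Ind φ T :=
  Quotient.mk (indSetoid φ T) (h, x)

instance (φ : G →* H) (T : Type) [MulAction G T] : MulAction H (Ind φ T) where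
  smul := fun h => Quotient.map (fun a => (h * a.1, a.2)) (by
    rintro a b ⟨g, h1, h2⟩
    exact ⟨g, by rw [h1, mul_assoc], h2⟩)
  one_smul := by
    rintro ⟨h, x⟩
    exact congrArg (Quotient.mk _) (Prod.ext (one_mul h) rfl)
  mul_smul := by
    rintro a b ⟨h, x⟩
    exact congrArg (Quotient.mk _) (Prod.ext (mul_assoc a b h) rfl)

theorem Ind.smul_mk (φ : G →* H) {T : Type} [MulAction G T] (a h : H) (x : T) :
    a • Ind.mk φ h x = Ind.mk φ (a * h) x := rfl

theorem Ind.mk_eq (φ : G →* H) {T : Type} [MulAction G T] (g : G) (h : H) (x : T) :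
    Ind.mk φ (h * (φ g)⁻¹) (g • x) = Ind.mk φ h x :=
  (Quotient.sound (s := indSetoid φ T) ⟨g, rfl, rfl⟩).symm

/-- The element of `G` that relates `h` to the chosen representative of its coset. -/
def indElt (φ : G →* H) (h : H) : G :=
  Classical.choose (p := fun g => φ g = ((h : H ⧸ φ.range).out)⁻¹ * h) (by
    have := QuotientGroup.mk_out_eq_mul φ.range h
    obtain ⟨⟨_, g, rfl⟩, hg⟩ := this
    exact ⟨g⁻¹, by rw [hg]; simp⟩)

theorem map_indElt (φ : G →* H) (h : H) : φ (indElt φ h) = ((h : H ⧸ φ.range).out)⁻¹ * h :=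
  Classical.choose_spec (p := fun g => φ g = ((h : H ⧸ φ.range).out)⁻¹ * h) _

theorem indElt_mul (φ : G →* H) (hφ : Function.Injective φ) (h : H) (g : G) :
    indElt φ (h * (φ g)⁻¹) = indElt φ h * g⁻¹ := by
  apply hφ
  have : ((h * (φ g)⁻¹ : H) : H ⧸ φ.range) = (h : H ⧸ φ.range) := by
    rw [QuotientGroup.eq]
    simp
  rw [map_mul, map_indElt, map_indElt, this, map_inv, mul_assoc]

/-- As a set, `ind_G^H T` is the disjoint union of copies of `T` indexed by `H/G`; on the copy of
the coset with the chosen representative `h`, the bijection is `x ↦ [(h, x)]`. -/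
def indEquiv (φ : G →* H) (hφ : Function.Injective φ) (T : Type) [MulAction G T] :
    Ind φ T ≃ Σ _ : H ⧸ φ.range, T where
  toFun := Quotient.lift (fun a => ⟨(a.1 : H ⧸ φ.range), indElt φ a.1 • a.2⟩) (by
    rintro ⟨h, x⟩ ⟨h', x'⟩ ⟨g, h1, h2⟩
    obtain rfl : h' = h * (φ g)⁻¹ := h1
    obtain rfl : x' = g • x := h2
    refine Sigma.ext ?_ (heq_of_eq ?_)
    · change (h : H ⧸ φ.range) = ((h * (φ g)⁻¹ : H) : H ⧸ φ.range)
      rw [QuotientGroup.eq]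
      simp
    · change indElt φ h • x = indElt φ (h * (φ g)⁻¹) • g • x
      rw [indElt_mul φ hφ, mul_smul, inv_smul_smul])
  invFun := fun a => Ind.mk φ a.1.out a.2
  left_inv := by
    rintro ⟨h, x⟩
    change Ind.mk φ (h : H ⧸ φ.range).out (indElt φ h • x) = Ind.mk φ h x
    rw [← Ind.mk_eq φ (indElt φ h) h x, map_indElt]
    simp
  right_inv := by
    rintro ⟨c, x⟩
    have hc : ((c.out : H) : H ⧸ φ.range) = c := Quotient.out_eq c
    have h1 : indElt φ c.out = 1 := by
      apply hφ
      rw [map_indElt, hc, map_one, inv_mul_cancel]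
    refine Sigma.ext hc (heq_of_eq ?_)
    change indElt φ c.out • x = x
    rw [h1, one_smul]

instance [Finite H] (φ : G →* H) : Finite (H ⧸ φ.range) := Quotient.finite _

/-- The induced triple `(ind_G^H Z, ind_G^H E, H)` for an embedding `φ : G → H` of finite groups.
As a variety, `ind_G^H Z` is the disjoint union of copies of `Z` indexed by `H/G`. A different
choice of representatives of the cosets gives the same variety and bundle up to the identity
isomorphism, since `G` acts by automorphisms. -/
def induce [Finite H] (X : GBundle G) (φ : G →* H) (hφ : Function.Injective φ) : GBundle H where
  base := (QPVariety.sigma fun _ : H ⧸ φ.range => X.base).transport (indEquiv φ hφ X.base.pts)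
  bundle := (VBundle.sigma fun _ : H ⧸ φ.range => X.bundle).transport
    (indEquiv φ hφ X.base.pts) (indEquiv φ hφ X.bundle.tot)
  actBase := inferInstanceAs (MulAction H (Ind φ X.base.pts))
  actTot := inferInstanceAs (MulAction H (Ind φ X.bundle.tot))
  isBundleMap_smul := fun h => by
    have h1 : IsBundleMap (VBundle.sigma fun _ : H ⧸ φ.range => X.bundle)
        ((VBundle.sigma fun _ : H ⧸ φ.range => X.bundle).transport
          (indEquiv φ hφ X.base.pts) (indEquiv φ hφ X.bundle.tot))
        (fun a => h • (indEquiv φ hφ X.base.pts).symm a)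
        (fun a => h • (indEquiv φ hφ X.bundle.tot).symm a) := by
      refine VBundle.isBundleMap_sigma fun c => ?_
      refine (VBundle.isBundleMap_comp (VBundle.isBundleMap_transport_symm
          (indEquiv φ hφ X.base.pts) (indEquiv φ hφ X.bundle.tot))
        (VBundle.isBundleMap_comp
          (VBundle.isBundleMap_inc (E := fun _ : H ⧸ φ.range => X.bundle)
            ((h * c.out : H) : H ⧸ φ.range))
          (X.isBundleMap_smul (indElt φ (h * c.out))))).congr ?_ ?_
      · exact fun x =>
          ((indEquiv φ hφ X.base.pts).symm_apply_apply (h • Ind.mk φ c.out x)).symm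
      · exact fun e =>
          ((indEquiv φ hφ X.bundle.tot).symm_apply_apply (h • Ind.mk φ c.out e)).symm
    refine (VBundle.isBundleMap_comp h1 (VBundle.isBundleMap_transport
      (indEquiv φ hφ X.base.pts) (indEquiv φ hφ X.bundle.tot))).congr ?_ ?_
    · exact fun x => congrArg (fun y : Ind φ X.base.pts => h • y)
        ((indEquiv φ hφ X.base.pts).symm_apply_apply x).symm
    · exact fun e => congrArg (fun y : Ind φ X.bundle.tot => h • y)
        ((indEquiv φ hφ X.bundle.tot).symm_apply_apply e).symm

/-- The one-point variety `Spec ℂ`. -/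
def pointVar : QPVariety where
  pts := Unit
  idx := Unit
  emb := fun _ => ProjSpace.of (fun _ => 1) (fun h => one_ne_zero (congrFun h ()))
  emb_injective := fun _ _ _ => rfl
  isLocallyClosed_range := by
    have : Set.range (fun _ : Unit => ProjSpace.of (fun _ : Unit => (1 : ℂ))
        (fun h => one_ne_zero (congrFun h ()))) = Set.univ := by
      refine Set.eq_univ_of_forall fun x => ⟨(), ?_⟩
      obtain ⟨c, hc, h⟩ := ProjSpace.vec_of (fun _ : Unit => (1 : ℂ))
        (fun h => one_ne_zero (congrFun h ()))
      obtain ⟨i, hi⟩ := x.exists_vec_ne_zero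
      refine ProjSpace.ext_of_smul (c := c * (x.vec i)⁻¹) (h.trans (funext fun j => ?_))
      simp only [Pi.smul_apply, smul_eq_mul]
      rw [mul_assoc, inv_mul_cancel₀ hi]
    rw [this]
    exact isOpen_univ.isLocallyClosed

/-- The vector bundle of rank zero over a variety. -/
def zeroBundle (X : QPVariety) : VBundle X where
  tot := X.pts
  proj := id
  charts := {τ | IsEmpty τ.rank}
  cover := fun x =>
    ⟨{  dom := Set.univ
        isOpen_dom := isOpen_univ
        rank := Empty
        coord := fun _ i => i.elim
        bijective := fun x _ => ⟨fun e e' _ => Subtype.ext (e.2.trans e'.2.symm),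
          fun _ => ⟨⟨x, rfl⟩, funext fun i => i.elim⟩⟩ },
      (inferInstance : IsEmpty Empty), Set.mem_univ x⟩
  compat := fun _ _ _ hτ' _ _ _ => ⟨fun _ => 0,
    fun _ i => (hτ'.false i).elim,
    Filter.Eventually.of_forall fun _ _ _ => funext fun i => (hτ'.false i).elim⟩

/-- The point with the rank zero bundle and the group with one element. -/
def point : GBundle Unit where
  base := pointVar
  bundle := zeroBundle pointVar
  actBase := { smul := fun _ x => x, one_smul := fun _ => rfl, mul_smul := fun _ _ _ => rfl }
  actTot := { smul := fun _ x => x, one_smul := fun _ => rfl, mul_smul := fun _ _ _ => rfl }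
  isBundleMap_smul := fun _ => VBundle.isBundleMap_id

theorem smul_mem_compl (X : GBundle G) {S : Set X.base.pts}
    (hG : ∀ (g : G), ∀ x ∈ S, g • x ∈ S) (g : G) (x : X.base.pts) (hx : x ∈ Sᶜ) : g • x ∈ Sᶜ :=
  fun h => hx (by simpa using hG g⁻¹ _ h)

end GBundle

/-- A variety with a pure action and an equivariant vector bundle: a triple `(Z, E, G)` with a
finite group `G`. -/
structure Triple : Type 1 where
  G : Type
  [group : Group G]
  [finite : Finite G]
  obj : GBundle G

namespace Triple

attribute [instance] Triple.group Triple.finite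

/-- The triple `(Z, E, G)` of a variety with an equivariant bundle for a finite group. -/
abbrev of {G : Type} [Group G] [Finite G] (X : GBundle G) : Triple := ⟨G, X⟩

/-- Isomorphism of triples `(Z, E, G)` and `(Z', E', G')`: an isomorphism of groups and an
isomorphism of varieties with vector bundles that is equivariant relative to it. -/
def Iso (X Y : Triple) : Prop :=
  ∃ (φ : X.G ≃* Y.G) (ψ : X.obj.base.pts ≃ Y.obj.base.pts)
    (Ψ : X.obj.bundle.tot ≃ Y.obj.bundle.tot),
    IsBundleMap X.obj.bundle Y.obj.bundle ψ Ψ ∧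
    IsBundleMap Y.obj.bundle X.obj.bundle ψ.symm Ψ.symm ∧
    (∀ (g : X.G) (x : X.obj.base.pts), ψ (g • x) = φ g • ψ x) ∧
    ∀ (g : X.G) (e : X.obj.bundle.tot), Ψ (g • e) = φ g • Ψ e

end Triple

/-- A quasi-projective variety with a finite groups action and an equivariant vector bundle: a
finite disjoint union of triples, with different groups in general. -/
structure MultiTriple : Type 1 where
  I : Type
  [finite : Finite I]
  comp : I → Triple

namespace MultiTriple

attribute [instance] MultiTriple.finite

/-- A triple, as a disjoint union with one component. -/
def single (X : Triple) : MultiTriple := ⟨Unit, fun _ => X⟩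

/-- The Cartesian product. -/
def prod (X Y : MultiTriple) : MultiTriple :=
  ⟨X.I × Y.I, fun i => Triple.of ((X.comp i.1).obj.prod (Y.comp i.2).obj)⟩

/-- The restriction to an invariant locally closed subvariety. -/
def restrict (X : MultiTriple) (S : ∀ i, Set (X.comp i).obj.base.pts)
    (hS : ∀ i, IsLocallyClosed (S i))
    (hG : ∀ i (g : (X.comp i).G), ∀ x ∈ S i, g • x ∈ S i) : MultiTriple :=
  ⟨X.I, fun i => Triple.of ((X.comp i).obj.restrict (S i) (hS i) (hG i))⟩

/-- A partition: every component is decomposed into finitely many invariant locally closed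
pieces. -/
structure Partition (X : MultiTriple) : Type 1 where
  P : X.I → Type
  [finite : ∀ i, Finite (P i)]
  part : ∀ i, P i → Set (X.comp i).obj.base.pts
  isLocallyClosed : ∀ i k, IsLocallyClosed (part i k)
  smul_mem : ∀ i k (g : (X.comp i).G), ∀ x ∈ part i k, g • x ∈ part i k
  existsUnique : ∀ i x, ∃! k, x ∈ part i k

/-- A piece of a partition. -/
def Partition.piece {X : MultiTriple} (p : X.Partition) (k : Σ i, p.P i) : Triple :=
  Triple.of ((X.comp k.1).obj.restrict (p.part k.1 k.2) (p.isLocallyClosed k.1 k.2)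
    (p.smul_mem k.1 k.2))

/-- Equivalence: there are partitions with isomorphic pieces. -/
def Equivalent (X Y : MultiTriple) : Prop :=
  ∃ (p : X.Partition) (q : Y.Partition) (e : (Σ i, p.P i) ≃ Σ i, q.P i),
    ∀ k, (p.piece k).Iso (q.piece (e k))

end MultiTriple

/-! The Grothendieck ring of varieties with equivariant vector bundles. -/

/-- The defining relations of `K₀^{fGr}(Vect_ℂ)`: equivalence, the scissor relation for invariant
Zariski closed subvarieties, and induction along embeddings of finite groups. -/
inductive K0Rel : FreeAbelianGroup MultiTriple → Prop
  | equivalent (X Y : MultiTriple) (h : X.Equivalent Y) :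
      K0Rel (FreeAbelianGroup.of X - FreeAbelianGroup.of Y)
  | closed (X : MultiTriple) (S : ∀ i, Set (X.comp i).obj.base.pts) (hS : ∀ i, IsClosed (S i))
      (hG : ∀ i (g : (X.comp i).G), ∀ x ∈ S i, g • x ∈ S i) :
      K0Rel (FreeAbelianGroup.of X -
        (FreeAbelianGroup.of (X.restrict S (fun i => (hS i).isLocallyClosed) hG) +
          FreeAbelianGroup.of (X.restrict (fun i => (S i)ᶜ)
            (fun i => (hS i).isOpen_compl.isLocallyClosed)
            (fun i => (X.comp i).obj.smul_mem_compl (hG i)))))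
  | induced (X : Triple) (H : Type) [Group H] [Finite H] (φ : X.G →* H)
      (hφ : Function.Injective φ) :
      K0Rel (FreeAbelianGroup.of (MultiTriple.single (Triple.of (X.obj.induce φ hφ))) -
        FreeAbelianGroup.of (MultiTriple.single X))

/-- The abelian group `K₀^{fGr}(Vect_ℂ)`. -/
def K0 : Type 1 := FreeAbelianGroup MultiTriple ⧸ AddSubgroup.closure {x | K0Rel x}

instance K0.addCommGroup : AddCommGroup K0 :=
  inferInstanceAs (AddCommGroup (FreeAbelianGroup MultiTriple ⧸ AddSubgroup.closure {x | K0Rel x}))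

/-- The class of a variety with finite groups action and equivariant vector bundle. -/
def MultiTriple.cls (X : MultiTriple) : K0 := QuotientAddGroup.mk (FreeAbelianGroup.of X)

/-- The class `[(Z, E, G)]`. -/
def Triple.cls (X : Triple) : K0 := (MultiTriple.single X).cls

/-- `R` is the ring structure of `K₀^{fGr}(Vect_ℂ)`: its addition is that of the group, its
multiplication is given by the Cartesian product, its unit is the class of the point. -/
structure IsCartesianRing (R : CommRing K0) : Prop where
  addCommGroup_eq : R.toRing.toAddCommGroup = K0.addCommGroup
  mul_cls : ∀ X Y : MultiTriple, R.mul X.cls Y.cls = (X.prod Y).cls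
  one_eq : R.one = (Triple.of GBundle.point).cls

/-- `1 + ∑_{n ≥ 1} [(Zⁿ, Eⁿ, Gₙ)] tⁿ`. -/
def zeta [CommRing K0] {G : Type} [Group G] [Finite G] (X : GBundle G) : PowerSeries K0 :=
  PowerSeries.mk fun n => if n = 0 then 1 else (Triple.of (X.power n)).cls

/-- `1 + ∑_{n ≥ 1} [(Zⁿ ∖ Δ_G, Eⁿ restricted to it, Gₙ)] tⁿ`. -/
def lam [CommRing K0] {G : Type} [Group G] [Finite G] (X : GBundle G) : PowerSeries K0 :=
  PowerSeries.mk fun n => if n = 0 then 1 else (Triple.of (X.config n)).cls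

/-- A `λ`-structure on a ring: an additive-to-multiplicative map to `1 + t R[[t]]` with
`L a = 1 + a t + …`. -/
structure IsLambdaStructure {R : Type*} [CommRing R] (L : R → PowerSeries R) : Prop where
  coeff_zero : ∀ a, PowerSeries.coeff 0 (L a) = 1
  coeff_one : ∀ a, PowerSeries.coeff 1 (L a) = a
  map_add : ∀ a b, L (a + b) = L a * L b

end FGr

end

open FGr

/-! The argument rests on one notion, `IsAdditive`: a function on triples with values in an abelian
group that is unchanged by isomorphism and induction and is additive when an invariant closed
subvariety is cut off. Such a function extends to a homomorphism on K (`K0.lift`). The only relation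
that is not immediate is equivalence, which allows arbitrary locally closed partitions. Each piece
is a difference of two invariant closed sets, so cutting along finitely many closed sets refines the
partition, and additivity over it follows (`IsAdditive.eq_finsum`). Conversely K is generated by
classes of triples (`K0.closure_cls`), which gives all uniqueness statements.

The Cartesian product is additive in each variable, so extending twice gives the ring structure.
Each of the two series is an additive invariant with values in the multiplicative group of units of
K[[t]] (`isAdditive_powUnit`), and extending it gives the λ-structure. Then (a) holds because the
series is a function of the class, and (b) because the class of a disjoint union is the sum of the
classes.

Two geometric facts make the series additive invariants. First, if Y is induced from X along G → H,
then the n-th power of Y is induced from that of X along G_n → H_n, and likewise for configuration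
spaces (`IsInd.pow`). Secondly, let S be an invariant closed subset of Z. The tuples in Zⁿ with
exactly k entries in S form a triple induced from S^k × (Z ∖ S)^(n-k) along G_k × G_(n-k) → G_n
(`exists_isInd_append`). For configuration spaces the same holds, since points of S and of Z ∖ S are
never in one orbit. Summing over k gives the coefficients of a product of series (`cls_pow_cut`).

To avoid computing with quotients, induced triples are recognised by a criterion, `IsInd`: an
equivariant open embedding X → Y whose translates cover Y, such that only elements of G carry a
point of the image into the image. Such a Y is isomorphic to the induced triple
(`IsInd.iso_induce`). Both series are treated at once through a Boolean parameter, `true` for powers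
and `false` for configuration spaces. -/

noncomputable section

namespace FGr

/-! Embeddings of vector bundles. -/

namespace VBundle

variable {X Y W : QPVariety} {E : VBundle X} {F : VBundle Y} {K : VBundle W}

/-- The pair `(ψ, Ψ)` is an embedding of `E` into `F`: it identifies `E` with the restriction of `F`
to the image of `ψ`, and a map to `E` is a morphism as soon as its composition with the embedding
is a morphism. -/
structure IsInitial (E : VBundle X) (F : VBundle Y) (ψ : X.pts → Y.pts) (Ψ : E.tot → F.tot) :
    Prop where
  isBundleMap : IsBundleMap E F ψ Ψ
  injective : Function.Injective ψ
  injective_tot : Function.Injective Ψ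
  exists_of_proj : ∀ (f : F.tot) (x : X.pts), F.proj f = ψ x → ∃ e, Ψ e = f
  lift : ∀ {W : QPVariety} {K : VBundle W} (φ : W.pts → X.pts) (Φ : K.tot → E.tot),
    IsBundleMap K F (fun x => ψ (φ x)) (fun e => Ψ (Φ e)) → IsBundleMap K E φ Φ

namespace IsInitial

variable {ψ : X.pts → Y.pts} {Ψ : E.tot → F.tot} {ψ' : Y.pts → W.pts} {Ψ' : F.tot → K.tot}

theorem comp (h' : IsInitial F K ψ' Ψ') (h : IsInitial E F ψ Ψ) :
    IsInitial E K (fun x => ψ' (ψ x)) (fun e => Ψ' (Ψ e)) where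
  isBundleMap := isBundleMap_comp h'.isBundleMap h.isBundleMap
  injective := h'.injective.comp h.injective
  injective_tot := h'.injective_tot.comp h.injective_tot
  exists_of_proj := fun f x hf => by
    obtain ⟨e, rfl⟩ := h'.exists_of_proj f _ hf
    obtain ⟨e', rfl⟩ := h.exists_of_proj e x (h'.injective ((h'.isBundleMap.2.1 e).symm.trans hf))
    exact ⟨e', rfl⟩
  lift := fun φ Φ hΦ => h.lift φ Φ (h'.lift _ _ hΦ)

/-- Cancellation on the left. With the inclusion of a subvariety as second map, it shows that the
corestriction of an embedding is again an embedding. -/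
theorem of_comp (h' : IsInitial F K ψ' Ψ')
    (h : IsInitial E K (fun x => ψ' (ψ x)) (fun e => Ψ' (Ψ e))) : IsInitial E F ψ Ψ where
  isBundleMap := h'.lift _ _ h.isBundleMap
  injective := Function.Injective.of_comp h.injective
  injective_tot := Function.Injective.of_comp h.injective_tot
  exists_of_proj := fun f x hf => by
    obtain ⟨e, he⟩ := h.exists_of_proj (Ψ' f) x (by rw [h'.isBundleMap.2.1, hf])
    exact ⟨e, h'.injective_tot he⟩
  lift := fun φ Φ hΦ => h.lift φ Φ (isBundleMap_comp h'.isBundleMap hΦ)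

theorem of_inverse {φ : Y.pts → X.pts} {Φ : F.tot → E.tot} (h : IsBundleMap E F ψ Ψ)
    (h' : IsBundleMap F E φ Φ) (h1 : Function.LeftInverse φ ψ) (h2 : Function.LeftInverse Φ Ψ)
    (h3 : Function.RightInverse Φ Ψ) : IsInitial E F ψ Ψ where
  isBundleMap := h
  injective := h1.injective
  injective_tot := h2.injective
  exists_of_proj := fun f _ _ => ⟨Φ f, h3 f⟩
  lift := fun α A hA => (isBundleMap_comp h' hA).congr (fun x => (h1 (α x)).symm)
    (fun e => (h2 (A e)).symm)

theorem id : IsInitial E E (fun x => x) (fun e => e) :=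
  of_inverse isBundleMap_id isBundleMap_id (fun _ => rfl) (fun _ => rfl) (fun _ => rfl)

theorem surjective_tot (h : IsInitial E F ψ Ψ) (hs : Function.Surjective ψ) :
    Function.Surjective Ψ := fun f => by
  obtain ⟨x, hx⟩ := hs (F.proj f)
  exact h.exists_of_proj f x hx.symm

/-- Composed with the embedding, the inverse becomes the identity of `F`, so the lifting property
applies to it. -/
theorem isBundleMap_symm {e : X.pts ≃ Y.pts} {e' : E.tot ≃ F.tot} (h : IsInitial E F e e') :
    IsBundleMap F E e.symm e'.symm :=
  h.lift _ _ (isBundleMap_id.congr (fun x => e.apply_symm_apply x) (fun x => e'.apply_symm_apply x))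

theorem transport {S T : Type} (a : S ≃ X.pts) (b : T ≃ E.tot) :
    IsInitial (E.transport a b) E a b :=
  of_inverse (isBundleMap_transport a b) (isBundleMap_transport_symm a b)
    a.symm_apply_apply b.symm_apply_apply b.apply_symm_apply

theorem transport_symm {S T : Type} (a : S ≃ X.pts) (b : T ≃ E.tot) :
    IsInitial E (E.transport a b) a.symm b.symm :=
  of_inverse (isBundleMap_transport_symm a b) (isBundleMap_transport a b)
    a.apply_symm_apply b.apply_symm_apply b.symm_apply_apply

end IsInitial

theorem isBundleMap_val (E : VBundle X) (S : Set X.pts) (hS : IsLocallyClosed S) :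
    IsBundleMap (E.restrict S hS) E Subtype.val Subtype.val := by
  refine ⟨QPVariety.isRegularMap_val S hS, fun _ => rfl, ?_⟩
  rintro _ ⟨τ, hτ, rfl⟩ σ hσ x hx hx'
  obtain ⟨L, hL, he⟩ := E.compat τ hτ σ hσ x.1 hx hx'
  refine ⟨fun y => L y.1, fun v i => (QPVariety.isRegularMap_val S hS).2 x _ (hL v i), ?_⟩
  filter_upwards [(QPVariety.isRegularMap_val S hS).1.continuousAt.eventually he] with y hy e hey
  exact hy e.1 (congrArg Subtype.val hey)

theorem IsInitial.val (E : VBundle X) (S : Set X.pts) (hS : IsLocallyClosed S) :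
    IsInitial (E.restrict S hS) E Subtype.val Subtype.val where
  isBundleMap := isBundleMap_val E S hS
  injective := Subtype.val_injective
  injective_tot := Subtype.val_injective
  exists_of_proj := fun f x hf => ⟨⟨f, by rw [hf]; exact x.2⟩, rfl⟩
  lift := fun φ Φ h => by
    refine ⟨QPVariety.isRegularMap_sub h.1, fun e => Subtype.ext (h.2.1 e), ?_⟩
    rintro τ hτ _ ⟨σ, hσ, rfl⟩ x hx hx'
    exact h.2.2 τ hτ σ hσ x hx hx'

theorem IsInitial.pi {J : Type} [Fintype J] {X Y : J → QPVariety} {E : ∀ j, VBundle (X j)}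
    {F : ∀ j, VBundle (Y j)} {ψ : ∀ j, (X j).pts → (Y j).pts} {Ψ : ∀ j, (E j).tot → (F j).tot}
    (h : ∀ j, IsInitial (E j) (F j) (ψ j) (Ψ j)) :
    IsInitial (VBundle.pi E) (VBundle.pi F) (fun x j => ψ j (x j)) (fun e j => Ψ j (e j)) where
  isBundleMap := isBundleMap_pi fun j => isBundleMap_comp (h j).isBundleMap (isBundleMap_proj E j)
  injective := fun x y hxy => funext fun j => (h j).injective (congrFun hxy j)
  injective_tot := fun x y hxy => funext fun j => (h j).injective_tot (congrFun hxy j)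
  exists_of_proj := fun f x hf => by
    choose e he using fun j => (h j).exists_of_proj (f j) (x j) (congrFun hf j)
    exact ⟨e, funext he⟩
  lift := fun φ Φ hΦ => isBundleMap_pi fun j =>
    (h j).lift _ _ ((isBundleMap_comp (isBundleMap_proj F j) hΦ).congr (fun _ => rfl) fun _ => rfl)

theorem IsInitial.inc {J : Type} [Finite J] {X : J → QPVariety} {E : ∀ j, VBundle (X j)} (k : J) :
    IsInitial (E k) (VBundle.sigma E) (QPVariety.inc k) (fun e => ⟨k, e⟩) where
  isBundleMap := isBundleMap_inc k
  injective := fun x y h => eq_of_heq (Sigma.mk.inj h).2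
  injective_tot := fun x y h => eq_of_heq (Sigma.mk.inj h).2
  exists_of_proj := by
    rintro ⟨j, e⟩ x hx
    obtain rfl : j = k := congrArg Sigma.fst hx
    exact ⟨e, rfl⟩
  lift := fun {W K} φ Φ h => by
    have hreg : W.IsRegularMap (X k) φ := by
      refine QPVariety.IsRegularMap.of_local fun w => ?_
      -- The retraction onto the piece needs a value on the other pieces; the point `φ w` serves,
      -- and regularity is only to be checked near a given `w`.
      refine ⟨_, (QPVariety.isRegularMap_retract k (φ w)).comp h.1,
        Filter.Eventually.of_forall fun y => ?_⟩
      exact (QPVariety.retract_mk k (φ w) (φ y)).symm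
    refine ⟨hreg, fun e => ?_, fun τ hτ σ hσ x hx hx' => ?_⟩
    · exact eq_of_heq (Sigma.mk.inj (h.2.1 e)).2
    · obtain ⟨L, hL, he⟩ := h.2.2 τ hτ (chartSigma k σ) ⟨k, σ, hσ, rfl⟩ x hx ⟨_, hx', rfl⟩
      refine ⟨L, hL, ?_⟩
      filter_upwards [he] with y hy e hey
      exact (chartSigma_coord k σ (Φ e)).symm.trans (hy e hey)

theorem nhds_sub {S : Set X.pts} {hS : IsLocallyClosed S} (x : (X.sub S hS).pts) :
    nhds x = Filter.comap Subtype.val (nhds x.1) := by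
  rw [nhds_induced, nhds_induced, Filter.comap_comap]
  rfl

theorem eventually_of_sub {S : Set X.pts} (hS : IsOpen S) {P : X.pts → Prop}
    {x : (X.sub S hS.isLocallyClosed).pts} (h : ∀ᶠ y in nhds x, P y.1) :
    ∀ᶠ y in nhds x.1, P y := by
  rw [nhds_sub] at h
  replace h := Filter.eventually_comap.mp h
  filter_upwards [h, hS.mem_nhds x.2] with y hy hyS
  exact hy ⟨y, hyS⟩ rfl

/-- The subvariety has the same homogeneous coordinates, so the same fraction represents the
function; openness makes a neighbourhood in `S` one in `X`. -/
theorem regularAt_of_sub {S : Set X.pts} (hS : IsOpen S) {f : X.pts → ℂ}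
    {x : (X.sub S hS.isLocallyClosed).pts}
    (h : (X.sub S hS.isLocallyClosed).RegularAt (fun y => f y.1) x) : X.RegularAt f x.1 := by
  obtain ⟨d, p, q, hp, hq, h0, he⟩ := h
  refine ⟨d, p, q, hp, hq, h0, eventually_of_sub hS ?_⟩
  exact he

/-- Being a morphism of bundles is local on the base. This is used for inverse maps that have an
explicit formula only on small open sets. -/
theorem isBundleMap_of_restrict {ψ : X.pts → Y.pts} {Ψ : E.tot → F.tot}
    (h : ∀ x, ∃ (S : Set X.pts) (hS : IsOpen S), x ∈ S ∧
      IsBundleMap (E.restrict S hS.isLocallyClosed) F (fun y => ψ y.1) (fun e => Ψ e.1)) :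
    IsBundleMap E F ψ Ψ := by
  classical
  refine ⟨⟨continuous_iff_continuousAt.mpr fun x => ?_, fun x f hf => ?_⟩, fun e => ?_,
    fun τ hτ σ hσ x hx hx' => ?_⟩
  · obtain ⟨S, hS, hxS, hm⟩ := h x
    intro U hU
    exact eventually_of_sub hS (x := ⟨x, hxS⟩) (P := fun y => ψ y ∈ U)
      (hm.1.1.continuousAt.eventually (p := fun y => y ∈ U) hU)
  · obtain ⟨S, hS, hxS, hm⟩ := h x
    exact regularAt_of_sub hS (x := ⟨x, hxS⟩) (hm.1.2 ⟨x, hxS⟩ f hf)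
  · obtain ⟨S, hS, hxS, hm⟩ := h (E.proj e)
    exact hm.2.1 ⟨e, hxS⟩
  · obtain ⟨S, hS, hxS, hm⟩ := h x
    obtain ⟨L, hL, he⟩ := hm.2.2 (chartRestrict S hS.isLocallyClosed τ) ⟨τ, hτ, rfl⟩ σ hσ
      ⟨x, hxS⟩ hx hx'
    -- Extended by zero off `S`; only the germ of the matrix at `x` matters.
    let L' : X.pts → ((τ.rank → ℂ) →ₗ[ℂ] (σ.rank → ℂ)) := fun y =>
      if hy : y ∈ S then L ⟨y, hy⟩ else 0
    have hL' : ∀ y : S, L' y.1 = L y := fun y => dif_pos y.2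
    refine ⟨L', fun v i => regularAt_of_sub hS (x := ⟨x, hxS⟩) ((hL v i).congr
      (Filter.Eventually.of_forall fun y => ?_)), ?_⟩
    · exact congrArg (fun l => l v i) (hL' y)
    · refine eventually_of_sub hS (x := ⟨x, hxS⟩)
        (P := fun y => ∀ e, E.proj e = y → σ.coord (Ψ e) = L' y (τ.coord e)) ?_
      filter_upwards [he] with y hy e hey
      refine (hy ⟨e, by rw [hey]; exact y.2⟩ (Subtype.ext hey)).trans ?_
      exact congrArg (fun l => l (τ.coord e)) (hL' y).symm

/-! Binary products. -/

/-- The product of two vector bundles over the product of their bases. -/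
abbrev prod (E : VBundle X) (F : VBundle Y) := (VBundle.pi (GBundle.pairBundle E F)).transport
  (GBundle.pairVarEquiv X Y) (GBundle.pairBundleEquiv E F)

theorem isBundleMap_fst (E : VBundle X) (F : VBundle Y) :
    IsBundleMap (E.prod F) E Prod.fst Prod.fst := by
  have h := isBundleMap_comp (isBundleMap_proj (GBundle.pairBundle E F) true)
    (isBundleMap_transport (GBundle.pairVarEquiv X Y) (GBundle.pairBundleEquiv E F))
  exact h

theorem isBundleMap_snd (E : VBundle X) (F : VBundle Y) :
    IsBundleMap (E.prod F) F Prod.snd Prod.snd := by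
  have h := isBundleMap_comp (isBundleMap_proj (GBundle.pairBundle E F) false)
    (isBundleMap_transport (GBundle.pairVarEquiv X Y) (GBundle.pairBundleEquiv E F))
  exact h

theorem isBundleMap_prodMk {ψ : W.pts → X.pts × Y.pts} {Ψ : K.tot → E.tot × F.tot}
    (h : IsBundleMap K E (fun x => (ψ x).1) (fun e => (Ψ e).1))
    (h' : IsBundleMap K F (fun x => (ψ x).2) (fun e => (Ψ e).2)) :
    IsBundleMap K (E.prod F) ψ Ψ := by
  refine (IsInitial.transport (E := VBundle.pi (GBundle.pairBundle E F))
    (GBundle.pairVarEquiv X Y) (GBundle.pairBundleEquiv E F)).lift _ _ (isBundleMap_pi fun b => ?_)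
  cases b with
  | true => exact h
  | false => exact h'

theorem IsInitial.prodMap {X' Y' : QPVariety} {E' : VBundle X'} {F' : VBundle Y'}
    {ψ : X.pts → X'.pts} {Ψ : E.tot → E'.tot} {φ : Y.pts → Y'.pts} {Φ : F.tot → F'.tot}
    (h : IsInitial E E' ψ Ψ) (h' : IsInitial F F' φ Φ) :
    IsInitial (E.prod F) (E'.prod F') (Prod.map ψ φ) (Prod.map Ψ Φ) where
  isBundleMap := GBundle.isBundleMap_pair h.isBundleMap h'.isBundleMap
  injective := h.injective.prodMap h'.injective
  injective_tot := h.injective_tot.prodMap h'.injective_tot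
  exists_of_proj := by
    rintro ⟨f, g⟩ ⟨x, y⟩ hx
    obtain ⟨e, he⟩ := h.exists_of_proj f x (congrArg Prod.fst hx)
    obtain ⟨e', he'⟩ := h'.exists_of_proj g y (congrArg Prod.snd hx)
    exact ⟨(e, e'), Prod.ext he he'⟩
  lift := fun α A hA => by
    have h1 := isBundleMap_comp (isBundleMap_fst E' F') hA
    have h2 := isBundleMap_comp (isBundleMap_snd E' F') hA
    exact isBundleMap_prodMk (h.lift _ _ h1) (h'.lift _ _ h2)

/-! Bundles of rank zero. -/

/-- The charts of the target have no coordinates, so linearity is void and only the map of bases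
counts. -/
theorem isBundleMap_zeroBundle {ψ : X.pts → Y.pts} (h : X.IsRegularMap Y ψ) :
    IsBundleMap E (GBundle.zeroBundle Y) ψ (fun e => ψ (E.proj e)) :=
  ⟨h, fun _ => rfl, fun _ _ _ hτ' _ _ _ => ⟨fun _ => 0, fun _ i => (hτ'.false i).elim,
    Filter.Eventually.of_forall fun _ _ _ => funext fun i => (hτ'.false i).elim⟩⟩

end VBundle

/-! Recognition of induced triples. -/

namespace GBundle

namespace Ind

variable {G H : Type} [Group G] [Group H] {T T' : Type} [MulAction G T] [MulAction H T']

theorem mk_eq_mk_iff {φ : G →* H} {h h' : H} {x x' : T} :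
    Ind.mk φ h x = Ind.mk φ h' x' ↔ ∃ g : G, h' = h * (φ g)⁻¹ ∧ x' = g • x :=
  Quotient.eq (r := GBundle.indSetoid φ T)

theorem exists_mk {φ : G →* H} (y : Ind φ T) : ∃ h x, Ind.mk φ h x = y := by
  obtain ⟨h, x⟩ := y
  exact ⟨h, x, rfl⟩

/-- The map of `H`-sets `[(h, x)] ↦ h • f x` given by an equivariant map `f`. -/
def lift (φ : G →* H) (f : T → T') (hf : ∀ (g : G) (x : T), f (g • x) = φ g • f x) :
    Ind φ T → T' :=
  Quotient.lift (fun a => a.1 • f a.2) (by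
    rintro ⟨h, x⟩ ⟨h', x'⟩ ⟨g, h1, h2⟩
    obtain rfl : h' = h * (φ g)⁻¹ := h1
    obtain rfl : x' = g • x := h2
    change h • f x = (h * (φ g)⁻¹) • f (g • x)
    rw [hf, mul_smul, inv_smul_smul])

theorem lift_mk {φ : G →* H} {f : T → T'} (hf : ∀ (g : G) (x : T), f (g • x) = φ g • f x)
    (h : H) (x : T) : lift φ f hf (Ind.mk φ h x) = h • f x := rfl

theorem lift_smul {φ : G →* H} {f : T → T'} (hf : ∀ (g : G) (x : T), f (g • x) = φ g • f x)
    (h : H) (y : Ind φ T) : lift φ f hf (h • y) = h • lift φ f hf y := by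
  obtain ⟨h', x, rfl⟩ := exists_mk y
  rw [Ind.smul_mk, lift_mk, lift_mk, mul_smul]

/-- If two classes have the same image, then `h'⁻¹ * h` carries a point of the image of `f` into
that image. By `hr` it comes from `G`, and injectivity of `f` then identifies the representatives.
-/
theorem lift_injective {φ : G →* H} {f : T → T'}
    (hf : ∀ (g : G) (x : T), f (g • x) = φ g • f x) (hi : Function.Injective f)
    (hr : ∀ (h : H) (x x' : T), h • f x = f x' → h ∈ φ.range) :
    Function.Injective (lift φ f hf) := by
  intro y y' hy
  obtain ⟨h, x, rfl⟩ := exists_mk y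
  obtain ⟨h', x', rfl⟩ := exists_mk y'
  rw [lift_mk, lift_mk] at hy
  have h1 : (h'⁻¹ * h) • f x = f x' := by rw [mul_smul, hy, inv_smul_smul]
  obtain ⟨g, hg⟩ := hr _ _ _ h1
  refine mk_eq_mk_iff.mpr ⟨g, by rw [hg]; group, hi ?_⟩
  rw [hf, hg, h1]

end Ind

variable {G K H : Type} [Group G] [Group K] [Group H]

open VBundle

theorem isInitial_smul (X : GBundle G) (g : G) :
    IsInitial X.bundle X.bundle (fun x => g • x) (fun e => g • e) :=
  .of_inverse (X.isBundleMap_smul g) (X.isBundleMap_smul g⁻¹) (fun x => inv_smul_smul g x)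
    (fun e => inv_smul_smul g e) (fun e => smul_inv_smul g e)

/-- In the coordinates of `indEquiv`, the class of `(h, x)` is the point `indElt φ h • x` of the
copy belonging to the coset of `h`. The map is thus an automorphism of `X` followed by the inclusion
of a piece of a disjoint union. -/
theorem isInitial_indMk [Finite H] (X : GBundle G) (φ : G →* H) (hφ : Function.Injective φ)
    (h : H) : IsInitial X.bundle (X.induce φ hφ).bundle (Ind.mk φ h) (Ind.mk φ h) := by
  have h1 : IsInitial X.bundle (X.induce φ hφ).bundle
      (fun x => (indEquiv φ hφ X.base.pts).symm ⟨h, indElt φ h • x⟩)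
      (fun e => (indEquiv φ hφ X.bundle.tot).symm ⟨h, indElt φ h • e⟩) :=
    (IsInitial.transport_symm (E := VBundle.sigma fun _ : H ⧸ φ.range => X.bundle)
      (indEquiv φ hφ X.base.pts) (indEquiv φ hφ X.bundle.tot)).comp
      ((IsInitial.inc (E := fun _ : H ⧸ φ.range => X.bundle) (h : H ⧸ φ.range)).comp
        (X.isInitial_smul (indElt φ h)))
  have h2 : (Ind.mk φ h : X.base.pts → _) =
      fun x => (indEquiv φ hφ X.base.pts).symm ⟨h, indElt φ h • x⟩ := funext fun x =>
    ((indEquiv φ hφ X.base.pts).symm_apply_apply (Ind.mk φ h x)).symm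
  have h3 : (Ind.mk φ h : X.bundle.tot → _) =
      fun x => (indEquiv φ hφ X.bundle.tot).symm ⟨h, indElt φ h • x⟩ := funext fun x =>
    ((indEquiv φ hφ X.bundle.tot).symm_apply_apply (Ind.mk φ h x)).symm
  rw [h2, h3]
  exact h1

/-- The induced bundle is a disjoint union of copies of the given one, so maps out of it are tested
on the copies, here through the chosen coset representatives. -/
theorem isBundleMap_induce [Finite H] {X : GBundle G} {φ : G →* H} {hφ : Function.Injective φ}
    {W : QPVariety} {F : VBundle W} {ψ : (X.induce φ hφ).base.pts → W.pts}
    {Ψ : (X.induce φ hφ).bundle.tot → F.tot}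
    (h : ∀ h : H, IsBundleMap X.bundle F (fun x => ψ (Ind.mk φ h x)) (fun e => Ψ (Ind.mk φ h e))) :
    IsBundleMap (X.induce φ hφ).bundle F ψ Ψ := by
  have h1 : IsBundleMap (VBundle.sigma fun _ : H ⧸ φ.range => X.bundle) F
      (fun a => ψ ((indEquiv φ hφ X.base.pts).symm a))
      (fun a => Ψ ((indEquiv φ hφ X.bundle.tot).symm a)) :=
    VBundle.isBundleMap_sigma fun c => h c.out
  refine (isBundleMap_comp h1 (isBundleMap_transport (indEquiv φ hφ X.base.pts)
    (indEquiv φ hφ X.bundle.tot))).congr ?_ ?_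
  · exact fun x => congrArg ψ ((indEquiv φ hφ X.base.pts).symm_apply_apply x).symm
  · exact fun x => congrArg Ψ ((indEquiv φ hφ X.bundle.tot).symm_apply_apply x).symm

/-- The image is exactly the copy of the base belonging to the coset of `h`, a piece of a finite
disjoint union. -/
theorem isOpen_range_indMk [Finite H] (X : GBundle G) (φ : G →* H) (hφ : Function.Injective φ)
    (h : H) : IsOpen (X := (X.induce φ hφ).base.pts) (Set.range (Ind.mk φ h)) := by
  have h1 : IsOpen {y : (QPVariety.sigma fun _ : H ⧸ φ.range => X.base).pts |
      y.1 = (h : H ⧸ φ.range)} := by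
    refine QPVariety.isOpen_sigma fun j => ?_
    exact isOpen_const (p := j = (h : H ⧸ φ.range))
  have h2 := h1.preimage (QPVariety.isRegularMap_transport (indEquiv φ hφ X.base.pts)).1
  refine (congrArg IsOpen (Set.ext fun y => ?_)).mpr h2
  obtain ⟨h', x, rfl⟩ := Ind.exists_mk y
  change (∃ x', Ind.mk φ h x' = Ind.mk φ h' x) ↔ ((h' : H ⧸ φ.range) = h)
  constructor
  · rintro ⟨x', hx⟩
    obtain ⟨g, rfl, -⟩ := Ind.mk_eq_mk_iff.mp hx
    rw [QuotientGroup.eq]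
    simp
  · intro he
    obtain ⟨g, hg⟩ := QuotientGroup.eq.mp he
    exact ⟨g⁻¹ • x, Ind.mk_eq_mk_iff.mpr ⟨g, by rw [hg]; simp, by simp⟩⟩

/-- The map `(f, F)`, equivariant relative to `φ`, identifies `Y` with the triple induced from `X`
along `φ`. -/
structure IsInd {X : GBundle G} {Y : GBundle H} (φ : G →* H) (f : X.base.pts → Y.base.pts)
    (F : X.bundle.tot → Y.bundle.tot) : Prop where
  injective_hom : Function.Injective φ
  initial : IsInitial X.bundle Y.bundle f F
  map_smul : ∀ (g : G) (x : X.base.pts), f (g • x) = φ g • f x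
  map_smul_tot : ∀ (g : G) (e : X.bundle.tot), F (g • e) = φ g • F e
  isOpen_range : IsOpen (Set.range f)
  exists_smul : ∀ y : Y.base.pts, ∃ (h : H) (x : X.base.pts), h • f x = y
  mem_range : ∀ (h : H) (x x' : X.base.pts), h • f x = f x' → h ∈ φ.range

theorem isInd_indMk [Finite H] (X : GBundle G) (φ : G →* H) (hφ : Function.Injective φ) :
    IsInd (X := X) (Y := X.induce φ hφ) φ (Ind.mk φ 1) (Ind.mk φ 1) where
  injective_hom := hφ
  initial := X.isInitial_indMk φ hφ 1
  map_smul := fun g x => Ind.mk_eq_mk_iff.mpr ⟨g⁻¹, by simp, by simp⟩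
  map_smul_tot := fun g x => Ind.mk_eq_mk_iff.mpr ⟨g⁻¹, by simp, by simp⟩
  isOpen_range := X.isOpen_range_indMk φ hφ 1
  exists_smul := fun y => by
    obtain ⟨h, x, rfl⟩ := Ind.exists_mk y
    exact ⟨h, x, congrArg (fun a => Ind.mk φ a x) (mul_one h)⟩
  mem_range := fun h x x' hx => by
    obtain ⟨g, hg, -⟩ := Ind.mk_eq_mk_iff.mp hx
    exact ⟨g, by simpa [eq_mul_inv_iff_mul_eq] using hg⟩

end GBundle

theorem Triple.Iso.of_initial {G H : Type} [Group G] [Finite G] [Group H] [Finite H]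
    {X : GBundle G} {Y : GBundle H} (φ : G ≃* H) {f : X.base.pts → Y.base.pts}
    {F : X.bundle.tot → Y.bundle.tot} (hi : VBundle.IsInitial X.bundle Y.bundle f F)
    (hs : Function.Surjective f) (h : ∀ (g : G) (x : X.base.pts), f (g • x) = φ g • f x)
    (h' : ∀ (g : G) (e : X.bundle.tot), F (g • e) = φ g • F e) :
    (Triple.of X).Iso (Triple.of Y) := by
  let e := Equiv.ofBijective f ⟨hi.injective, hs⟩
  let e' := Equiv.ofBijective F ⟨hi.injective_tot, hi.surjective_tot hs⟩
  have hi' : VBundle.IsInitial X.bundle Y.bundle e e' := hi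
  exact ⟨φ, e, e', hi'.isBundleMap, hi'.isBundleMap_symm, h, h'⟩

namespace GBundle

open VBundle

variable {G K H : Type} [Group G] [Group K] [Group H]

/-- Every point lies in some open translate `a • range f`. There the inverse sends `y` to the class
of `(a, x)` with `f x = a⁻¹ • y`, and `x` depends regularly on `y` because `f` is an embedding. The
same formula describes the total spaces. -/
theorem IsInd.isBundleMap_lift_symm [Finite H] {X : GBundle G} {Y : GBundle H} {φ : G →* H}
    {f : X.base.pts → Y.base.pts} {F : X.bundle.tot → Y.bundle.tot} (h : IsInd φ f F)
    (e : (X.induce φ h.injective_hom).base.pts ≃ Y.base.pts)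
    (e' : (X.induce φ h.injective_hom).bundle.tot ≃ Y.bundle.tot)
    (he : ∀ a x, e (Ind.mk φ a x) = a • f x) (he' : ∀ a x, e' (Ind.mk φ a x) = a • F x) :
    IsBundleMap Y.bundle (X.induce φ h.injective_hom).bundle e.symm e'.symm := by
  refine isBundleMap_of_restrict fun y => ?_
  obtain ⟨a, x, rfl⟩ := h.exists_smul y
  have hS : IsOpen {y : Y.base.pts | a⁻¹ • y ∈ Set.range f} :=
    h.isOpen_range.preimage (Y.isBundleMap_smul a⁻¹).1.1
  refine ⟨_, hS, ⟨x, by simp⟩, ?_⟩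
  let E := Y.bundle.restrict _ hS.isLocallyClosed
  choose p hp using fun y : {y : Y.base.pts | a⁻¹ • y ∈ Set.range f} => y.2
  choose q hq using fun v : E.tot => h.initial.exists_of_proj (a⁻¹ • v.1) (p ⟨_, v.2⟩)
    ((Y.proj_smul _ _).trans (hp ⟨_, v.2⟩).symm)
  have hpq : IsBundleMap E X.bundle p q := by
    refine h.initial.lift _ _ ?_
    exact (isBundleMap_comp (Y.isBundleMap_smul a⁻¹) (isBundleMap_val Y.bundle _ _)).congr hp hq
  refine (isBundleMap_comp (X.isInitial_indMk φ h.injective_hom a).isBundleMap hpq).congr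
    (fun y => ?_) (fun v => ?_)
  · refine e.symm_apply_eq.mpr ?_
    exact ((he _ _).trans ((congrArg (a • ·) (hp y)).trans (smul_inv_smul a y.1))).symm
  · refine e'.symm_apply_eq.mpr ?_
    exact ((he' _ _).trans ((congrArg (a • ·) (hq v)).trans (smul_inv_smul a v.1))).symm

/-- The isomorphism sends the class of `(a, x)` to `a • f x`. It links the criterion `IsInd`, which
can be verified directly on spaces of tuples, with the construction `induce` that occurs in the
relations of K. -/
theorem IsInd.iso_induce [Finite G] [Finite H] {X : GBundle G} {Y : GBundle H} {φ : G →* H}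
    {f : X.base.pts → Y.base.pts} {F : X.bundle.tot → Y.bundle.tot} (h : IsInd φ f F) :
    (Triple.of (X.induce φ h.injective_hom)).Iso (Triple.of Y) := by
  let l : (X.induce φ h.injective_hom).base.pts → Y.base.pts := Ind.lift φ f h.map_smul
  let l' : (X.induce φ h.injective_hom).bundle.tot → Y.bundle.tot := Ind.lift φ F h.map_smul_tot
  have hl : Function.Bijective l := by
    refine ⟨Ind.lift_injective _ h.initial.injective h.mem_range, fun y => ?_⟩
    obtain ⟨a, x, rfl⟩ := h.exists_smul y
    exact ⟨Ind.mk φ a x, rfl⟩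
  have hl' : Function.Bijective l' := by
    refine ⟨Ind.lift_injective _ h.initial.injective_tot fun a e e' he => ?_, fun v => ?_⟩
    -- The criterion controls the group only through points of the base, so the equation between
    -- vectors is projected.
    · refine h.mem_range a (X.bundle.proj e) (X.bundle.proj e') ?_
      rw [← h.initial.isBundleMap.2.1, ← h.initial.isBundleMap.2.1, ← proj_smul, he]
    · obtain ⟨a, x, hx⟩ := h.exists_smul (Y.bundle.proj v)
      obtain ⟨e, he⟩ := h.initial.exists_of_proj (a⁻¹ • v) x (by
        rw [proj_smul, ← hx, inv_smul_smul])
      exact ⟨Ind.mk φ a e, by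
        change a • F e = v
        rw [he, smul_inv_smul]⟩
  let e := Equiv.ofBijective l hl
  let e' := Equiv.ofBijective l' hl'
  have hm : IsBundleMap (X.induce φ h.injective_hom).bundle Y.bundle e e' :=
    isBundleMap_induce fun a => isBundleMap_comp (Y.isBundleMap_smul a) h.initial.isBundleMap
  exact ⟨MulEquiv.refl H, e, e', hm,
    h.isBundleMap_lift_symm e e' (fun _ _ => rfl) (fun _ _ => rfl),
    Ind.lift_smul h.map_smul, Ind.lift_smul h.map_smul_tot⟩

/-- Isomorphisms are the special case of induction along a group isomorphism, so invariance under
`IsInd` covers both. -/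
theorem IsInd.of_initial {X : GBundle G} {Y : GBundle H} (φ : G ≃* H)
    {f : X.base.pts → Y.base.pts} {F : X.bundle.tot → Y.bundle.tot}
    (hi : IsInitial X.bundle Y.bundle f F) (hs : Function.Surjective f)
    (h : ∀ (g : G) (x : X.base.pts), f (g • x) = φ g • f x)
    (h' : ∀ (g : G) (e : X.bundle.tot), F (g • e) = φ g • F e) : IsInd (φ : G →* H) f F where
  injective_hom := φ.injective
  initial := hi
  map_smul := h
  map_smul_tot := h'
  isOpen_range := by
    rw [hs.range_eq]
    exact isOpen_univ
  exists_smul := fun y => by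
    obtain ⟨x, rfl⟩ := hs y
    exact ⟨1, x, one_smul _ _⟩
  mem_range := fun a _ _ _ => ⟨φ.symm a, φ.apply_symm_apply a⟩

theorem IsInd.prod {X : GBundle G} {Y : GBundle H} {φ : G →* H} {f : X.base.pts → Y.base.pts}
    {F : X.bundle.tot → Y.bundle.tot} (h : IsInd φ f F) (Z : GBundle K) :
    IsInd (X := X.prod Z) (Y := Y.prod Z) (φ.prodMap (MonoidHom.id K)) (Prod.map f id)
      (Prod.map F id) where
  injective_hom := h.injective_hom.prodMap Function.injective_id
  initial := h.initial.prodMap .id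
  map_smul := fun g x => Prod.ext (h.map_smul g.1 x.1) rfl
  map_smul_tot := fun g x => Prod.ext (h.map_smul_tot g.1 x.1) rfl
  isOpen_range := by
    have := h.isOpen_range.preimage (isBundleMap_fst Y.bundle Z.bundle).1.1
    refine (congrArg IsOpen (Set.ext ?_)).mpr this
    rintro ⟨y, z⟩
    constructor
    · rintro ⟨⟨x, z⟩, hx⟩
      exact ⟨x, congrArg Prod.fst hx⟩
    · rintro ⟨x, hx⟩
      exact ⟨(x, z), Prod.ext hx rfl⟩
  exists_smul := by
    rintro ⟨y, z⟩
    obtain ⟨a, x, hx⟩ := h.exists_smul y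
    exact ⟨(a, 1), (x, z), Prod.ext hx (one_smul _ _)⟩
  mem_range := by
    rintro ⟨a, k⟩ ⟨x, z⟩ ⟨x', z'⟩ hx
    obtain ⟨g, hg⟩ := h.mem_range a x x' (congrArg Prod.fst hx)
    exact ⟨(g, k), Prod.ext hg rfl⟩

end GBundle

/-! Additive invariants of triples. -/

open VBundle

/-! ### Isomorphisms of triples and their restrictions -/

section iso

variable {G H : Type} [Group G] [Finite G] [Group H] [Finite H]

/-- An embedding is an isomorphism onto the restriction to its image. Most identifications of pieces
below have this form. -/
theorem Triple.Iso.restrict_range {X : GBundle G} {Y : GBundle H} (φ : G ≃* H)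
    {f : X.base.pts → Y.base.pts} {F : X.bundle.tot → Y.bundle.tot}
    (hi : IsInitial X.bundle Y.bundle f F) (h : ∀ (g : G) (x : X.base.pts), f (g • x) = φ g • f x)
    (h' : ∀ (g : G) (e : X.bundle.tot), F (g • e) = φ g • F e) {S : Set Y.base.pts}
    (hS : IsLocallyClosed S) (hG : ∀ (g : H), ∀ x ∈ S, g • x ∈ S)
    (hr : ∀ y, y ∈ S ↔ ∃ x, f x = y) :
    (Triple.of X).Iso (Triple.of (Y.restrict S hS hG)) := by
  have hp : ∀ x, f x ∈ S := fun x => (hr _).mpr ⟨x, rfl⟩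
  refine Triple.Iso.of_initial (Y := Y.restrict S hS hG) φ
    (f := fun x => ⟨f x, hp x⟩)
    (F := fun e => ⟨F e, by rw [hi.isBundleMap.2.1]; exact hp _⟩)
    ((IsInitial.val Y.bundle S hS).of_comp hi) ?_ (fun g x => Subtype.ext (h g x))
    (fun g x => Subtype.ext (h' g x))
  rintro ⟨y, hy⟩
  obtain ⟨x, rfl⟩ := (hr y).mp hy
  exact ⟨x, rfl⟩

theorem Triple.Iso.exists_initial {X : GBundle G} {Y : GBundle H}
    (h : (Triple.of X).Iso (Triple.of Y)) :
    ∃ (φ : G ≃* H) (f : X.base.pts → Y.base.pts) (F : X.bundle.tot → Y.bundle.tot),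
      IsInitial X.bundle Y.bundle f F ∧ Function.Surjective f ∧
      (∀ (g : G) (x : X.base.pts), f (g • x) = φ g • f x) ∧
      ∀ (g : G) (e : X.bundle.tot), F (g • e) = φ g • F e := by
  obtain ⟨φ, ψ, Ψ, h1, h2, h3, h4⟩ := h
  exact ⟨φ, ψ, Ψ, .of_inverse h1 h2 ψ.symm_apply_apply Ψ.symm_apply_apply Ψ.apply_symm_apply,
    ψ.surjective, h3, h4⟩

theorem Triple.Iso.restrict_restrict (X : GBundle G) {W S : Set X.base.pts}
    (hW : IsLocallyClosed W) (hWG : ∀ (g : G), ∀ x ∈ W, g • x ∈ W)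
    {T : Set (X.restrict W hW hWG).base.pts}
    (hT : IsLocallyClosed T) (hTG : ∀ (g : G), ∀ x ∈ T, g • x ∈ T)
    (hS : IsLocallyClosed S) (hSG : ∀ (g : G), ∀ x ∈ S, g • x ∈ S)
    (h : ∀ x, x ∈ S ↔ ∃ hx : x ∈ W, (⟨x, hx⟩ : W) ∈ T) :
    (Triple.of ((X.restrict W hW hWG).restrict T hT hTG)).Iso
      (Triple.of (X.restrict S hS hSG)) :=
  Triple.Iso.restrict_range (X := (X.restrict W hW hWG).restrict T hT hTG) (MulEquiv.refl G)
    ((IsInitial.val X.bundle W hW).comp (IsInitial.val _ T hT)) (fun _ _ => rfl) (fun _ _ => rfl)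
    hS hSG fun x => (h x).trans
      ⟨fun ⟨hx, hx'⟩ => ⟨⟨⟨x, hx⟩, hx'⟩, rfl⟩, fun ⟨y, hy⟩ => hy ▸ ⟨y.1.2, y.2⟩⟩

theorem Triple.Iso.restrict_univ (X : GBundle G) {S : Set X.base.pts}
    (hS : IsLocallyClosed S) (hSG : ∀ (g : G), ∀ x ∈ S, g • x ∈ S) (h : ∀ x, x ∈ S) :
    (Triple.of X).Iso (Triple.of (X.restrict S hS hSG)) :=
  Triple.Iso.restrict_range (MulEquiv.refl G) .id (fun _ _ => rfl) (fun _ _ => rfl) hS hSG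
    fun x => ⟨fun _ => ⟨x, rfl⟩, fun _ => h x⟩

theorem Triple.Iso.univ_univ {X : GBundle G} {Y : GBundle H} (h : (Triple.of X).Iso (Triple.of Y))
    {S : Set X.base.pts} (hS : IsLocallyClosed S) (hSG : ∀ (g : G), ∀ x ∈ S, g • x ∈ S)
    {T : Set Y.base.pts} (hT : IsLocallyClosed T) (hTG : ∀ (g : H), ∀ x ∈ T, g • x ∈ T)
    (hSu : ∀ x, x ∈ S) (hTu : ∀ x, x ∈ T) :
    (Triple.of (X.restrict S hS hSG)).Iso (Triple.of (Y.restrict T hT hTG)) := by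
  obtain ⟨φ, f, F, hi, hs, h1, h2⟩ := h.exists_initial
  refine Triple.Iso.restrict_range (X := X.restrict S hS hSG) φ
    (hi.comp (IsInitial.val X.bundle S hS)) (fun g x => h1 g x.1) (fun g x => h2 g x.1) hT hTG
    fun y => ⟨fun _ => ?_, fun _ => hTu y⟩
  obtain ⟨x, rfl⟩ := hs y
  exact ⟨⟨x, hSu x⟩, rfl⟩

theorem Triple.Iso.refl (X : Triple) : X.Iso X :=
  ⟨MulEquiv.refl _, Equiv.refl _, Equiv.refl _, isBundleMap_id, isBundleMap_id,
    fun _ _ => rfl, fun _ _ => rfl⟩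

end iso

/-! ### Classes of finite disjoint unions of triples -/

namespace MultiTriple

/-- The partition into the components that are not empty. -/
def components (X : MultiTriple) : X.Partition where
  P := fun i => {_u : Unit // Nonempty (X.comp i).obj.base.pts}
  part := fun _ _ => Set.univ
  isLocallyClosed := fun _ _ => isOpen_univ.isLocallyClosed
  smul_mem := fun _ _ _ _ _ => trivial
  existsUnique := fun _ x => ⟨⟨(), ⟨x⟩⟩, trivial, fun _ _ => rfl⟩

/-- The pieces of the partition into the non-empty components. -/
def componentsEquiv (X : MultiTriple) :
    (Σ i, X.components.P i) ≃ {i : X.I // Nonempty (X.comp i).obj.base.pts} where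
  toFun := fun k => ⟨k.1, k.2.2⟩
  invFun := fun i => ⟨i.1, (), i.2⟩
  left_inv := fun _ => rfl
  right_inv := fun _ => rfl

/-- A partition of an empty component may have no pieces, so empty components are invisible to
equivalence and only the others have to be matched. -/
theorem equivalent_of_iso {X Y : MultiTriple}
    (e : {i : X.I // Nonempty (X.comp i).obj.base.pts} ≃
      {i : Y.I // Nonempty (Y.comp i).obj.base.pts})
    (h : ∀ i, (X.comp i.1).Iso (Y.comp (e i).1)) : X.Equivalent Y :=
  ⟨X.components, Y.components, X.componentsEquiv.trans (e.trans Y.componentsEquiv.symm),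
    fun k => Triple.Iso.univ_univ (h (X.componentsEquiv k)) _ _ _ _
      (fun _ => trivial) (fun _ => trivial)⟩

theorem equivalent_of_injective {X Y : MultiTriple} (j : X.I → Y.I) (hj : Function.Injective j)
    (h : ∀ i, (X.comp i).Iso (Y.comp (j i)))
    (h' : ∀ k, Nonempty (Y.comp k).obj.base.pts → ∃ i, j i = k) : X.Equivalent Y := by
  let e : {i : X.I // Nonempty (X.comp i).obj.base.pts} →
      {i : Y.I // Nonempty (Y.comp i).obj.base.pts} := fun i =>
    ⟨j i.1, i.2.map (h i.1).choose_spec.choose⟩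
  have he : Function.Bijective e := by
    refine ⟨fun i i' hi => Subtype.ext (hj (congrArg Subtype.val hi)), ?_⟩
    rintro ⟨k, hk⟩
    obtain ⟨i, rfl⟩ := h' k hk
    exact ⟨⟨i, hk.map (h i).choose_spec.choose.symm⟩, rfl⟩
  exact equivalent_of_iso (Equiv.ofBijective e he) fun i => h i.1

theorem cls_eq_of_equivalent {X Y : MultiTriple} (h : X.Equivalent Y) : X.cls = Y.cls := by
  have := (QuotientAddGroup.eq_zero_iff (N := AddSubgroup.closure {x | K0Rel x}) _).mpr
    (AddSubgroup.subset_closure (K0Rel.equivalent X Y h))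
  exact sub_eq_zero.mp this

theorem cls_closed (X : MultiTriple) (S : ∀ i, Set (X.comp i).obj.base.pts)
    (hS : ∀ i, IsClosed (S i)) (hG : ∀ i (g : (X.comp i).G), ∀ x ∈ S i, g • x ∈ S i) :
    X.cls = (X.restrict S (fun i => (hS i).isLocallyClosed) hG).cls +
      (X.restrict (fun i => (S i)ᶜ) (fun i => (hS i).isOpen_compl.isLocallyClosed)
        (fun i => (X.comp i).obj.smul_mem_compl (hG i))).cls := by
  have := (QuotientAddGroup.eq_zero_iff (N := AddSubgroup.closure {x | K0Rel x}) _).mpr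
    (AddSubgroup.subset_closure (K0Rel.closed X S hS hG))
  exact sub_eq_zero.mp this

/-- Cutting a union without components gives two unions without components, so the class is twice
itself. -/
theorem cls_of_isEmpty (X : MultiTriple) [IsEmpty X.I] : X.cls = 0 := by
  have h := X.cls_closed isEmptyElim isEmptyElim isEmptyElim
  have h1 : ∀ Y : MultiTriple, IsEmpty Y.I → Y.cls = X.cls := fun Y hY =>
    cls_eq_of_equivalent (equivalent_of_injective isEmptyElim (fun i => isEmptyElim i) isEmptyElim
      fun i => isEmptyElim i)
  have h2 := (h.trans (congrArg₂ (· + ·) (h1 _ ‹IsEmpty X.I›) (h1 _ ‹IsEmpty X.I›))).symm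
  exact add_eq_left.mp h2

theorem cls_option {I : Type} [Finite I] (c : Option I → Triple) :
    (MultiTriple.mk (Option I) c).cls = (c none).cls + (MultiTriple.mk I (c ∘ some)).cls := by
  -- The whole component at `none` and the empty set elsewhere, hence closed with closed complement.
  -- Both restrictions keep the full index type, but their superfluous components are empty.
  let S : ∀ i, Set (c i).obj.base.pts := fun i => {_x | i = none}
  refine ((MultiTriple.mk (Option I) c).cls_closed S (fun i => isClosed_const (p := i = none))
    (fun _ _ _ h => h)).trans (congrArg₂ (· + ·) ?_ ?_)
  · refine (cls_eq_of_equivalent (equivalent_of_injective (X := single (c none)) (fun _ => none)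
      (fun _ _ _ => rfl) (fun _ => Triple.Iso.restrict_univ _ _ _ fun _ => rfl) ?_)).symm
    rintro k ⟨x, hx⟩
    exact ⟨(), Eq.symm hx⟩
  · refine (cls_eq_of_equivalent (equivalent_of_injective (X := MultiTriple.mk I (c ∘ some)) some
      (Option.some_injective I) (fun i => Triple.Iso.restrict_univ _ _ _ fun _ h => ?_) ?_)).symm
    · exact Option.some_ne_none i h
    · rintro (_ | i) ⟨x, hx⟩
      · exact (hx rfl).elim
      · exact ⟨i, rfl⟩

/-- Induction on the index type, one component being split off at a time. This reduces the group to
classes of triples. -/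
theorem cls_eq_finsum (X : MultiTriple) : X.cls = ∑ᶠ i, (X.comp i).cls := by
  suffices h : ∀ (hI : Finite X.I) (c : X.I → Triple),
      (MultiTriple.mk X.I c).cls = ∑ᶠ i, (c i).cls from h X.finite X.comp
  refine Finite.induction_empty_option (P := fun I => ∀ (hI : Finite I) (c : I → Triple),
    (MultiTriple.mk I c).cls = ∑ᶠ i, (c i).cls) ?_ ?_ ?_ X.I
  · intro α β e ih hI c
    have := Finite.of_equiv _ e.symm
    rw [← finsum_comp_equiv e, ← ih this fun i => c (e i)]
    exact cls_eq_of_equivalent (equivalent_of_injective e.symm e.symm.injective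
      (fun i => by
        change (c i).Iso (c (e (e.symm i)))
        rw [e.apply_symm_apply]
        exact Triple.Iso.refl _)
      fun k _ => ⟨e k, e.symm_apply_apply k⟩)
  · intro hI c
    have : IsEmpty (MultiTriple.mk PEmpty c).I := inferInstanceAs (IsEmpty PEmpty)
    rw [cls_of_isEmpty, finsum_of_isEmpty]
  · intro α _ ih hI c
    rw [cls_option, finsum_eq_sum_of_fintype, Fintype.sum_option, ih inferInstance,
      finsum_eq_sum_of_fintype]
    rfl

end MultiTriple

/-! ### Additive invariants and locally closed partitions -/

/-- An invariant of triples that does not change under isomorphism and induction and that is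
additive with respect to closed subvarieties. -/
structure IsAdditive {A : Type*} [AddCommGroup A] (v : Triple → A) : Prop where
  ind : ∀ {G H : Type} [Group G] [Finite G] [Group H] [Finite H] {X : GBundle G} {Y : GBundle H}
    {φ : G →* H} {f : X.base.pts → Y.base.pts} {F : X.bundle.tot → Y.bundle.tot},
    GBundle.IsInd φ f F → v (Triple.of X) = v (Triple.of Y)
  closed : ∀ {G : Type} [Group G] [Finite G] (X : GBundle G) (S : Set X.base.pts)
    (hS : IsClosed S) (hG : ∀ (g : G), ∀ x ∈ S, g • x ∈ S),
    v (Triple.of X) = v (Triple.of (X.restrict S hS.isLocallyClosed hG)) +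
      v (Triple.of (X.restrict Sᶜ hS.isOpen_compl.isLocallyClosed (X.smul_mem_compl hG)))

namespace IsAdditive

variable {A : Type*} [AddCommGroup A] {v : Triple → A}

theorem iso (hv : IsAdditive v) {X Y : Triple} (h : X.Iso Y) : v X = v Y := by
  obtain ⟨φ, f, F, hi, hs, h1, h2⟩ := Triple.Iso.exists_initial h
  exact hv.ind (GBundle.IsInd.of_initial φ hi hs h1 h2)

open Classical in
/-- The value of `v` at the restriction to `S`, extended by zero. -/
def restrictVal {A : Type*} [AddCommGroup A] (v : Triple → A) {G : Type} [Group G] [Finite G]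
    (X : GBundle G) (S : Set X.base.pts) : A :=
  if h : IsLocallyClosed S ∧ ∀ (g : G), ∀ x ∈ S, g • x ∈ S then
    v (Triple.of (X.restrict S h.1 h.2)) else 0

theorem restrictVal_eq {G : Type} [Group G] [Finite G] {X : GBundle G} {S : Set X.base.pts}
    (hS : IsLocallyClosed S) (hG : ∀ (g : G), ∀ x ∈ S, g • x ∈ S) :
    restrictVal v X S = v (Triple.of (X.restrict S hS hG)) := dif_pos ⟨hS, hG⟩

variable {G : Type} [Group G] [Finite G] {X : GBundle G}

/-- Additivity for closed sets, relative to a locally closed set. With values attached to bare sets,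
set identities can be rewritten without carrying proofs of local closedness and invariance. -/
theorem restrictVal_cut (hv : IsAdditive v) {S C : Set X.base.pts}
    (hS : IsLocallyClosed S) (hG : ∀ (g : G), ∀ x ∈ S, g • x ∈ S) (hC : IsClosed C)
    (hCG : ∀ (g : G), ∀ x ∈ C, g • x ∈ C) :
    restrictVal v X S = restrictVal v X (S ∩ C) + restrictVal v X (S ∩ Cᶜ) := by
  rw [restrictVal_eq hS hG,
    restrictVal_eq (hS.inter hC.isLocallyClosed) fun g x hx => ⟨hG g x hx.1, hCG g x hx.2⟩,
    restrictVal_eq (hS.inter hC.isOpen_compl.isLocallyClosed)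
      fun g x hx => ⟨hG g x hx.1, X.smul_mem_compl hCG g x hx.2⟩]
  have hC' : IsClosed {x : (X.base.sub S hS).pts | x.1 ∈ C} :=
    hC.preimage (QPVariety.isRegularMap_val S hS).1
  rw [hv.closed (X.restrict S hS hG) _ hC' fun g x hx => hCG g x.1 hx]
  refine congrArg₂ (· + ·) (hv.iso ?_) (hv.iso ?_)
  · exact Triple.Iso.restrict_restrict _ _ _ _ _ _ _ fun x =>
      ⟨fun h => ⟨h.1, h.2⟩, fun ⟨h, h'⟩ => ⟨h, h'⟩⟩
  · exact Triple.Iso.restrict_restrict _ _ _ _ _ _ _ fun x =>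
      ⟨fun h => ⟨h.1, h.2⟩, fun ⟨h, h'⟩ => ⟨h, h'⟩⟩

theorem restrictVal_empty (hv : IsAdditive v) : restrictVal v X ∅ = 0 := by
  have h := hv.restrictVal_cut (X := X) (S := ∅) (C := ∅) isOpen_empty.isLocallyClosed
    (fun _ _ h => h) isClosed_empty (fun _ _ h => h)
  rw [Set.empty_inter, Set.empty_inter] at h
  exact add_eq_left.mp h.symm

/-- The hypothesis `h` says that on `W` the closed sets in `l` separate the pieces: points lying in
the same members of `l` lie in the same piece. Cutting `W` by the head of the list leaves two sets
on each of which the tail separates the pieces. When the list is exhausted, `W` is empty or lies in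
a single piece. -/
theorem restrictVal_partition (hv : IsAdditive v) {P : Type} [Finite P] (S : P → Set X.base.pts)
    (hS : ∀ k, IsLocallyClosed (S k)) (hSG : ∀ k (g : G), ∀ x ∈ S k, g • x ∈ S k)
    (hex : ∀ x, ∃! k, x ∈ S k) (l : List (Set X.base.pts))
    (hl : ∀ C ∈ l, IsClosed C ∧ ∀ (g : G), ∀ x ∈ C, g • x ∈ C) (W : Set X.base.pts)
    (hW : IsLocallyClosed W) (hWG : ∀ (g : G), ∀ x ∈ W, g • x ∈ W)
    (h : ∀ x ∈ W, ∀ y ∈ W, (∀ C ∈ l, x ∈ C ↔ y ∈ C) → ∀ k, x ∈ S k → y ∈ S k) :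
    restrictVal v X W = ∑ᶠ k, restrictVal v X (W ∩ S k) := by
  induction l generalizing W with
  | nil =>
    rcases W.eq_empty_or_nonempty with rfl | ⟨x, hx⟩
    · simp [hv.restrictVal_empty]
    · obtain ⟨k, hk, -⟩ := hex x
      have hWk : ∀ y ∈ W, y ∈ S k := fun y hy => h x hx y hy (by simp) k hk
      -- Only the piece containing `W` contributes; the others meet `W` in the empty set, where the
      -- value is zero.
      rw [finsum_eq_single _ k, Set.inter_eq_left.mpr hWk]
      intro k' hk'
      rw [← hv.restrictVal_empty (X := X)]
      congr 1
      refine Set.eq_empty_of_forall_notMem fun y hy => hk' ?_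
      exact (hex y).unique hy.2 (hWk y hy.1)
  | cons C l ih =>
    obtain ⟨hC, hCG⟩ := hl C (by simp)
    have hl' : ∀ C ∈ l, IsClosed C ∧ ∀ (g : G), ∀ x ∈ C, g • x ∈ C := fun D hD =>
      hl D (by simp [hD])
    rw [hv.restrictVal_cut hW hWG hC hCG,
      ih hl' _ (hW.inter hC.isLocallyClosed) (fun g x hx => ⟨hWG g x hx.1, hCG g x hx.2⟩)
        fun x hx y hy hxy => h x hx.1 y hy.1 (by simpa [hx.2, hy.2] using hxy),
      ih hl' _ (hW.inter hC.isOpen_compl.isLocallyClosed)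
        (fun g x hx => ⟨hWG g x hx.1, X.smul_mem_compl hCG g x hx.2⟩)
        fun x hx y hy hxy => h x hx.1 y hy.1 (by
          simpa [Set.notMem_of_mem_compl hx.2, Set.notMem_of_mem_compl hy.2] using hxy),
      ← finsum_add_distrib (Set.toFinite _) (Set.toFinite _)]
    refine finsum_congr fun k => ?_
    rw [hv.restrictVal_cut (hW.inter (hS k)) (fun g x hx => ⟨hWG g x hx.1, hSG k g x hx.2⟩) hC hCG,
      Set.inter_right_comm, Set.inter_right_comm W Cᶜ]

/-- A locally closed set is the difference of the closed sets `closure (S k)` and `closure (S k) \ S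
k`, which are invariant because the group acts by homeomorphisms. Together these closed sets
separate the pieces. -/
theorem eq_finsum (hv : IsAdditive v) {P : Type} [Finite P] (S : P → Set X.base.pts)
    (hS : ∀ k, IsLocallyClosed (S k)) (hSG : ∀ k (g : G), ∀ x ∈ S k, g • x ∈ S k)
    (hex : ∀ x, ∃! k, x ∈ S k) :
    v (Triple.of X) = ∑ᶠ k, v (Triple.of (X.restrict (S k) (hS k) (hSG k))) := by
  have := Fintype.ofFinite P
  have hcl : ∀ k (g : G), ∀ x ∈ closure (S k), g • x ∈ closure (S k) := fun k g x hx =>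
    (Set.MapsTo.closure (f := fun x : X.base.pts => g • x) (hSG k g)
      (X.isBundleMap_smul g).1.1) hx
  have h := hv.restrictVal_partition S hS hSG hex
    (Finset.univ.toList.map (fun k => closure (S k)) ++
      Finset.univ.toList.map fun k => closure (S k) \ S k) ?_ Set.univ
    isOpen_univ.isLocallyClosed (fun _ _ _ => trivial) ?_
  · rw [restrictVal_eq isOpen_univ.isLocallyClosed fun _ _ _ => trivial] at h
    rw [hv.iso (Triple.Iso.restrict_univ X isOpen_univ.isLocallyClosed (fun _ _ _ => trivial)
      fun _ => trivial), h]
    refine finsum_congr fun k => ?_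
    rw [Set.univ_inter, restrictVal_eq (hS k) (hSG k)]
  · intro C hC
    simp only [List.mem_append, List.mem_map, Finset.mem_toList, Finset.mem_univ, true_and] at hC
    obtain ⟨k, rfl⟩ | ⟨k, rfl⟩ := hC
    · exact ⟨isClosed_closure, hcl k⟩
    · refine ⟨?_, fun g x hx => ⟨hcl k g x hx.1, X.smul_mem_compl (hSG k) g x hx.2⟩⟩
      -- The complement of `closure (S k) \ S k` is the coborder, which is open exactly when the set
      -- is locally closed.
      exact isOpen_compl_iff.mp (hS k).isOpen_coborder
  · intro x _ y _ hxy k hx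
    have h1 := hxy (closure (S k)) (by simp)
    have h2 := hxy (closure (S k) \ S k) (by simp)
    by_contra hy
    exact (h2.mpr ⟨h1.mp (subset_closure hx), hy⟩).2 hx

theorem finsum_eq_of_equivalent (hv : IsAdditive v) {X Y : MultiTriple} (h : X.Equivalent Y) :
    ∑ᶠ i, v (X.comp i) = ∑ᶠ i, v (Y.comp i) := by
  have key : ∀ (X : MultiTriple) (p : X.Partition),
      ∑ᶠ i, v (X.comp i) = ∑ᶠ k, v (p.piece k) := by
    intro X p
    have := p.finite
    have := Fintype.ofFinite X.I
    have := fun i => Fintype.ofFinite (p.P i)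
    rw [finsum_eq_sum_of_fintype, finsum_eq_sum_of_fintype, Fintype.sum_sigma]
    refine Finset.sum_congr rfl fun i _ => ?_
    have h1 := hv.eq_finsum (p.part i) (p.isLocallyClosed i) (p.smul_mem i) (p.existsUnique i)
    rw [finsum_eq_sum_of_fintype] at h1
    exact h1
  obtain ⟨p, q, e, he⟩ := h
  rw [key X p, key Y q, ← finsum_comp_equiv e]
  exact finsum_congr fun k => hv.iso (he k)

end IsAdditive

/-- The universal additive invariant: the relations of K give its axioms once an abstract induced
triple is replaced by the constructed one through `IsInd.iso_induce`. -/
theorem Triple.cls_isAdditive : IsAdditive Triple.cls where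
  ind := fun {G H _ _ _ _ X Y φ f F} h => by
    have h1 := (QuotientAddGroup.eq_zero_iff (N := AddSubgroup.closure {x | K0Rel x}) _).mpr
      (AddSubgroup.subset_closure (K0Rel.induced (Triple.of X) H φ h.injective_hom))
    refine (sub_eq_zero.mp h1).symm.trans (MultiTriple.cls_eq_of_equivalent ?_)
    exact MultiTriple.equivalent_of_injective (Y := MultiTriple.single (Triple.of Y)) (fun i => i)
      (fun _ _ h => h) (fun _ => h.iso_induce) (fun k _ => ⟨k, rfl⟩)
  closed := fun X S hS hG =>
    (MultiTriple.single (Triple.of X)).cls_closed (fun _ => S) (fun _ => hS) (fun _ => hG)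

/-! ### Homomorphisms out of the Grothendieck group -/

namespace K0

variable {A : Type*} [AddCommGroup A]

/-- The homomorphism from the Grothendieck group given by an additive invariant of triples. -/
def lift (v : Triple → A) (hv : IsAdditive v) : K0 →+ A :=
  QuotientAddGroup.lift (AddSubgroup.closure {x | K0Rel x})
    -- By `cls_eq_finsum`, the value on a disjoint union has to be the sum over its components.
    (FreeAbelianGroup.lift fun X : MultiTriple => ∑ᶠ i, v (X.comp i)) (by
      rw [AddSubgroup.closure_le]
      intro x hx
      change FreeAbelianGroup.lift _ x = 0
      induction hx with
      | equivalent X Y h =>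
        rw [map_sub, FreeAbelianGroup.lift_apply_of, FreeAbelianGroup.lift_apply_of,
          hv.finsum_eq_of_equivalent h, sub_self]
      | closed X S hS hG =>
        rw [map_sub, map_add, FreeAbelianGroup.lift_apply_of, FreeAbelianGroup.lift_apply_of,
          FreeAbelianGroup.lift_apply_of, sub_eq_zero]
        refine Eq.trans ?_ (finsum_add_distrib (Set.toFinite _) (Set.toFinite _))
        exact finsum_congr fun i => hv.closed (X.comp i).obj (S i) (hS i) (hG i)
      | induced X H φ hφ =>
        rw [map_sub, FreeAbelianGroup.lift_apply_of, FreeAbelianGroup.lift_apply_of, sub_eq_zero]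
        exact finsum_congr fun _ => (hv.ind (X.obj.isInd_indMk φ hφ)).symm)

theorem lift_cls (v : Triple → A) (hv : IsAdditive v) (X : Triple) : lift v hv X.cls = v X := by
  change FreeAbelianGroup.lift _ (FreeAbelianGroup.of _) = _
  rw [FreeAbelianGroup.lift_apply_of]
  exact finsum_unique (α := Unit) fun _ => v X

theorem closure_cls : AddSubgroup.closure (Set.range Triple.cls) = ⊤ := by
  refine eq_top_iff.mpr fun a _ => ?_
  obtain ⟨x, rfl⟩ := QuotientAddGroup.mk_surjective a
  induction x using FreeAbelianGroup.induction_on with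
  | zero => exact zero_mem _
  | of X =>
    change X.cls ∈ _
    rw [X.cls_eq_finsum]
    have := Fintype.ofFinite X.I
    rw [finsum_eq_sum_of_fintype]
    exact sum_mem fun i _ => AddSubgroup.subset_closure ⟨_, rfl⟩
  | neg X h => exact neg_mem (h trivial)
  | add x y hx hy => exact add_mem (hx trivial) (hy trivial)

theorem induction_on {p : K0 → Prop} (a : K0) (cls : ∀ X : Triple, p X.cls) (zero : p 0)
    (add : ∀ a b, p a → p b → p (a + b)) (neg : ∀ a, p a → p (-a)) : p a := by
  have ha : a ∈ AddSubgroup.closure (Set.range Triple.cls) := by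
    rw [closure_cls]
    trivial
  induction ha using AddSubgroup.closure_induction with
  | mem x hx =>
    obtain ⟨X, rfl⟩ := hx
    exact cls X
  | zero => exact zero
  | add x y _ _ hx hy => exact add x y hx hy
  | neg x _ hx => exact neg x hx

theorem hom_ext {f g : K0 →+ A} (h : ∀ X : Triple, f X.cls = g X.cls) : f = g :=
  AddMonoidHom.eq_of_eqOn_dense closure_cls (by
    rintro _ ⟨X, rfl⟩
    exact h X)

end K0

/-! The ring structure. -/

section products

variable {X Y W : QPVariety}

theorem VBundle.isInitial_swap (E : VBundle X) (F : VBundle Y) :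
    IsInitial (E.prod F) (F.prod E) Prod.swap Prod.swap :=
  .of_inverse (φ := Prod.swap) (Φ := Prod.swap)
    (isBundleMap_prodMk (isBundleMap_snd E F) (isBundleMap_fst E F))
    (isBundleMap_prodMk (isBundleMap_snd F E) (isBundleMap_fst F E))
    (fun _ => rfl) (fun _ => rfl) (fun _ => rfl)

theorem VBundle.isInitial_prodAssoc (E : VBundle X) (F : VBundle Y) (K : VBundle W) :
    IsInitial ((E.prod F).prod K) (E.prod (F.prod K)) (Equiv.prodAssoc _ _ _)
      (Equiv.prodAssoc _ _ _) := by
  have h1 := isBundleMap_fst (E.prod F) K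
  have h2 := isBundleMap_snd E (F.prod K)
  have h11 := isBundleMap_comp (isBundleMap_fst E F) h1
  have h12 := isBundleMap_comp (isBundleMap_snd E F) h1
  have h21 := isBundleMap_comp (isBundleMap_fst F K) h2
  have h22 := isBundleMap_comp (isBundleMap_snd F K) h2
  exact .of_inverse (φ := (Equiv.prodAssoc _ _ _).symm) (Φ := (Equiv.prodAssoc _ _ _).symm)
    (isBundleMap_prodMk h11 (isBundleMap_prodMk h12 (isBundleMap_snd (E.prod F) K)))
    (isBundleMap_prodMk (isBundleMap_prodMk (isBundleMap_fst E (F.prod K)) h21) h22)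
    (fun _ => rfl) (fun _ => rfl) (fun _ => rfl)

variable {G H K : Type} [Group G] [Finite G] [Group H] [Finite H] [Group K] [Finite K]

theorem Triple.Iso.prod_comm (X : GBundle G) (Y : GBundle H) :
    (Triple.of (X.prod Y)).Iso (Triple.of (Y.prod X)) :=
  Triple.Iso.of_initial (X := X.prod Y) (Y := Y.prod X) MulEquiv.prodComm
    (isInitial_swap X.bundle Y.bundle) Prod.swap_surjective (fun _ _ => rfl) (fun _ _ => rfl)

theorem Triple.Iso.prod_assoc (X : GBundle G) (Y : GBundle H) (Z : GBundle K) :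
    (Triple.of ((X.prod Y).prod Z)).Iso (Triple.of (X.prod (Y.prod Z))) :=
  Triple.Iso.of_initial (X := (X.prod Y).prod Z) (Y := X.prod (Y.prod Z)) MulEquiv.prodAssoc
    (isInitial_prodAssoc X.bundle Y.bundle Z.bundle) (Equiv.prodAssoc _ _ _).surjective
    (fun _ _ => rfl) (fun _ _ => rfl)

theorem Triple.Iso.prod_point (X : GBundle G) :
    (Triple.of (X.prod GBundle.point)).Iso (Triple.of X) := by
  refine Triple.Iso.of_initial (X := X.prod GBundle.point) MulEquiv.prodUnique
    (f := Prod.fst) (F := Prod.fst)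
    (.of_inverse (φ := fun x => (x, ())) (Φ := fun e => (e, ()))
      (isBundleMap_fst X.bundle GBundle.point.bundle)
      (isBundleMap_prodMk isBundleMap_id (isBundleMap_zeroBundle (QPVariety.IsRegularMap.const _)))
      (fun _ => rfl) (fun _ => rfl) (fun _ => rfl))
    (fun x => ⟨(x, ()), rfl⟩) (fun _ _ => rfl) (fun _ _ => rfl)

theorem Triple.Iso.restrict_prod (X : GBundle G) (Y : GBundle H) {S : Set X.base.pts}
    (hS : IsLocallyClosed S) (hSG : ∀ (g : G), ∀ x ∈ S, g • x ∈ S)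
    {T : Set (X.prod Y).base.pts} (hT : IsLocallyClosed T)
    (hTG : ∀ (g : G × H), ∀ x ∈ T, g • x ∈ T) (h : ∀ x : X.base.pts × Y.base.pts,
      x ∈ T ↔ x.1 ∈ S) :
    (Triple.of ((X.restrict S hS hSG).prod Y)).Iso (Triple.of ((X.prod Y).restrict T hT hTG)) :=
  Triple.Iso.restrict_range (X := (X.restrict S hS hSG).prod Y) (Y := X.prod Y) (MulEquiv.refl _)
    ((IsInitial.val X.bundle S hS).prodMap .id) (fun _ _ => rfl) (fun _ _ => rfl) hT hTG
    fun y => (h y).trans ⟨fun hy => ⟨(⟨y.1, hy⟩, y.2), rfl⟩, fun ⟨x, hx⟩ => hx ▸ x.1.2⟩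

/-- Induction commutes with the product by a fixed triple, and the preimage of a closed set under
the first projection is closed. -/
theorem isAdditive_prod_left (Y : Triple) :
    IsAdditive fun X : Triple => (Triple.of (X.obj.prod Y.obj)).cls where
  ind := fun h => Triple.cls_isAdditive.ind (h.prod Y.obj)
  closed := fun X S hS hG => by
    have hT : IsClosed {x : (X.prod Y.obj).base.pts | x.1 ∈ S} :=
      hS.preimage (isBundleMap_fst X.bundle Y.obj.bundle).1.1
    refine (Triple.cls_isAdditive.closed (X.prod Y.obj) _ hT fun g x hx => hG g.1 x.1 hx).trans ?_
    refine congrArg₂ (· + ·) (Triple.cls_isAdditive.iso ?_).symm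
      (Triple.cls_isAdditive.iso ?_).symm
    · exact Triple.Iso.restrict_prod X Y.obj _ hG _ _ fun _ => Iff.rfl
    · exact Triple.Iso.restrict_prod X Y.obj _ (X.smul_mem_compl hG) _ _ fun _ => Iff.rfl

theorem cls_prod_comm (X Y : Triple) :
    (Triple.of (X.obj.prod Y.obj)).cls = (Triple.of (Y.obj.prod X.obj)).cls :=
  Triple.cls_isAdditive.iso (Triple.Iso.prod_comm X.obj Y.obj)

theorem isAdditive_prod_right (X : Triple) :
    IsAdditive fun Y : Triple => (Triple.of (X.obj.prod Y.obj)).cls := by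
  simp only [cls_prod_comm X]
  exact isAdditive_prod_left X

end products

namespace K0

/-- Multiplication by the class of a triple. -/
def mulCls (X : Triple) : K0 →+ K0 := lift _ (isAdditive_prod_right X)

theorem mulCls_cls (X Y : Triple) : mulCls X Y.cls = (Triple.of (X.obj.prod Y.obj)).cls :=
  lift_cls _ _ _

/-- Multiplication by a class is itself an additive invariant, with values in the endomorphisms of
K. Tested on a triple `Z`, this is additivity of the product in the other variable. A second
extension then yields a biadditive product. -/
theorem isAdditive_mulCls : IsAdditive mulCls where
  ind := fun {G H _ _ _ _ X Y φ f F} h => hom_ext fun Z => by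
    rw [mulCls_cls, mulCls_cls]
    exact (isAdditive_prod_left Z).ind h
  closed := fun X S hS hG => hom_ext fun Z => by
    rw [AddMonoidHom.add_apply, mulCls_cls, mulCls_cls, mulCls_cls]
    exact (isAdditive_prod_left Z).closed X S hS hG

/-- The multiplication given by the Cartesian product. -/
def mulHom : K0 →+ K0 →+ K0 := lift mulCls isAdditive_mulCls

theorem mulHom_cls (X Y : Triple) :
    mulHom X.cls Y.cls = (Triple.of (X.obj.prod Y.obj)).cls := by
  rw [mulHom, lift_cls, mulCls_cls]

theorem mulHom_comm (a b : K0) : mulHom a b = mulHom b a := by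
  have : mulHom = mulHom.flip := hom_ext fun X => hom_ext fun Y => by
    rw [AddMonoidHom.flip_apply, mulHom_cls, mulHom_cls, cls_prod_comm]
  rw [this, AddMonoidHom.flip_apply, ← this]

theorem mulHom_one (a : K0) : mulHom a (Triple.of GBundle.point).cls = a := by
  have : mulHom.flip (Triple.of GBundle.point).cls = AddMonoidHom.id K0 := hom_ext fun X => by
    rw [AddMonoidHom.flip_apply, mulHom_cls]
    exact Triple.cls_isAdditive.iso (Triple.Iso.prod_point X.obj)
  exact DFunLike.congr_fun this a

theorem mulHom_assoc (a b c : K0) : mulHom (mulHom a b) c = mulHom a (mulHom b c) := by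
  induction a using K0.induction_on with
  | zero => simp
  | add a a' h h' => simp [h, h']
  | neg a h => simp [h]
  | cls X =>
    induction b using K0.induction_on with
    | zero => simp
    | add a a' h h' => simp [h, h']
    | neg a h => simp [h]
    | cls Y =>
      induction c using K0.induction_on with
      | zero => simp
      | add a a' h h' => simp [h, h']
      | neg a h => simp [h]
      | cls Z =>
        rw [mulHom_cls, mulHom_cls, mulHom_cls, mulHom_cls]
        exact Triple.cls_isAdditive.iso (Triple.Iso.prod_assoc X.obj Y.obj Z.obj)

/-- The ring structure given by the Cartesian product. -/
@[reducible]
def commRing : CommRing K0 where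
  __ := K0.addCommGroup
  mul := fun a b => mulHom a b
  one := (Triple.of GBundle.point).cls
  left_distrib := fun a b c => map_add (mulHom a) b c
  right_distrib := fun a b c => DFunLike.congr_fun (map_add mulHom a b) c
  zero_mul := fun a => DFunLike.congr_fun (map_zero mulHom) a
  mul_zero := fun a => map_zero (mulHom a)
  mul_assoc := mulHom_assoc
  one_mul := fun a => (mulHom_comm _ a).trans (mulHom_one a)
  mul_one := mulHom_one
  mul_comm := mulHom_comm

/-- Both sides expand into sums over pairs of components. It is needed because the product on K is
prescribed on disjoint unions, not only on single triples. -/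
theorem mulHom_multi (X Y : MultiTriple) : mulHom X.cls Y.cls = (X.prod Y).cls := by
  have := Fintype.ofFinite X.I
  have := Fintype.ofFinite Y.I
  let : Fintype (X.prod Y).I := inferInstanceAs (Fintype (X.I × Y.I))
  rw [X.cls_eq_finsum, Y.cls_eq_finsum, (X.prod Y).cls_eq_finsum, finsum_eq_sum_of_fintype,
    finsum_eq_sum_of_fintype, finsum_eq_sum_of_fintype]
  refine Eq.trans ?_ (Fintype.sum_prod_type
    (fun i : X.I × Y.I => ((X.prod Y).comp i).cls)).symm
  refine (map_sum (mulHom.flip _) _ _).trans (Finset.sum_congr rfl fun i _ => ?_)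
  rw [AddMonoidHom.flip_apply]
  refine (map_sum (mulHom (X.comp i).cls) _ _).trans (Finset.sum_congr rfl fun k _ => ?_)
  exact mulHom_cls _ _

theorem isCartesianRing_commRing : IsCartesianRing commRing where
  addCommGroup_eq := rfl
  mul_cls := mulHom_multi
  one_eq := rfl

/-- A biadditive map on K is determined by its values at pairs of triples. -/
theorem eq_mulHom (m : K0 → K0 → K0) (h : ∀ a b c, m a (b + c) = m a b + m a c)
    (h' : ∀ a b c, m (a + b) c = m a c + m b c) (hc : ∀ X Y : Triple, m X.cls Y.cls =
      ((MultiTriple.single X).prod (MultiTriple.single Y)).cls) (a b : K0) : m a b = mulHom a b := by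
  let M : K0 →+ K0 →+ K0 := AddMonoidHom.mk' (fun a => AddMonoidHom.mk' (m a) (h a))
    fun a b => AddMonoidHom.ext (h' a b)
  have hM : M = mulHom := hom_ext fun X => hom_ext fun Y =>
    (hc X Y).trans (mulHom_multi (MultiTriple.single X) (MultiTriple.single Y)).symm
  exact DFunLike.congr_fun (DFunLike.congr_fun hM a) b

theorem eq_commRing (R : CommRing K0) (h : IsCartesianRing R) : R = commRing := by
  have ha : ∀ a b : K0, R.add a b = K0.addCommGroup.add a b := fun a b =>
    congrArg (fun i : AddCommGroup K0 => i.add a b) h.addCommGroup_eq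
  -- A commutative ring structure is determined by its addition and multiplication. Distributivity
  -- in `R` refers to the addition of `R`, which `ha` translates into that of K.
  refine CommRing.ext (funext fun a => funext fun b => ha a b) (funext fun a => funext fun b => ?_)
  exact eq_mulHom R.mul
    (fun a b c => (congrArg (R.mul a) (ha b c)).symm.trans ((R.left_distrib a b c).trans (ha _ _)))
    (fun a b c => (congrArg (R.mul · c) (ha a b)).symm.trans
      ((R.right_distrib a b c).trans (ha _ _)))
    (fun X Y => h.mul_cls (MultiTriple.single X) (MultiTriple.single Y)) a b

end K0

/-! Powers and configuration spaces. -/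

namespace GBundle

variable {G H : Type} [Group G] [Group H]

/-- The set of all `n`-tuples, or that of the tuples with pairwise different orbits. -/
def powSet (b : Bool) (X : GBundle G) (n : ℕ) : Set (X.power n).base.pts :=
  {x | b = true ∨ x ∈ X.offDiag n}

theorem isOpen_powSet [Finite G] (b : Bool) (X : GBundle G) (n : ℕ) : IsOpen (powSet b X n) :=
  (isOpen_const (p := b = true)).union (X.isOpen_offDiag n)

theorem smul_mem_powSet (b : Bool) (X : GBundle G) (n : ℕ) (w : Wreath G n)
    (x : (X.power n).base.pts) (hx : x ∈ powSet b X n) : w • x ∈ powSet b X n :=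
  hx.imp id (X.smul_mem_offDiag n w x)

/-- The Cartesian power or the configuration space. -/
def pow [Finite G] (b : Bool) (X : GBundle G) (n : ℕ) : GBundle (Wreath G n) :=
  (X.power n).restrict (powSet b X n) (isOpen_powSet b X n).isLocallyClosed (smul_mem_powSet b X n)

theorem cls_power [Finite G] (X : GBundle G) (n : ℕ) :
    (Triple.of (X.power n)).cls = (Triple.of (X.pow true n)).cls :=
  Triple.cls_isAdditive.iso (Triple.Iso.restrict_univ _ _ _ fun _ => Or.inl rfl)

theorem cls_config [Finite G] (X : GBundle G) (n : ℕ) :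
    (Triple.of (X.config n)).cls = (Triple.of (X.pow false n)).cls :=
  Triple.cls_isAdditive.iso (Triple.Iso.restrict_range (X := X.config n) (MulEquiv.refl _)
    (IsInitial.val (X.power n).bundle _ _) (fun _ _ => rfl) (fun _ _ => rfl) _ _ fun x =>
      ⟨fun h => ⟨⟨x, h.resolve_left Bool.false_ne_true⟩, rfl⟩, fun ⟨y, hy⟩ => hy ▸ Or.inr y.2⟩)

/-- The homomorphism of wreath products given by a homomorphism of groups. -/
def wreathMap (φ : G →* H) (n : ℕ) : Wreath G n →* Wreath H n where
  toFun := fun w => ⟨fun i => φ (w.left i), w.right⟩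
  map_one' := SemidirectProduct.ext (funext fun _ => map_one φ) rfl
  map_mul' := fun _ _ => SemidirectProduct.ext (funext fun _ => map_mul φ _ _) rfl

theorem wreathMap_injective {φ : G →* H} (hφ : Function.Injective φ) (n : ℕ) :
    Function.Injective (wreathMap φ n) := fun _ _ h =>
  SemidirectProduct.ext (funext fun i => hφ (congrFun (congrArg SemidirectProduct.left h) i))
    (SemidirectProduct.ext_iff.mp h).2

section ind

variable {X : GBundle G} {Y : GBundle H} {φ : G →* H}
  {f : X.base.pts → Y.base.pts} {F : X.bundle.tot → Y.bundle.tot}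

/-- An element of `H` that carries one point of the image of `f` to another comes from `G`, so two
points share a `G`-orbit exactly when their images share an `H`-orbit. The big diagonals therefore
correspond. -/
theorem IsInd.mem_powSet_iff (h : IsInd φ f F) {b : Bool} {n : ℕ} {x : Fin n → X.base.pts} :
    (fun i => f (x i)) ∈ Y.powSet b n ↔ x ∈ X.powSet b n := by
  refine or_congr Iff.rfl ⟨fun hx i j hij g hg => ?_, fun hx i j hij a ha => ?_⟩
  · refine hx i j hij (φ g) ?_
    change φ g • f (x i) = f (x j)
    rw [← h.map_smul, hg]
  · obtain ⟨g, rfl⟩ := h.mem_range _ _ _ ha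
    exact hx i j hij g (h.initial.injective ((h.map_smul _ _).trans ha))

variable [Finite G] [Finite H]

/-- Powers and configuration spaces are compatible with induction. This is why the two series do not
change when a triple is replaced by an induced one. -/
theorem IsInd.pow (h : IsInd φ f F) (b : Bool) (n : ℕ) :
    IsInd (X := X.pow b n) (Y := Y.pow b n) (wreathMap φ n)
      (fun x => ⟨fun i => f (x.1 i), h.mem_powSet_iff.mpr x.2⟩)
      (fun e => ⟨fun i => F (e.1 i), by
        have h1 : (fun i => f (X.bundle.proj (e.1 i))) ∈ Y.powSet b n := h.mem_powSet_iff.mpr e.2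
        simp only [← h.initial.isBundleMap.2.1] at h1
        exact h1⟩) where
  injective_hom := wreathMap_injective h.injective_hom n
  initial := (IsInitial.val (Y.power n).bundle _ _).of_comp
    ((IsInitial.pi fun _ : Fin n => h.initial).comp (IsInitial.val (X.power n).bundle _ _))
  map_smul := fun w x => Subtype.ext (funext fun i => h.map_smul _ _)
  map_smul_tot := fun w x => Subtype.ext (funext fun i => h.map_smul_tot _ _)
  isOpen_range := by
    have h1 : IsOpen (⋂ i : Fin n, {y : (Y.pow b n).base.pts | y.1 i ∈ Set.range f}) :=
      isOpen_iInter_of_finite fun i => h.isOpen_range.preimage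
        ((QPVariety.isRegularMap_proj (fun _ : Fin n => Y.base) i).1.comp
          (QPVariety.isRegularMap_val (X := (Y.power n).base) _
            (isOpen_powSet b Y n).isLocallyClosed).1)
    refine (congrArg IsOpen (Set.ext fun y => ?_)).mpr h1
    rw [Set.mem_iInter]
    constructor
    · rintro ⟨x, rfl⟩ i
      exact ⟨x.1 i, rfl⟩
    · intro hy
      choose x hx using hy
      exact ⟨⟨x, h.mem_powSet_iff.mp ((funext hx : (fun i => f (x i)) = y.1) ▸ y.2)⟩,
        Subtype.ext (funext hx)⟩
  exists_smul := fun y => by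
    -- Each entry is moved into the image separately, so an element of `H^n` with trivial
    -- permutation suffices.
    choose a x hx using fun i => h.exists_smul (y.1 i)
    let w : Wreath H n := ⟨a, 1⟩
    have hw : w • (show (Y.power n).base.pts from fun i => f (x i)) = y.1 := funext hx
    have hx' : x ∈ X.powSet b n := by
      refine h.mem_powSet_iff.mp ?_
      have := smul_mem_powSet b Y n w⁻¹ y.1 y.2
      rwa [← hw, inv_smul_smul] at this
    exact ⟨w, ⟨x, hx'⟩, Subtype.ext hw⟩
  mem_range := fun w x x' hx => by
    have hx' : ∀ i, w.left i • f (x.1 (w.right⁻¹ i)) = f (x'.1 i) := fun i =>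
      congrFun (congrArg Subtype.val hx) i
    -- Each component of `w.left` carries a point of the image of `f` into that image, so it comes
    -- from `G`. The permutation needs no condition, since both wreath products contain the full
    -- symmetric group.
    choose g hg using fun i => h.mem_range _ _ _ (hx' i)
    exact ⟨⟨g, w.right⟩, SemidirectProduct.ext (funext hg) rfl⟩

end ind

/-- The empty product of varieties is a point with the zero bundle, and the wreath product on zero
letters is trivial. So the constant term of the uniform series is the unit of the ring. -/
theorem cls_pow_zero [Finite G] (b : Bool) (X : GBundle G) :
    (Triple.of (X.pow b 0)).cls = (Triple.of GBundle.point).cls := by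
  have : Unique (Wreath G 0) :=
    { default := 1
      uniq := fun w => SemidirectProduct.ext (funext fun i => i.elim0) (Subsingleton.elim _ _) }
  have hm : ∀ x : (X.power 0).base.pts, x ∈ X.powSet b 0 := fun x => Or.inr fun i => i.elim0
  have hp : IsBundleMap point.bundle (X.pow b 0).bundle
      (fun _ => ⟨fun i => i.elim0, hm _⟩) (fun _ => ⟨fun i => i.elim0, hm _⟩) := by
    refine (IsInitial.val (X.power 0).bundle _ _).lift _ _ (isBundleMap_pi fun i => i.elim0)
  refine Triple.cls_isAdditive.iso (Triple.Iso.of_initial (X := X.pow b 0) (Y := GBundle.point)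
    MulEquiv.ofUnique (f := fun _ => ()) (F := fun _ => ())
    (.of_inverse (isBundleMap_zeroBundle (QPVariety.IsRegularMap.const (Z := pointVar) ())) hp ?_ ?_ ?_)
    (fun _ => ⟨⟨fun i => i.elim0, hm _⟩, rfl⟩) (fun _ _ => rfl) (fun _ _ => rfl))
  · exact fun x => Subtype.ext (funext fun i => i.elim0)
  · exact fun x => Subtype.ext (funext fun i => i.elim0)
  · exact fun _ => rfl

theorem cls_pow_one [Finite G] (b : Bool) (X : GBundle G) :
    (Triple.of (X.pow b 1)).cls = (Triple.of X).cls := by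
  let φ : G ≃* Wreath G 1 :=
    { toFun := fun g => ⟨fun _ => g, 1⟩
      invFun := fun w => w.left 0
      left_inv := fun _ => rfl
      right_inv := fun w => SemidirectProduct.ext
        (funext fun i => congrArg w.left (Subsingleton.elim _ _)) (Subsingleton.elim _ _)
      map_mul' := fun g h => rfl }
  have hm : ∀ x : (X.power 1).base.pts, x ∈ X.powSet b 1 := fun x =>
    Or.inr fun i j hij => (hij (Subsingleton.elim _ _)).elim
  have hc : ∀ {T : Type} (x : Fin 1 → T), (fun _ => x 0) = x := fun x =>
    funext fun i => congrArg x (Subsingleton.elim _ _)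
  refine (Triple.cls_isAdditive.iso (Triple.Iso.of_initial (X := X) (Y := X.pow b 1) φ
    (f := fun x => ⟨fun _ => x, hm _⟩) (F := fun x => ⟨fun _ => x, hm _⟩)
    (.of_inverse (φ := fun x => x.1 0) (Φ := fun x => x.1 0) ?_ ?_ (fun _ => rfl) (fun _ => rfl)
      fun x => Subtype.ext (hc x.1)) (fun x => ⟨x.1 0, Subtype.ext (hc x.1)⟩)
      (fun _ _ => rfl) (fun _ _ => rfl))).symm
  · exact (IsInitial.val (X.power 1).bundle _ _).lift _ _ (isBundleMap_pi fun i => isBundleMap_id)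
  · exact isBundleMap_comp (isBundleMap_proj (fun _ : Fin 1 => X.bundle) 0)
      (isBundleMap_val (X.power 1).bundle _ _)

end GBundle

/-! The powers of a union of two pieces. -/

section append

variable {G : Type} [Group G] {k l : ℕ}

/-- Permutations of two blocks as a permutation of their concatenation. -/
def permAppend (k l : ℕ) :
    Equiv.Perm (Fin k) × Equiv.Perm (Fin l) →* Equiv.Perm (Fin (k + l)) :=
  (finSumFinEquiv (m := k) (n := l)).permCongrHom.toMonoidHom.comp
    (Equiv.Perm.sumCongrHom (Fin k) (Fin l))

@[simp]
theorem permAppend_castAdd (σ : Equiv.Perm (Fin k) × Equiv.Perm (Fin l)) (i : Fin k) :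
    permAppend k l σ (Fin.castAdd l i) = Fin.castAdd l (σ.1 i) := by
  change finSumFinEquiv (Equiv.sumCongr σ.1 σ.2 (finSumFinEquiv.symm (Fin.castAdd l i))) = _
  simp

@[simp]
theorem permAppend_natAdd (σ : Equiv.Perm (Fin k) × Equiv.Perm (Fin l)) (i : Fin l) :
    permAppend k l σ (Fin.natAdd k i) = Fin.natAdd k (σ.2 i) := by
  change finSumFinEquiv (Equiv.sumCongr σ.1 σ.2 (finSumFinEquiv.symm (Fin.natAdd k i))) = _
  simp

theorem permAppend_injective : Function.Injective (permAppend k l) :=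
  (finSumFinEquiv (m := k) (n := l)).permCongrHom.injective.comp
    Equiv.Perm.sumCongrHom_injective

theorem mem_range_permAppend {σ : Equiv.Perm (Fin (k + l))}
    (h : ∀ i, ∃ j, σ (Fin.castAdd l i) = Fin.castAdd l j) : σ ∈ (permAppend k l).range := by
  let e := (finSumFinEquiv (m := k) (n := l)).permCongrHom
  have h1 : e.symm σ ∈ (Equiv.Perm.sumCongrHom (Fin k) (Fin l)).range := by
    refine Equiv.Perm.mem_sumCongrHom_range_of_perm_mapsTo_inl ?_
    rintro _ ⟨i, rfl⟩
    obtain ⟨j, hj⟩ := h i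
    refine ⟨j, ?_⟩
    change _ = finSumFinEquiv.symm (σ (finSumFinEquiv (Sum.inl i)))
    simp [hj]
  obtain ⟨τ, hτ⟩ := h1
  refine ⟨τ, ?_⟩
  change e (Equiv.Perm.sumCongrHom _ _ τ) = σ
  rw [hτ, e.apply_symm_apply]

/-- A bijection from the first block onto `T`, which has the same cardinality, extends to a
permutation of all indices; its values on the second block lie outside `T`. -/
theorem exists_perm_of_ncard {T : Set (Fin (k + l))} (hT : T.ncard = k) :
    ∃ σ : Equiv.Perm (Fin (k + l)), (∀ i, σ (Fin.castAdd l i) ∈ T) ∧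
      ∀ i, σ (Fin.natAdd k i) ∉ T := by
  classical
  have hc : Nat.card (Set.range (Fin.castAdd l : Fin k → Fin (k + l))) = Nat.card T := by
    rw [Nat.card_coe_set_eq, Nat.card_coe_set_eq, hT,
      Set.ncard_range_of_injective (Fin.castAdd_injective k l), Nat.card_fin]
  rw [Nat.card_eq_fintype_card, Nat.card_eq_fintype_card] at hc
  let e' : {x // x ∈ Set.range (Fin.castAdd l : Fin k → Fin (k + l))} ≃ {x // x ∈ T} :=
    Fintype.equivOfCardEq hc
  refine ⟨e'.extendSubtype, fun i => e'.extendSubtype_mem _ ⟨i, rfl⟩,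
    fun i => e'.extendSubtype_not_mem _ ?_⟩
  rintro ⟨j, hj⟩
  have := congrArg Fin.val hj
  simp only [Fin.val_castAdd, Fin.val_natAdd] at this
  omega

namespace GBundle

/-- The embedding `G_k × G_l → G_{k+l}` of wreath products. -/
def wreathAppend (G : Type) [Group G] (k l : ℕ) : Wreath G k × Wreath G l →* Wreath G (k + l) where
  toFun := fun w => ⟨Fin.append w.1.left w.2.left, permAppend k l (w.1.right, w.2.right)⟩
  map_one' := SemidirectProduct.ext
    (funext fun i => Fin.addCases (fun i => by simp) (fun i => by simp) i) (map_one (permAppend k l))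
  map_mul' := fun v w => by
    refine SemidirectProduct.ext (funext fun i => ?_) (map_mul (permAppend k l)
      (v.1.right, v.2.right) (w.1.right, w.2.right))
    change _ = Fin.append v.1.left v.2.left i *
      Fin.append w.1.left w.2.left ((permAppend k l (v.1.right, v.2.right))⁻¹ i)
    -- The inverse of a concatenated permutation is the concatenation of the inverses, so both
    -- blocks can be evaluated.
    rw [← map_inv]
    refine Fin.addCases (fun i => ?_) (fun i => ?_) i
    · simp only [Fin.append_left, permAppend_castAdd]
      rfl
    · simp only [Fin.append_right, permAppend_natAdd]
      rfl

theorem wreathAppend_injective : Function.Injective (wreathAppend G k l) := by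
  intro v w h
  have h1 : Fin.append v.1.left v.2.left = Fin.append w.1.left w.2.left :=
    (SemidirectProduct.ext_iff.mp h).1
  have h2 : permAppend k l (v.1.right, v.2.right) = permAppend k l (w.1.right, w.2.right) :=
    (SemidirectProduct.ext_iff.mp h).2
  have h3 := permAppend_injective h2
  refine Prod.ext (SemidirectProduct.ext (funext fun i => ?_) (congrArg Prod.fst h3))
    (SemidirectProduct.ext (funext fun i => ?_) (congrArg Prod.snd h3))
  · simpa using congrFun h1 (Fin.castAdd l i)
  · simpa using congrFun h1 (Fin.natAdd k i)

/-- Only the permutation is constrained, since every function on `Fin (k + l)` splits into two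
blocks. The condition is on the inverse permutation because the action reads entry `w.right⁻¹ i` at
position `i`. -/
theorem mem_range_wreathAppend {w : Wreath G (k + l)}
    (h : ∀ i, ∃ j, w.right⁻¹ (Fin.castAdd l i) = Fin.castAdd l j) :
    w ∈ (wreathAppend G k l).range := by
  obtain ⟨σ, hσ⟩ := inv_mem (mem_range_permAppend h)
  rw [inv_inv] at hσ
  exact ⟨(⟨fun i => w.left (Fin.castAdd l i), σ.1⟩, ⟨fun i => w.left (Fin.natAdd k i), σ.2⟩),
    SemidirectProduct.ext Fin.append_castAdd_natAdd hσ⟩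

theorem append_smul {T : Type} [MulAction G T] (w : Wreath G k × Wreath G l) (a : Fin k → T)
    (c : Fin l → T) (i : Fin (k + l)) :
    Fin.append (fun j => w.1.left j • a (w.1.right⁻¹ j)) (fun j => w.2.left j • c (w.2.right⁻¹ j))
      i = (wreathAppend G k l w).left i • Fin.append a c ((wreathAppend G k l w).right⁻¹ i) := by
  change _ = Fin.append w.1.left w.2.left i •
      Fin.append a c ((permAppend k l (w.1.right, w.2.right))⁻¹ i)
  rw [← map_inv]
  refine Fin.addCases (fun i => ?_) (fun i => ?_) i
  · simp only [Fin.append_left, permAppend_castAdd]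
    rfl
  · simp only [Fin.append_right, permAppend_natAdd]
    rfl

end GBundle

/-- Regularity and linearity of a map into a product are tested on coordinates, and each coordinate
of a concatenation is a coordinate of one of the two blocks. -/
theorem VBundle.IsInitial.append {A B X : QPVariety} {E : VBundle A} {F : VBundle B}
    {K : VBundle X} {ψ : A.pts → X.pts} {Ψ : E.tot → K.tot} {φ : B.pts → X.pts}
    {Φ : F.tot → K.tot} (h : IsInitial E K ψ Ψ) (h' : IsInitial F K φ Φ) :
    IsInitial ((VBundle.pi fun _ : Fin k => E).prod (VBundle.pi fun _ : Fin l => F))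
      (VBundle.pi fun _ : Fin (k + l) => K)
      (fun x => Fin.append (fun i => ψ (x.1 i)) (fun i => φ (x.2 i)))
      (fun x => Fin.append (fun i => Ψ (x.1 i)) (fun i => Φ (x.2 i))) where
  isBundleMap := by
    refine isBundleMap_pi fun i => Fin.addCases (fun i => ?_) (fun i => ?_) i
    · simp only [Fin.append_left]
      exact isBundleMap_comp h.isBundleMap (isBundleMap_comp (isBundleMap_proj _ i)
        (isBundleMap_fst _ _))
    · simp only [Fin.append_right]
      exact isBundleMap_comp h'.isBundleMap (isBundleMap_comp (isBundleMap_proj _ i)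
        (isBundleMap_snd _ _))
  injective := fun x y hxy => Prod.ext
    (funext fun i => h.injective (by simpa using congrFun hxy (Fin.castAdd l i)))
    (funext fun i => h'.injective (by simpa using congrFun hxy (Fin.natAdd k i)))
  injective_tot := fun x y hxy => Prod.ext
    (funext fun i => h.injective_tot (by simpa using congrFun hxy (Fin.castAdd l i)))
    (funext fun i => h'.injective_tot (by simpa using congrFun hxy (Fin.natAdd k i)))
  exists_of_proj := fun f x hf => by
    choose a ha using fun i => h.exists_of_proj (f (Fin.castAdd l i)) (x.1 i)
      ((congrFun hf (Fin.castAdd l i)).trans (Fin.append_left _ _ i))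
    choose c hc using fun i => h'.exists_of_proj (f (Fin.natAdd k i)) (x.2 i)
      ((congrFun hf (Fin.natAdd k i)).trans (Fin.append_right _ _ i))
    refine ⟨(a, c), ?_⟩
    simp only [ha, hc]
    exact Fin.append_castAdd_natAdd
  lift := fun α β hαβ => by
    refine isBundleMap_prodMk (isBundleMap_pi fun i => h.lift _ _ ?_)
      (isBundleMap_pi fun i => h'.lift _ _ ?_)
    · exact (isBundleMap_comp (isBundleMap_proj _ (Fin.castAdd l i)) hαβ).congr
        (fun x => (Fin.append_left (fun i => ψ ((α x).1 i)) (fun i => φ ((α x).2 i)) i).symm)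
        (fun e => (Fin.append_left (fun i => Ψ ((β e).1 i)) (fun i => Φ ((β e).2 i)) i).symm)
    · exact (isBundleMap_comp (isBundleMap_proj _ (Fin.natAdd k i)) hαβ).congr
        (fun x => (Fin.append_right (fun i => ψ ((α x).1 i)) (fun i => φ ((α x).2 i)) i).symm)
        (fun e => (Fin.append_right (fun i => Ψ ((β e).1 i)) (fun i => Φ ((β e).2 i)) i).symm)

end append

/-- The corestriction of an embedding, remembered only through its composite with the inclusion. -/
theorem VBundle.IsInitial.exists_restrict {X Y : QPVariety} {E : VBundle X} {F : VBundle Y}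
    {ψ : X.pts → Y.pts} {Ψ : E.tot → F.tot} (h : IsInitial E F ψ Ψ) {S : Set Y.pts}
    (hS : IsLocallyClosed S) (hψ : ∀ x, ψ x ∈ S) :
    ∃ (f : X.pts → (Y.sub S hS).pts) (A : E.tot → (F.restrict S hS).tot),
      IsInitial E (F.restrict S hS) f A ∧ (∀ x, (f x).1 = ψ x) ∧ ∀ e, (A e).1 = Ψ e :=
  ⟨fun x => ⟨ψ x, hψ x⟩, fun e => ⟨Ψ e, by rw [h.isBundleMap.2.1]; exact hψ _⟩,
    (IsInitial.val F S hS).of_comp h, fun _ => rfl, fun _ => rfl⟩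

/-! ### Cutting powers along an invariant closed subvariety -/

namespace GBundle

variable {G : Type} [Group G]

theorem mem_iff_smul_mem {X : GBundle G} {S : Set X.base.pts}
    (hG : ∀ (g : G), ∀ x ∈ S, g • x ∈ S) (g : G) (x : X.base.pts) : g • x ∈ S ↔ x ∈ S :=
  ⟨fun h => by simpa using hG g⁻¹ _ h, hG g x⟩

/-- The number of entries of a tuple that lie in `S`. -/
def entries {T : Type} (S : Set T) {n : ℕ} (x : Fin n → T) : ℕ := {i | x i ∈ S}.ncard

/-- Since `S` is invariant, the group components change nothing, and the permutation only moves the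
set of positions of the entries in `S`. -/
theorem entries_smul {X : GBundle G} {S : Set X.base.pts}
    (hG : ∀ (g : G), ∀ x ∈ S, g • x ∈ S) {n : ℕ} (w : Wreath G n) (x : (X.power n).base.pts) :
    entries S (w • x : (X.power n).base.pts) = entries S x := by
  have h : {i | (show Fin n → X.base.pts from w • x) i ∈ S} =
      w.right '' {i | (show Fin n → X.base.pts from x) i ∈ S} := by
    ext i
    rw [Equiv.image_eq_preimage_symm]
    exact mem_iff_smul_mem hG (w.left i) _
  exact (congrArg Set.ncard h).trans (Set.ncard_image_of_injective _ w.right.injective)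

/-- An entry outside the closed set `S` stays outside nearby, so the number of entries in `S` is
upper semicontinuous. -/
theorem isOpen_entries_lt {X : QPVariety} {S : Set X.pts} (hS : IsClosed S) (n m : ℕ) :
    IsOpen {x : (QPVariety.pi fun _ : Fin n => X).pts | entries S x < m} := by
  refine isOpen_iff_mem_nhds.mpr fun x hx => ?_
  have h : ∀ i, ∀ᶠ y : (QPVariety.pi fun _ : Fin n => X).pts in nhds x, y i ∈ S → x i ∈ S := by
    intro i
    by_cases hi : x i ∈ S
    · exact Filter.Eventually.of_forall fun _ _ => hi
    · filter_upwards [(hS.isOpen_compl.preimage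
        (QPVariety.isRegularMap_proj (fun _ : Fin n => X) i).1).mem_nhds (x := x) hi] with y hy hy'
      exact (hy hy').elim
  filter_upwards [Filter.eventually_all.mpr h] with y hy
  exact (Set.ncard_le_ncard (fun i hi => hy i hi) (Set.toFinite _)).trans_lt hx

theorem isLocallyClosed_entries {X : QPVariety} {S : Set X.pts} (hS : IsClosed S) (n m : ℕ) :
    IsLocallyClosed {x : (QPVariety.pi fun _ : Fin n => X).pts | entries S x = m} := by
  refine (congrArg IsLocallyClosed (Set.ext fun x => ?_)).mpr
    ((isOpen_entries_lt hS n (m + 1)).isLocallyClosed.inter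
      (isOpen_entries_lt hS n m).isClosed_compl.isLocallyClosed)
  change entries S x = m ↔ entries S x < m + 1 ∧ ¬ entries S x < m
  omega

theorem entries_append {T : Type} {S : Set T} {k l : ℕ} {a : Fin k → T} {c : Fin l → T}
    (ha : ∀ i, a i ∈ S) (hc : ∀ i, c i ∉ S) : entries S (Fin.append a c) = k := by
  have h : {i | Fin.append a c i ∈ S} = Set.range (Fin.castAdd l) := by
    ext i
    refine Fin.addCases (fun i => ?_) (fun i => ?_) i
    · simp [ha]
    · simp only [Set.mem_ofPred_eq, Fin.append_right, hc, false_iff]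
      rintro ⟨j, hj⟩
      have := congrArg Fin.val hj
      simp only [Fin.val_castAdd, Fin.val_natAdd] at this
      omega
  rw [entries, h, Set.ncard_range_of_injective (Fin.castAdd_injective k l), Nat.card_fin]

/-- The `k` entries in `S` must occupy positions of the first block, which has only `k` positions,
so they fill it. -/
theorem castAdd_mem_of_entries {T : Type} {S : Set T} {k l : ℕ} {x : Fin (k + l) → T}
    (hx : entries S x = k) (h : ∀ i, x (Fin.natAdd k i) ∉ S) (i : Fin k) :
    x (Fin.castAdd l i) ∈ S := by
  have h1 : {i | x i ∈ S} ⊆ Set.range (Fin.castAdd l) := by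
    intro i
    refine Fin.addCases (fun i _ => ⟨i, rfl⟩) (fun i hi => (h i hi).elim) i
  have h2 := Set.eq_of_subset_of_ncard_le h1 (by
    rw [Set.ncard_range_of_injective (Fin.castAdd_injective k l), Nat.card_fin]
    exact hx.ge)
  have h3 : Fin.castAdd l i ∈ {i | x i ∈ S} := h2 ▸ ⟨i, rfl⟩
  exact h3

section pieces

variable {X : GBundle G} {S : Set X.base.pts}

/-- A point of `S` and a point outside `S` never share an orbit, so the condition of different
orbits only concerns pairs within one block. This makes the series of configuration spaces
multiplicative as well. -/
theorem append_mem_powSet_iff (hG : ∀ (g : G), ∀ x ∈ S, g • x ∈ S) {b : Bool} {k l : ℕ}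
    {a : Fin k → X.base.pts} {c : Fin l → X.base.pts} (ha : ∀ i, a i ∈ S) (hc : ∀ i, c i ∉ S) :
    Fin.append a c ∈ X.powSet b (k + l) ↔ a ∈ X.powSet b k ∧ c ∈ X.powSet b l := by
  change (_ ∨ _) ↔ (_ ∨ _) ∧ (_ ∨ _)
  rw [← or_and_left]
  refine or_congr Iff.rfl ⟨fun h => ⟨fun i j hij g => ?_, fun i j hij g => ?_⟩,
    fun h i j => ?_⟩
  · have := h (Fin.castAdd l i) (Fin.castAdd l j)
      (fun h => hij (Fin.castAdd_injective k l h)) g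
    rwa [Fin.append_left, Fin.append_left] at this
  · have := h (Fin.natAdd k i) (Fin.natAdd k j)
      (fun h => hij (Fin.natAdd_injective l k h)) g
    rwa [Fin.append_right, Fin.append_right] at this
  · refine Fin.addCases (fun i => ?_) (fun i => ?_) i <;>
      refine Fin.addCases (fun j => ?_) (fun j => ?_) j <;> intro hij g <;>
      simp only [Fin.append_left, Fin.append_right]
    · exact h.1 i j (fun h => hij (congrArg _ h)) g
    · exact fun he => hc j (he ▸ hG g _ (ha i))
    · exact fun he => hc i ((mem_iff_smul_mem hG g _).mp (he ▸ ha j))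
    · exact h.2 i j (fun h => hij (congrArg _ h)) g

theorem val_mem_powSet_iff {T : Set X.base.pts} {hT : IsLocallyClosed T}
    {hTG : ∀ (g : G), ∀ x ∈ T, g • x ∈ T} {b : Bool} {k : ℕ} {x : Fin k → T} :
    x ∈ (X.restrict T hT hTG).powSet b k ↔ (fun i => (x i).1) ∈ X.powSet b k := by
  refine or_congr Iff.rfl (forall_congr' fun i => forall_congr' fun j => forall_congr' fun _ =>
    forall_congr' fun g => not_congr ?_)
  exact Subtype.ext_iff

variable [Finite G]

theorem isLocallyClosed_piece (hS : IsClosed S) (b : Bool) (n m : ℕ) :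
    IsLocallyClosed {x : (X.pow b n).base.pts | entries S x.1 = m} :=
  (isLocallyClosed_entries hS n m).preimage (QPVariety.isRegularMap_val (X := (X.power n).base) _
    (isOpen_powSet b X n).isLocallyClosed).1

theorem smul_mem_piece (hG : ∀ (g : G), ∀ x ∈ S, g • x ∈ S) (b : Bool) (n m : ℕ)
    (w : Wreath G n) (x : (X.pow b n).base.pts) (hx : entries S x.1 = m) :
    entries S (w • x).1 = m :=
  (entries_smul hG w x.1).trans hx

variable (hS : IsClosed S) (hG : ∀ (g : G), ∀ x ∈ S, g • x ∈ S)

/-- The restriction to a closed subvariety. -/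
abbrev closedPart : GBundle G := X.restrict S hS.isLocallyClosed hG

/-- The restriction to the complement of a closed subvariety. -/
abbrev openPart : GBundle G :=
  X.restrict Sᶜ hS.isOpen_compl.isLocallyClosed (X.smul_mem_compl hG)

/-- The concatenation of the two inclusions is an embedding into the power of `X`. It lands first in
the tuples allowed by `b` and then in those with exactly `k` entries in `S`, so it is corestricted
twice. -/
theorem exists_initial_append (b : Bool) (k l : ℕ) :
    ∃ (f : (((closedPart hS hG).pow b k).prod ((openPart hS hG).pow b l)).base.pts →
        ((X.pow b (k + l)).restrict _ (isLocallyClosed_piece hS b (k + l) k)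
          (smul_mem_piece hG b (k + l) k)).base.pts)
      (F : (((closedPart hS hG).pow b k).prod ((openPart hS hG).pow b l)).bundle.tot →
        ((X.pow b (k + l)).restrict _ (isLocallyClosed_piece hS b (k + l) k)
          (smul_mem_piece hG b (k + l) k)).bundle.tot),
      IsInitial (((closedPart hS hG).pow b k).prod ((openPart hS hG).pow b l)).bundle
        ((X.pow b (k + l)).restrict _ (isLocallyClosed_piece hS b (k + l) k)
          (smul_mem_piece hG b (k + l) k)).bundle f F ∧
      (∀ x, (f x).1.1 = Fin.append (fun i => (x.1.1 i).1) (fun i => (x.2.1 i).1)) ∧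
      ∀ x, (F x).1.1 = Fin.append (fun i => (x.1.1 i).1) (fun i => (x.2.1 i).1) := by
  have h := ((IsInitial.val X.bundle S hS.isLocallyClosed).append (k := k) (l := l)
    (IsInitial.val X.bundle Sᶜ hS.isOpen_compl.isLocallyClosed)).comp
      ((IsInitial.val ((closedPart hS hG).power k).bundle (powSet b _ k)
        (isOpen_powSet b _ k).isLocallyClosed).prodMap
      (IsInitial.val ((openPart hS hG).power l).bundle (powSet b _ l)
        (isOpen_powSet b _ l).isLocallyClosed))
  obtain ⟨f, F, hi, hf, hF⟩ := h.exists_restrict (isOpen_powSet b X (k + l)).isLocallyClosed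
    fun x => (append_mem_powSet_iff hG (fun i => (x.1.1 i).2) (fun i => (x.2.1 i).2)).mpr
          ⟨val_mem_powSet_iff.mp x.1.2, val_mem_powSet_iff.mp x.2.2⟩
  obtain ⟨f', F', hi', hf', hF'⟩ := hi.exists_restrict (isLocallyClosed_piece hS b (k + l) k)
    fun x => (congrArg (entries S) (hf x)).trans
      (entries_append (fun i => (x.1.1 i).2) (fun i => (x.2.1 i).2))
  exact ⟨f', F', hi', fun x => (congrArg Subtype.val (hf' x)).trans (hf x),
    fun x => (congrArg Subtype.val (hF' x)).trans (hF x)⟩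

/-- The geometric core of multiplicativity. Among the tuples with exactly `k` entries in `S`, the
image consists of those whose entries in `S` occupy the first block. Permutations bring every tuple
to this form, and an element of the wreath product that carries one such tuple to another must
preserve the blocks. -/
theorem exists_isInd_append (b : Bool) (k l : ℕ) :
    ∃ (f : (((closedPart hS hG).pow b k).prod ((openPart hS hG).pow b l)).base.pts →
        ((X.pow b (k + l)).restrict _ (isLocallyClosed_piece hS b (k + l) k)
          (smul_mem_piece hG b (k + l) k)).base.pts)
      (F : (((closedPart hS hG).pow b k).prod ((openPart hS hG).pow b l)).bundle.tot →
        ((X.pow b (k + l)).restrict _ (isLocallyClosed_piece hS b (k + l) k)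
          (smul_mem_piece hG b (k + l) k)).bundle.tot),
      IsInd (wreathAppend G k l) f F := by
  obtain ⟨f, F, hi, hf, hF⟩ := exists_initial_append hS hG b k l
  -- As the number of entries in `S` is fixed, it suffices that the second block avoids `S`. This is
  -- an open condition, which gives openness of the image although `S` itself is only closed.
  have hrange : ∀ y, (∀ i, y.1.1 (Fin.natAdd k i) ∉ S) → ∃ x, f x = y := by
    intro y hy
    have hy' : ∀ i, y.1.1 (Fin.castAdd l i) ∈ S := castAdd_mem_of_entries y.2 hy
    have h1 : Fin.append (fun i => y.1.1 (Fin.castAdd l i)) (fun i => y.1.1 (Fin.natAdd k i)) =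
      y.1.1 := Fin.append_castAdd_natAdd
    have h2 := (append_mem_powSet_iff (b := b) hG hy' hy).mp (by rw [h1]; exact y.1.2)
    refine ⟨(⟨fun i => ⟨_, hy' i⟩, val_mem_powSet_iff.mpr h2.1⟩,
      ⟨fun i => ⟨_, hy i⟩, val_mem_powSet_iff.mpr h2.2⟩), Subtype.ext (Subtype.ext ?_)⟩
    exact (hf _).trans h1
  have hright : ∀ x i, (f x).1.1 (Fin.natAdd k i) ∉ S := fun x i => by
    rw [hf, Fin.append_right]
    exact (x.2.1 i).2
  have hleft : ∀ x i, (f x).1.1 (Fin.castAdd l i) ∈ S := fun x i => by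
    rw [hf, Fin.append_left]
    exact (x.1.1 i).2
  refine ⟨f, F, wreathAppend_injective, hi, fun w x => ?_, fun w x => ?_, ?_, fun y => ?_,
    fun w x x' hx => mem_range_wreathAppend fun i => ?_⟩
  · refine Subtype.ext (Subtype.ext ((hf _).trans (funext fun i => ?_)))
    refine (append_smul (T := X.base.pts) w (fun i => (x.1.1 i).1) (fun i => (x.2.1 i).1) i).trans ?_
    rw [← hf]
    rfl
  · refine Subtype.ext (Subtype.ext ((hF _).trans (funext fun i => ?_)))
    refine (append_smul (T := X.bundle.tot) w (fun i => (x.1.1 i).1) (fun i => (x.2.1 i).1)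
      i).trans ?_
    rw [← hF]
    rfl
  · have h1 : IsOpen (⋂ i : Fin l, {y : ((X.pow b (k + l)).restrict _
        (isLocallyClosed_piece hS b (k + l) k) (smul_mem_piece hG b (k + l) k)).base.pts |
          y.1.1 (Fin.natAdd k i) ∈ Sᶜ}) :=
      isOpen_iInter_of_finite fun i => hS.isOpen_compl.preimage
        ((QPVariety.isRegularMap_proj (fun _ : Fin (k + l) => X.base) (Fin.natAdd k i)).1.comp
          ((QPVariety.isRegularMap_val (X := (X.power (k + l)).base) _
            (isOpen_powSet b X (k + l)).isLocallyClosed).1.comp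
            (QPVariety.isRegularMap_val (X := (X.pow b (k + l)).base) _
              (isLocallyClosed_piece hS b (k + l) k)).1))
    refine (congrArg IsOpen (Set.ext fun y => ?_)).mpr h1
    rw [Set.mem_iInter]
    constructor
    · rintro ⟨x, rfl⟩
      exact hright x
    · exact hrange y
  -- Here `σ` maps the first block onto the positions of the entries in `S`; undoing it collects
  -- these entries in the first block.
  · obtain ⟨σ, h1, h2⟩ := exists_perm_of_ncard (l := l) y.2
    let w : Wreath G (k + l) := ⟨1, σ⟩
    obtain ⟨x, hx⟩ := hrange (w⁻¹ • y) fun i => by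
      intro h3
      refine h2 i ((mem_iff_smul_mem hG (w⁻¹.left (Fin.natAdd k i)) _).mp ?_)
      exact h3
    exact ⟨w, x, by rw [hx, smul_inv_smul]⟩
  · have h1 : w.left (Fin.castAdd l i) • (f x).1.1 (w.right⁻¹ (Fin.castAdd l i)) =
        (f x').1.1 (Fin.castAdd l i) := congrFun (congrArg (fun y => y.1.1) hx) _
    -- The entry moved to a position of the first block lies in `S`, so it cannot have come from the
    -- second block.
    have h2 := (mem_iff_smul_mem hG _ _).mp (h1 ▸ hleft x' i)
    revert h2
    refine Fin.addCases (fun j _ => ⟨j, rfl⟩) (fun j hj => ?_) (w.right⁻¹ (Fin.castAdd l i))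
    exact (hright x j hj).elim

theorem cls_piece (b : Bool) {n k l : ℕ} (h : k + l = n) :
    (Triple.of ((X.pow b n).restrict _ (isLocallyClosed_piece hS b n k)
      (smul_mem_piece hG b n k))).cls =
    K0.mulHom (Triple.of ((closedPart hS hG).pow b k)).cls
      (Triple.of ((openPart hS hG).pow b l)).cls := by
  subst h
  obtain ⟨f, F, h⟩ := exists_isInd_append hS hG b k l
  rw [K0.mulHom_cls]
  exact (Triple.cls_isAdditive.ind h).symm

/-- The number of entries in `S` partitions the power into locally closed invariant pieces, each of
which is induced from a product. The sum is the coefficient of a product of two power series. -/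
theorem cls_pow_cut (b : Bool) (n : ℕ) :
    (Triple.of (X.pow b n)).cls = ∑ p ∈ Finset.HasAntidiagonal.antidiagonal n,
      K0.mulHom (Triple.of ((closedPart hS hG).pow b p.1)).cls
        (Triple.of ((openPart hS hG).pow b p.2)).cls := by
  have h := Triple.cls_isAdditive.eq_finsum (X := X.pow b n)
    -- Indexed by pairs with sum `n`, to match the coefficient formula for products of power series;
    -- the second member is determined by the first.
    (P := {p // p ∈ Finset.HasAntidiagonal.antidiagonal n}) (fun p => {x | entries S x.1 = p.1.1})
    (fun p => isLocallyClosed_piece hS b n p.1.1) (fun p => smul_mem_piece hG b n p.1.1)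
    fun x => by
      have hx : entries S x.1 ≤ n := (Set.ncard_le_card _).trans_eq (Nat.card_fin n)
      refine ⟨⟨(entries S x.1, n - entries S x.1), ?_⟩, rfl, ?_⟩
      · rw [Finset.HasAntidiagonal.mem_antidiagonal]
        omega
      · rintro ⟨⟨k, l⟩, hkl⟩ hk
        rw [Finset.HasAntidiagonal.mem_antidiagonal] at hkl
        obtain rfl : entries S x.1 = k := hk
        refine Subtype.ext (Prod.ext rfl ?_)
        change l = n - entries S x.1
        omega
  rw [h, finsum_eq_sum_of_fintype]
  refine (Finset.sum_congr rfl fun p _ => cls_piece hS hG b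
    (Finset.HasAntidiagonal.mem_antidiagonal.mp p.2)).trans ?_
  exact Finset.sum_coe_sort (Finset.HasAntidiagonal.antidiagonal n) fun p : ℕ × ℕ =>
    K0.mulHom (Triple.of ((closedPart hS hG).pow b p.1)).cls
      (Triple.of ((openPart hS hG).pow b p.2)).cls

end pieces

/-- The piece indexed by `true` is open and closed, so this is one application of the scissor
relation. An arbitrary family over `Bool` keeps the conditional of `disjUnion` out of the proof. -/
theorem cls_sigma [Finite G] (Z : Bool → GBundle G) :
    (Triple.of (sigma Z)).cls = (Triple.of (Z true)).cls + (Triple.of (Z false)).cls := by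
  have hS : IsClosed {y : (sigma Z).base.pts | y.1 = true} := by
    refine isOpen_compl_iff.mp (QPVariety.isOpen_sigma fun j => ?_)
    exact isOpen_const (p := ¬ j = true)
  have hG : ∀ (g : G), ∀ x ∈ {y : (sigma Z).base.pts | y.1 = true},
      g • x ∈ {y : (sigma Z).base.pts | y.1 = true} := fun _ _ h => h
  refine (Triple.cls_isAdditive.closed (sigma Z) _ hS hG).trans
    (congrArg₂ (· + ·) (Triple.cls_isAdditive.iso ?_).symm (Triple.cls_isAdditive.iso ?_).symm)
  · refine Triple.Iso.restrict_range (MulEquiv.refl G)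
      (IsInitial.inc (E := fun j => (Z j).bundle) true) (fun _ _ => rfl) (fun _ _ => rfl) _ hG
      fun y => ⟨fun hy => ?_, fun ⟨x, hx⟩ => hx ▸ rfl⟩
    obtain ⟨j, y⟩ := y
    obtain rfl : j = true := hy
    exact ⟨y, rfl⟩
  · refine Triple.Iso.restrict_range (MulEquiv.refl G)
      (IsInitial.inc (E := fun j => (Z j).bundle) false) (fun _ _ => rfl) (fun _ _ => rfl) _
      ((sigma Z).smul_mem_compl hG)
      fun y => ⟨fun hy => ?_, fun ⟨x, hx⟩ => hx ▸ Bool.false_ne_true⟩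
    obtain ⟨j, y⟩ := y
    obtain rfl : j = false := Bool.eq_false_of_not_eq_true hy
    exact ⟨y, rfl⟩

theorem cls_disjUnion [Finite G] (X Y : GBundle G) :
    (Triple.of (X.disjUnion Y)).cls = (Triple.of X).cls + (Triple.of Y).cls :=
  cls_sigma fun b : Bool => if b then X else Y

end GBundle

/-! ### The generating series and the λ-structures -/

section series

attribute [local instance] K0.commRing

/-- The generating series of the classes of the powers or of the configuration spaces. -/
def powSeries (b : Bool) (X : Triple) : PowerSeries K0 :=
  PowerSeries.mk fun n => (Triple.of (X.obj.pow b n)).cls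

theorem coeff_zero_powSeries (b : Bool) (X : Triple) :
    PowerSeries.coeff 0 (powSeries b X) = 1 := by
  rw [powSeries, PowerSeries.coeff_mk, GBundle.cls_pow_zero]
  rfl

theorem coeff_one_powSeries (b : Bool) (X : Triple) :
    PowerSeries.coeff 1 (powSeries b X) = X.cls := by
  rw [powSeries, PowerSeries.coeff_mk, GBundle.cls_pow_one]

theorem zeta_eq_powSeries {G : Type} [Group G] [Finite G] (X : GBundle G) :
    zeta X = powSeries true (Triple.of X) := by
  ext n
  rw [zeta, powSeries, PowerSeries.coeff_mk, PowerSeries.coeff_mk]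
  -- The constant term is set to 1 by definition; it agrees with the class of the zeroth power,
  -- which is that of the point.
  split_ifs with h
  · rw [h, GBundle.cls_pow_zero]
    rfl
  · exact X.cls_power n

theorem lam_eq_powSeries {G : Type} [Group G] [Finite G] (X : GBundle G) :
    lam X = powSeries false (Triple.of X) := by
  ext n
  rw [lam, powSeries, PowerSeries.coeff_mk, PowerSeries.coeff_mk]
  split_ifs with h
  · rw [h, GBundle.cls_pow_zero]
    rfl
  · exact X.cls_config n

/-- The generating series as a unit of the ring of power series. -/
def powUnit (b : Bool) (X : Triple) : (PowerSeries K0)ˣ :=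
  (PowerSeries.isUnit_iff_constantCoeff.mpr (by
    rw [← PowerSeries.coeff_zero_eq_constantCoeff_apply, coeff_zero_powSeries]
    exact isUnit_one) : IsUnit (powSeries b X)).unit

/-- With the unit group of the power series ring written additively, multiplicativity of the series
becomes additivity. Invariance comes from `IsInd.pow`, the scissor relation from `cls_pow_cut`. -/
theorem isAdditive_powUnit (b : Bool) :
    IsAdditive fun X : Triple => Additive.ofMul (powUnit b X) where
  ind := fun h => by
    refine congrArg Additive.ofMul (Units.ext (PowerSeries.ext fun n => ?_))
    change PowerSeries.coeff n (powSeries b _) = PowerSeries.coeff n (powSeries b _)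
    rw [powSeries, powSeries, PowerSeries.coeff_mk, PowerSeries.coeff_mk]
    exact Triple.cls_isAdditive.ind (h.pow b n)
  closed := fun X S hS hG => by
    rw [← ofMul_mul]
    refine congrArg Additive.ofMul (Units.ext (PowerSeries.ext fun n => ?_))
    change PowerSeries.coeff n (powSeries b _) = PowerSeries.coeff n (powSeries b _ * powSeries b _)
    rw [PowerSeries.coeff_mul]
    simp only [powSeries, PowerSeries.coeff_mk]
    exact GBundle.cls_pow_cut hS hG b n

/-- The `λ`-structure given by the powers or by the configuration spaces. -/
def powLambda (b : Bool) (a : K0) : PowerSeries K0 :=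
  (Additive.toMul (K0.lift _ (isAdditive_powUnit b) a) : (PowerSeries K0)ˣ)

theorem powLambda_cls (b : Bool) (X : Triple) : powLambda b X.cls = powSeries b X := by
  rw [powLambda, K0.lift_cls]
  rfl

theorem powLambda_add (b : Bool) (x y : K0) :
    powLambda b (x + y) = powLambda b x * powLambda b y := by
  rw [powLambda, map_add]
  rfl

theorem powLambda_zero (b : Bool) : powLambda b 0 = 1 := by
  rw [powLambda, map_zero]
  rfl

/-- The extension to K takes values in all units of the power series ring; constant term 1 is
checked on triples and survives products and inverses. -/
theorem powLambda_coeff_zero (b : Bool) (a : K0) :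
    PowerSeries.coeff 0 (powLambda b a) = 1 := by
  induction a using K0.induction_on with
  | cls X => rw [powLambda_cls, coeff_zero_powSeries]
  | zero => simp [powLambda_zero]
  | add x y hx hy =>
    simp only [PowerSeries.coeff_zero_eq_constantCoeff] at hx hy ⊢
    rw [powLambda_add, map_mul, hx, hy, one_mul]
  | neg x hx =>
    have h := congrArg (PowerSeries.coeff 0) (powLambda_add b (-x) x)
    rw [neg_add_cancel, powLambda_zero] at h
    simp only [PowerSeries.coeff_zero_eq_constantCoeff, map_mul, map_one] at hx h ⊢
    rw [hx, mul_one] at h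
    exact h.symm

/-- Since constant terms are 1, the linear coefficient of a product is the sum of the linear
coefficients. It is therefore an additive map on K, and it is the identity on classes of triples. -/
theorem powLambda_coeff_one (b : Bool) (a : K0) :
    PowerSeries.coeff 1 (powLambda b a) = a := by
  have hadd : ∀ x y, PowerSeries.coeff 1 (powLambda b (x + y)) =
      PowerSeries.coeff 1 (powLambda b x) + PowerSeries.coeff 1 (powLambda b y) := by
    intro x y
    rw [powLambda_add, PowerSeries.coeff_mul, Finset.Nat.antidiagonal_succ]
    simp [powLambda_coeff_zero, add_comm]
  have : AddMonoidHom.mk' (fun a => PowerSeries.coeff 1 (powLambda b a)) hadd =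
      AddMonoidHom.id K0 := K0.hom_ext fun X => by
    change PowerSeries.coeff 1 (powLambda b X.cls) = X.cls
    rw [powLambda_cls, coeff_one_powSeries]
  exact DFunLike.congr_fun this a

theorem isLambdaStructure_powLambda (b : Bool) : IsLambdaStructure (powLambda b) where
  coeff_zero := powLambda_coeff_zero b
  coeff_one := powLambda_coeff_one b
  map_add := powLambda_add b

theorem IsLambdaStructure.isUnit {L : K0 → PowerSeries K0} (h : IsLambdaStructure L) (a : K0) :
    IsUnit (L a) := by
  rw [PowerSeries.isUnit_iff_constantCoeff, ← PowerSeries.coeff_zero_eq_constantCoeff_apply,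
    h.coeff_zero]
  exact isUnit_one

theorem IsLambdaStructure.map_zero {L : K0 → PowerSeries K0} (h : IsLambdaStructure L) :
    L 0 = 1 := by
  have h1 := h.map_add 0 0
  rw [add_zero] at h1
  exact (h.isUnit 0).mul_left_cancel (h1.symm.trans (mul_one _).symm)

/-- Classes of triples generate K, and the value at a negative is forced because all values are
units. -/
theorem IsLambdaStructure.ext {L M : K0 → PowerSeries K0} (h : IsLambdaStructure L)
    (h' : IsLambdaStructure M) (hc : ∀ X : Triple, L X.cls = M X.cls) : L = M := by
  funext a
  induction a using K0.induction_on with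
  | cls X => exact hc X
  | zero => rw [h.map_zero, h'.map_zero]
  | add x y hx hy => rw [h.map_add, h'.map_add, hx, hy]
  | neg x hx =>
    have h1 := h.map_add (-x) x
    have h2 := h'.map_add (-x) x
    rw [neg_add_cancel, h.map_zero] at h1
    rw [neg_add_cancel, h'.map_zero, ← hx] at h2
    exact (h.isUnit x).mul_right_cancel (h1.symm.trans h2)

theorem powLambda_unique (b : Bool) {L : K0 → PowerSeries K0} (h : IsLambdaStructure L)
    (hc : ∀ (G : Type) [Group G] [Finite G] (X : GBundle G),
      L (Triple.of X).cls = powSeries b (Triple.of X)) : L = powLambda b :=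
  h.ext (isLambdaStructure_powLambda b) fun X => (hc X.G X.obj).trans (powLambda_cls b X).symm

end series

end FGr

end

/-! ### The main theorem -/

theorem mainTheorem9 :
    (∃! R : CommRing K0, IsCartesianRing R) ∧
    ∀ [R : CommRing K0], IsCartesianRing R →
      (∀ (G G' : Type) [Group G] [Finite G] [Group G'] [Finite G']
        (X : GBundle G) (X' : GBundle G'), (Triple.of X).cls = (Triple.of X').cls →
          zeta X = zeta X' ∧ lam X = lam X') ∧
      (∀ (G : Type) [Group G] [Finite G] (X₁ X₂ : GBundle G),
          zeta (X₁.disjUnion X₂) = zeta X₁ * zeta X₂ ∧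
          lam (X₁.disjUnion X₂) = lam X₁ * lam X₂) ∧
      (∃! L : K0 → PowerSeries K0, IsLambdaStructure L ∧
        ∀ (G : Type) [Group G] [Finite G] (X : GBundle G), L (Triple.of X).cls = zeta X) ∧
      (∃! L : K0 → PowerSeries K0, IsLambdaStructure L ∧
        ∀ (G : Type) [Group G] [Finite G] (X : GBundle G), L (Triple.of X).cls = lam X) := by
  refine ⟨⟨K0.commRing, K0.isCartesianRing_commRing, K0.eq_commRing⟩, ?_⟩
  intro R hR
  -- By uniqueness the given ring structure is the constructed one, for which all the series were
  -- computed.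
  obtain rfl := K0.eq_commRing R hR
  simp only [zeta_eq_powSeries, lam_eq_powSeries]
  refine ⟨fun G G' _ _ _ _ X X' h => ?_, fun G _ _ X₁ X₂ => ?_, ?_, ?_⟩
  -- Both series are values of a function on K at the class of the triple.
  · simp only [← powLambda_cls, h, and_self]
  · simp only [← powLambda_cls, GBundle.cls_disjUnion]
    exact ⟨powLambda_add _ _ _, powLambda_add _ _ _⟩
  · exact ⟨powLambda true, ⟨isLambdaStructure_powLambda true, fun G _ _ X => powLambda_cls _ _⟩,
      fun L hL => powLambda_unique true hL.1 hL.2⟩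
  · exact ⟨powLambda false, ⟨isLambdaStructure_powLambda false, fun G _ _ X => powLambda_cls _ _⟩,
      fun L hL => powLambda_unique false hL.1 hL.2⟩
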